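/- Let $d\ge 2$ and let $G=(\mathbb R\rtimes\mathbb R_+)\times \mathrm{SO}(d)$, with product $(b,a,R)(b',a',R')=(b+ab',aa',RR')$ and left Haar measure $dg=db\,\frac{da}{a^2}\,dR$, where $dR$ is the Haar measure of $\mathrm{SO}(d)$ of total mass $1$. Let $\pi$ be the Schrödinger representation of $G$ on $L^2(\mathbb R^d)$, \[ \pi(b,a,R)=e^{i\frac{b}{2\pi}\Delta}\,V(a,R),\qquad V(a,R)f(x)=a^{-d/4}f(a^{-1/2}R^{-1}x), \] where $e^{i\frac{b}{2\pi}\Delta}$ is the unitary operator which, under the Fourier transform $\mathcal F f(\xi)=\int f(x)e^{-2\pi i x\cdot\xi}\,dx$, becomes multiplication by $e^{-2\pi i b\,\xi\cdot\xi}$. A vector $\eta\in L^2(\mathbb R^d)$ is called admissible for $\pi$ if $\|f\|^2=\int_G|\langle f,\pi(g)\eta\rangle|^2\,dg$ for every $f\in L^2(\mathbb R^d)$. Let $S^{d-1}$ carry its Riemannian measure and let $\rho(R)\varphi(s)=\varphi(R^{-1}s)$ be the regular representation of $\mathrm{SO}(d)$ on $L^2(S^{d-1})$. Define an orthogonal family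 $(\mathcal H_k)_{k\in I}$ of finite-dimensional $\rho$-invariant subspaces of $L^2(S^{d-1})$ as follows: if $d\ge3$, then $I=\mathbb N=\{0,1,2,\dots\}$ and $\mathcal H_k$ is the space of spherical harmonics of degree $k$, that is, of restrictions to $S^{d-1}$ of complex harmonic polynomials in $d$ variables, homogeneous of degree $k$; if $d=2$, then $I=\mathbb Z$ and $\mathcal H_k$ is spanned by the function $(\cos\theta,\sin\theta)\mapsto e^{ik\theta}$. Let $P_k$ be the orthogonal projection of $L^2(S^{d-1})$ onto $\mathcal H_k$, let $\rho_k$ be the restriction of $\rho$ to $\mathcal H_k$, and let $d_k=\dim\mathcal H_k$. On $L^2((0,\infty),\mathcal H_k)=L^2((0,\infty))\otimes\mathcal H_k$ let \[ (\widehat W^+\otimes\rho_k)(b,a,R)\varphi(\omega)=a^{1/2}e^{-2\pi i b\omega}\rho_k(R)\,\varphi(a\omega). \] For $f\in L^2(\mathbb R^d)$ set \[ (Sf)_k(\omega)=P_k\Big(s\mapsto \tfrac{\omega^{(d-2)/4}}{\sqrt2}\,(\mathcal F f)(\sqrt\omega\, s)\Big)\quad\text{for a.e. }\omega>0,\ k\in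 I. \] Then $S$ is a unitary operator from $L^2(\mathbb R^d)$ onto the Hilbert sum $\bigoplus_{k\in I}L^2((0,\infty),\mathcal H_k)$, and \[ S\pi(g)S^{-1}=\bigoplus_{k\in I}(\widehat W^+\otimes\rho_k)(g)\qquad (g\in G). \] Each representation $\widehat W^+\otimes\rho_k$ of $G$ is irreducible, and $\widehat W^+\otimes\rho_k$ and $\widehat W^+\otimes\rho_l$ are not unitarily equivalent if $k\ne l$. A vector $\eta\in L^2(\mathbb R^d)$ is admissible for $\pi$ if and only if \[ \int_0^\infty \|(S\eta)_k(\omega)\|_{\mathcal H_k}^2\,\frac{d\omega}{\omega}=d_k\qquad\text{for every } k\in I. \] -/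

import Mathlib

noncomputable section

namespace Schroedinger

open MeasureTheory FourierTransform
open scoped ENNReal

/-- A unitary representation of `G` on `H` (as an abstract group homomorphism). -/
abbrev UnitaryRep (G H : Type*) [Group G] [NormedAddCommGroup H] [InnerProductSpace ℂ H] :=
  G →* (H ≃ₗᵢ[ℂ] H)

/-- A homomorphism from a group into the monoid of linear isometries takes values in the
invertible ones. -/
def homOfIsometry {𝕜 G H : Type*} [RCLike 𝕜] [Group G] [NormedAddCommGroup H]
    [InnerProductSpace 𝕜 H] (φ : G →* (H →ₗᵢ[𝕜] H)) : G →* (H ≃ₗᵢ[𝕜] H) where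
  toFun g :=
    { (φ g).toLinearMap with
      invFun := φ g⁻¹
      left_inv := fun x => by
        change (φ g⁻¹ * φ g) x = x
        rw [← map_mul, inv_mul_cancel, map_one]; rfl
      right_inv := fun x => by
        change (φ g * φ g⁻¹) x = x
        rw [← map_mul, mul_inv_cancel, map_one]; rfl
      norm_map' := fun x => (φ g).norm_map x }
  map_one' := by
    ext x
    change φ 1 x = x
    rw [map_one]; rfl
  map_mul' g h := by
    ext x
    change φ (g * h) x = φ g (φ h x)
    rw [map_mul]; rfl

theorem homOfIsometry_apply {𝕜 G H : Type*} [RCLike 𝕜] [Group G] [NormedAddCommGroup H]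
    [InnerProductSpace 𝕜 H] (φ : G →* (H →ₗᵢ[𝕜] H)) (g : G) (x : H) :
    homOfIsometry φ g x = φ g x := rfl

section WeightedComp

variable {α E : Type*} [MeasurableSpace α] [NormedAddCommGroup E] [InnerProductSpace ℂ E]

/-- Data of an isometry `f ↦ (x ↦ w x • A (f (T x)))` of `L²(μ, E)`. -/
structure WeightedComp (μ : Measure α) (E : Type*) [NormedAddCommGroup E]
    [InnerProductSpace ℂ E] where
  w : α → ℂ
  T : α → α
  A : E →ₗᵢ[ℂ] E
  measurable_w : Measurable w
  quasi : Measure.QuasiMeasurePreserving T μ μ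
  map_withDensity : (μ.withDensity fun x => ‖w x‖ₑ ^ 2).map T = μ

namespace WeightedComp

variable {μ : Measure α} (D D₁ D₂ : WeightedComp μ E)

theorem aestronglyMeasurable (f : Lp E 2 μ) :
    AEStronglyMeasurable (fun x => D.w x • D.A (f (D.T x))) μ :=
  D.measurable_w.aestronglyMeasurable.smul
    (D.A.continuous.comp_aestronglyMeasurable
      ((Lp.aestronglyMeasurable f).comp_quasiMeasurePreserving D.quasi))

theorem eLpNorm_eq (f : Lp E 2 μ) :
    eLpNorm (fun x => D.w x • D.A (f (D.T x))) 2 μ = eLpNorm f 2 μ := by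
  have hg : AEMeasurable (fun x => ‖f x‖ₑ ^ 2) μ :=
    (Lp.aestronglyMeasurable f).enorm.pow_const 2
  have hgT : AEMeasurable (fun x => ‖f (D.T x)‖ₑ ^ 2) μ :=
    ((Lp.aestronglyMeasurable f).comp_quasiMeasurePreserving D.quasi).enorm.pow_const 2
  have hw : Measurable fun x => ‖D.w x‖ₑ ^ 2 := D.measurable_w.enorm.pow_const 2
  have key : ∫⁻ x, ‖D.w x • D.A (f (D.T x))‖ₑ ^ 2 ∂μ = ∫⁻ x, ‖f x‖ₑ ^ 2 ∂μ := by
    have hch : ∫⁻ x, ‖f x‖ₑ ^ 2 ∂μ =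
        ∫⁻ x, ‖f x‖ₑ ^ 2 ∂((μ.withDensity fun x => ‖D.w x‖ₑ ^ 2).map D.T) :=
      congrArg (fun ν => ∫⁻ x, ‖f x‖ₑ ^ 2 ∂ν) D.map_withDensity.symm
    rw [hch, lintegral_map' (by rwa [D.map_withDensity]) D.quasi.measurable.aemeasurable,
      lintegral_withDensity_eq_lintegral_mul₀ hw.aemeasurable hgT]
    refine lintegral_congr fun x => ?_
    simp only [enorm_smul, Pi.mul_apply, mul_pow]
    congr 2
    simp only [enorm_eq_nnnorm, LinearIsometry.nnnorm_map]
  rw [eLpNorm_eq_lintegral_rpow_enorm_toReal (by norm_num) (by norm_num),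
    eLpNorm_eq_lintegral_rpow_enorm_toReal (by norm_num) (by norm_num)]
  simpa using congrArg (fun t : ℝ≥0∞ => t ^ (1 / 2 : ℝ)) key

theorem memLp (f : Lp E 2 μ) : MemLp (fun x => D.w x • D.A (f (D.T x))) 2 μ :=
  ⟨D.aestronglyMeasurable f, by rw [D.eLpNorm_eq]; exact Lp.eLpNorm_lt_top f⟩

/-- The isometry `f ↦ (x ↦ w x • A (f (T x)))` of `L²(μ, E)`. -/
def toIsometry : Lp E 2 μ →ₗᵢ[ℂ] Lp E 2 μ where
  toFun f := (D.memLp f).toLp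
  map_add' f g := by
    ext1
    refine (D.memLp _).coeFn_toLp.trans ?_
    refine Filter.EventuallyEq.trans ?_ (Lp.coeFn_add _ _).symm
    filter_upwards [(D.memLp f).coeFn_toLp, (D.memLp g).coeFn_toLp,
      D.quasi.ae (Lp.coeFn_add f g)] with x h1 h2 h3
    rw [h3, Pi.add_apply, Pi.add_apply, h1, h2, map_add, smul_add]
  map_smul' c f := by
    ext1
    refine (D.memLp _).coeFn_toLp.trans ?_
    refine Filter.EventuallyEq.trans ?_ (Lp.coeFn_smul _ _).symm
    filter_upwards [(D.memLp f).coeFn_toLp, D.quasi.ae (Lp.coeFn_smul c f)] with x h1 h2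
    rw [h2, Pi.smul_apply, Pi.smul_apply, RingHom.id_apply, h1, map_smul, smul_comm]
  norm_map' f := by
    change ‖(D.memLp f).toLp‖ = ‖f‖
    rw [Lp.norm_toLp, D.eLpNorm_eq, Lp.norm_def]

theorem toIsometry_ae (f : Lp E 2 μ) :
    D.toIsometry f =ᵐ[μ] fun x => D.w x • D.A (f (D.T x)) :=
  (D.memLp f).coeFn_toLp

theorem toIsometry_eq_one (hw : ∀ x, D.w x = 1) (hT : ∀ x, D.T x = x) (hA : ∀ v, D.A v = v) :
    D.toIsometry = 1 := by
  ext f : 1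
  ext1
  filter_upwards [D.toIsometry_ae f] with x h
  rw [h, hw, hT, hA, one_smul]; rfl

theorem toIsometry_eq_mul {D D₁ D₂ : WeightedComp μ E}
    (hw : ∀ x, D.w x = D₁.w x * D₂.w (D₁.T x))
    (hT : ∀ x, D.T x = D₂.T (D₁.T x)) (hA : ∀ v, D.A v = D₁.A (D₂.A v)) :
    D.toIsometry = D₁.toIsometry * D₂.toIsometry := by
  ext f : 1
  ext1
  change _ =ᵐ[μ] D₁.toIsometry (D₂.toIsometry f)
  filter_upwards [D.toIsometry_ae f, D₁.toIsometry_ae (D₂.toIsometry f),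
    D₁.quasi.ae (D₂.toIsometry_ae f)] with x h1 h2 h3
  rw [h1, h2, h3, hw, hT, hA, map_smul, mul_smul]

end WeightedComp

end WeightedComp

/-! ### The group -/

abbrev Euc (d : ℕ) := EuclideanSpace ℝ (Fin d)

/-- The unit sphere `S^{d-1}`. -/
abbrev Sph (d : ℕ) := Metric.sphere (0 : Euc d) 1

abbrev SO (d : ℕ) := Matrix.specialOrthogonalGroup (Fin d) ℝ

/-- The action of `SO(d)` on `ℝ^d`. -/
def rot (d : ℕ) : SO d →* (Euc d ≃ₗᵢ[ℝ] Euc d) :=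
  homOfIsometry
    { toFun := fun R =>
        { toLinearMap := (Matrix.toEuclideanCLM (𝕜 := ℝ) (R : Matrix (Fin d) (Fin d) ℝ)).toLinearMap
          norm_map' := fun x => by
            have hR : star (R : Matrix (Fin d) (Fin d) ℝ) * R = 1 := by
              have := (Matrix.mem_specialOrthogonalGroup_iff.1 R.2).1
              exact (Matrix.mem_unitaryGroup_iff'.1 this)
            have hmem : Matrix.toEuclideanCLM (𝕜 := ℝ) (R : Matrix (Fin d) (Fin d) ℝ) ∈
                unitary (Euc d →L[ℝ] Euc d) := by
              rw [Unitary.mem_iff]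
              have hR' : (R : Matrix (Fin d) (Fin d) ℝ) * star (R : Matrix (Fin d) (Fin d) ℝ) = 1 :=
                Matrix.mem_unitaryGroup_iff.1 (Matrix.mem_specialOrthogonalGroup_iff.1 R.2).1
              constructor
              · rw [← map_star, ← map_mul, hR, map_one]
              · rw [← map_star, ← map_mul, hR', map_one]
            exact ContinuousLinearMap.norm_map_of_mem_unitary hmem x }
      map_one' := by
        ext1 x
        change Matrix.toEuclideanCLM (𝕜 := ℝ) (1 : Matrix (Fin d) (Fin d) ℝ) x = x
        rw [map_one]; rfl
      map_mul' := fun R Q => by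
        ext1 x
        change Matrix.toEuclideanCLM (𝕜 := ℝ)
          ((R : Matrix (Fin d) (Fin d) ℝ) * (Q : Matrix (Fin d) (Fin d) ℝ)) x = _
        rw [map_mul]; rfl }

theorem rot_apply {d : ℕ} (R : SO d) (x : Euc d) (j : Fin d) :
    rot d R x j = ∑ k, (R : Matrix (Fin d) (Fin d) ℝ) j k * x k := rfl

instance (d : ℕ) : MeasurableSpace (SO d) := borel _
instance (d : ℕ) : BorelSpace (SO d) := ⟨rfl⟩

theorem inv_eq_star {d : ℕ} (R : SO d) :
    ((R⁻¹ : SO d) : Matrix (Fin d) (Fin d) ℝ) = star (R : Matrix (Fin d) (Fin d) ℝ) := rfl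

instance (d : ℕ) : IsTopologicalGroup (SO d) where
  continuous_inv := by
    refine continuous_induced_rng.2 ?_
    change Continuous fun R : SO d => star (R : Matrix (Fin d) (Fin d) ℝ)
    exact continuous_subtype_val.star

instance (d : ℕ) : CompactSpace (SO d) := by
  refine (isCompact_iff_compactSpace (s := ((SO d : Submonoid (Matrix (Fin d) (Fin d) ℝ)) :
    Set (Matrix (Fin d) (Fin d) ℝ)))).1 ?_
  refine IsCompact.of_isClosed_subset
    (isCompact_univ_pi fun _ : Fin d => isCompact_univ_pi fun _ : Fin d =>
      isCompact_Icc (a := (-1 : ℝ)) (b := 1)) ?_ ?_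
  · have : ((SO d : Submonoid (Matrix (Fin d) (Fin d) ℝ)) : Set (Matrix (Fin d) (Fin d) ℝ)) =
        {M | M * star M = 1} ∩ {M | M.det = 1} := by
      ext M
      simp only [SetLike.mem_coe, Matrix.mem_specialOrthogonalGroup_iff, Set.mem_inter_iff,
        Set.mem_ofPred_eq]
      rw [Matrix.orthogonalGroup, Matrix.mem_unitaryGroup_iff]
    change IsClosed ((SO d : Submonoid (Matrix (Fin d) (Fin d) ℝ)) : Set (Matrix (Fin d) (Fin d) ℝ))
    rw [this]
    exact (isClosed_eq (continuous_id.mul continuous_id.star) continuous_const).inter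
      (isClosed_eq continuous_id.matrix_det continuous_const)
  · intro M hM i _ j _
    have := entry_norm_bound_of_unitary (Matrix.mem_specialOrthogonalGroup_iff.1 hM).1 i j
    exact abs_le.1 this

/-- The multiplicative group `ℝ₊` of positive reals. -/
abbrev PosReal := {a : ℝ // 0 < a}

/-- The group `G = (ℝ ⋊ ℝ₊) × SO(d)`, with elements `(b, a, R)`. -/
@[ext] structure SGroup (d : ℕ) where
  b : ℝ
  a : PosReal
  R : SO d

namespace SGroup

variable {d : ℕ}

instance : Mul (SGroup d) := ⟨fun g h => ⟨g.b + g.a * h.b, g.a * h.a, g.R * h.R⟩⟩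
instance : One (SGroup d) := ⟨⟨0, 1, 1⟩⟩
instance : Inv (SGroup d) := ⟨fun g => ⟨-((g.a : ℝ)⁻¹ * g.b), g.a⁻¹, g.R⁻¹⟩⟩

@[simp] theorem mul_b (g h : SGroup d) : (g * h).b = g.b + g.a * h.b := rfl
@[simp] theorem mul_a (g h : SGroup d) : (g * h).a = g.a * h.a := rfl
@[simp] theorem mul_R (g h : SGroup d) : (g * h).R = g.R * h.R := rfl
@[simp] theorem one_b : (1 : SGroup d).b = 0 := rfl
@[simp] theorem one_a : (1 : SGroup d).a = 1 := rfl
@[simp] theorem one_R : (1 : SGroup d).R = 1 := rfl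

instance : Group (SGroup d) :=
  Group.ofLeftAxioms
    (fun x y z => by
      ext1
      · simp only [mul_b, mul_a, Positive.val_mul]; ring
      · simp only [mul_a, mul_assoc]
      · simp only [mul_R, mul_assoc])
    (fun x => by
      ext1
      · simp
      · simp
      · simp)
    (fun x => by
      ext1
      · change -((x.a : ℝ)⁻¹ * x.b) + (x.a : ℝ)⁻¹ * x.b = 0
        ring
      · exact inv_mul_cancel x.a
      · exact inv_mul_cancel x.R)

instance : MeasurableSpace (SGroup d) :=
  MeasurableSpace.comap (fun g => (g.b, g.a, g.R)) inferInstance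

/-- The left Haar measure `db da/a² dR` of `G`; here `dR` is the Haar measure of `SO(d)` with
total mass one. -/
def haar (d : ℕ) : Measure (SGroup d) :=
  ((volume : Measure ℝ).prod
    (((volume : Measure ℝ).comap (Subtype.val : PosReal → ℝ)).withDensity
      (fun a => ENNReal.ofReal (((a : ℝ) ^ 2)⁻¹)) |>.prod
    (Measure.haarMeasure (⊤ : TopologicalSpace.PositiveCompacts (SO d))))).map
    (fun p => (⟨p.1, p.2.1, p.2.2⟩ : SGroup d))

end SGroup

/-! ### The Schroedinger representation -/

/-- `L²(ℝ^d)`. -/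
abbrev L2 (d : ℕ) := Lp (α := Euc d) ℂ 2

/-- `f ↦ (x ↦ k f (r R x))`, isometric if `k² = r^d`. -/
def dilationData (d : ℕ) (k r : ℝ) (hr : 0 < r) (hk : k ^ 2 = r ^ d) (R : SO d) :
    WeightedComp (volume : Measure (Euc d)) ℂ where
  w := fun _ => (k : ℂ)
  T := fun x => r • rot d R x
  A := 1
  measurable_w := measurable_const
  quasi := by
    refine Measure.QuasiMeasurePreserving.comp (g := fun x : Euc d => r • x) (μb := volume)
      ⟨measurable_const_smul r, ?_⟩ (rot d R).measurePreserving.quasiMeasurePreserving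
    rw [Measure.map_addHaar_smul _ hr.ne']
    exact Measure.smul_absolutelyContinuous
  map_withDensity := by
    have hT : (fun x => r • rot d R x) = (fun x : Euc d => r • x) ∘ (rot d R) := rfl
    have hk' : ‖(k : ℂ)‖ₑ ^ 2 = ENNReal.ofReal (r ^ d) := by
      rw [← hk, ← sq_abs k, ENNReal.ofReal_pow (abs_nonneg k), ← Real.norm_eq_abs,
        ← Complex.norm_real, ofReal_norm]
    rw [withDensity_const, hT, Measure.map_smul,
      ← Measure.map_map (measurable_const_smul r) (rot d R).continuous.measurable,
      (rot d R).measurePreserving.map_eq, Measure.map_addHaar_smul _ hr.ne', smul_smul, hk',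
      ← ENNReal.ofReal_mul (by positivity), finrank_euclideanSpace_fin,
      abs_of_pos (by positivity), mul_inv_cancel₀ (by positivity), ENNReal.ofReal_one, one_smul]

/-- Multiplication by `ξ ↦ exp (-2πi b ξ·ξ)`. -/
def phaseData (d : ℕ) (b : ℝ) : WeightedComp (volume : Measure (Euc d)) ℂ where
  w := fun ξ => Complex.exp (((-2 * Real.pi * b * ‖ξ‖ ^ 2 : ℝ) : ℂ) * Complex.I)
  T := id
  A := 1
  measurable_w := by fun_prop
  quasi := Measure.QuasiMeasurePreserving.id _
  map_withDensity := by
    simp only [enorm_eq_nnnorm, Measure.map_id]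
    have : ∀ x : ℝ, ‖Complex.exp ((x : ℂ) * Complex.I)‖₊ = 1 := fun x =>
      NNReal.eq (Complex.norm_exp_ofReal_mul_I x)
    simp only [this]
    simp

/-- The Fourier transform on `L²(ℝ^d)`. -/
def fourierL2 (d : ℕ) : L2 d ≃ₗᵢ[ℂ] L2 d := Lp.fourierTransformₗᵢ (Euc d) ℂ

/-- The unitary operator `U(b) = exp (i b/(2π) Δ)`: the operator which on the Fourier side
is multiplication by `exp (-2πi b ξ·ξ)`. -/
def U (d : ℕ) (b : ℝ) : L2 d →ₗᵢ[ℂ] L2 d :=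
  (fourierL2 d).symm.toLinearIsometry.comp
    ((phaseData d b).toIsometry.comp (fourierL2 d).toLinearIsometry)

theorem rpow_quarter_sq (d : ℕ) {a t : ℝ} (ha : 0 < a) :
    (a ^ (t * (d / 4 : ℝ))) ^ 2 = (a ^ (t * (1 / 2 : ℝ))) ^ d := by
  rw [← Real.rpow_natCast, ← Real.rpow_natCast, ← Real.rpow_mul ha.le, ← Real.rpow_mul ha.le]
  congr 1
  push_cast
  ring

/-- The unitary operator `V(a,R) f (x) = a^{-d/4} f (a^{-1/2} R⁻¹ x)`. -/
def V (d : ℕ) (a : PosReal) (R : SO d) : L2 d →ₗᵢ[ℂ] L2 d :=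
  (dilationData d ((a : ℝ) ^ (-1 * (d / 4 : ℝ))) ((a : ℝ) ^ (-1 * (1 / 2 : ℝ)))
    (Real.rpow_pos_of_pos a.2 _) (rpow_quarter_sq d a.2) R⁻¹).toIsometry

theorem fourier_comp_dilation {d : ℕ} (h : Euc d → ℂ) {r : ℝ} (hr : 0 < r) (R : SO d)
    (ξ : Euc d) :
    𝓕 (fun x => h (r • rot d R x)) ξ = ((r ^ d : ℝ) : ℂ)⁻¹ * 𝓕 h (r⁻¹ • rot d R ξ) := by
  have h1 : (fun x => h (r • rot d R x)) = (fun x => h (r • x)) ∘ (rot d R) := rfl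
  rw [h1, Real.fourier_comp_linearIsometry, Real.fourier_eq, Real.fourier_eq]
  have h2 := Measure.integral_comp_smul (volume : Measure (Euc d))
    (fun y : Euc d => Real.fourierChar (-inner ℝ y (r⁻¹ • rot d R ξ)) • h y) r
  rw [finrank_euclideanSpace_fin, abs_of_pos (by positivity), Complex.real_smul] at h2
  rw [← Complex.ofReal_inv, ← h2]
  refine integral_congr_ae (Filter.Eventually.of_forall fun x => ?_)
  simp only [real_inner_smul_left, real_inner_smul_right]
  rw [inv_mul_cancel_left₀ hr.ne']

theorem fourier_dilation_schwartz {d : ℕ} (k : ℝ) {r : ℝ} (hr : 0 < r) (R : SO d)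
    (g : SchwartzMap (Euc d) ℂ) :
    ∃ g' : SchwartzMap (Euc d) ℂ, (∀ x, g' x = (k : ℂ) * g (r • rot d R x)) ∧
      ∀ ξ, (𝓕 g' : SchwartzMap (Euc d) ℂ) ξ =
        ((k * (r ^ d)⁻¹ : ℝ) : ℂ) * (𝓕 g : SchwartzMap (Euc d) ℂ) (r⁻¹ • rot d R ξ) := by
  let L : Euc d ≃L[ℝ] Euc d := (rot d R).toContinuousLinearEquiv.trans
    (ContinuousLinearEquiv.smulLeft (Units.mk0 r hr.ne'))
  have hL : ∀ x, L x = r • rot d R x := fun x => rfl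
  refine ⟨(k : ℂ) • SchwartzMap.compCLMOfContinuousLinearEquiv ℂ L g, fun x => rfl, fun ξ => ?_⟩
  rw [FourierTransform.fourier_smul, smul_apply, SchwartzMap.fourier_coe,
    SchwartzMap.fourier_coe, SchwartzMap.compCLMOfContinuousLinearEquiv_apply]
  have := fourier_comp_dilation (g : Euc d → ℂ) hr R ξ
  rw [show (g ∘ L : Euc d → ℂ) = fun x => g (r • rot d R x) from rfl, this, smul_eq_mul]
  push_cast
  ring

theorem eq_of_dense {X H : Type*} [NormedAddCommGroup H] [InnerProductSpace ℂ H] {e : X → H}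
    (he : DenseRange e) (F : H ≃ₗᵢ[ℂ] H) (A B : H →ₗᵢ[ℂ] H)
    (h : ∀ x, F (A (e x)) = B (F (e x))) (f : H) : F (A f) = B (F f) :=
  he.induction_on f (isClosed_eq (F.continuous.comp A.continuous) (B.continuous.comp F.continuous))
    h

theorem fourier_dilation {d : ℕ} {k r k' r' : ℝ} (hr : 0 < r) (hk : k ^ 2 = r ^ d)
    (hr' : 0 < r') (hk' : k' ^ 2 = r' ^ d) (R : SO d) (e : r' = r⁻¹)
    (e' : k' = k * (r ^ d)⁻¹) (f : L2 d) :
    fourierL2 d ((dilationData d k r hr hk R).toIsometry f) =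
      (dilationData d k' r' hr' hk' R).toIsometry (fourierL2 d f) := by
  have hS : ∀ g : SchwartzMap (Euc d) ℂ,
      fourierL2 d ((dilationData d k r hr hk R).toIsometry (g.toLp 2)) =
        (dilationData d k' r' hr' hk' R).toIsometry (fourierL2 d (g.toLp 2)) := by
    intro g
    obtain ⟨g', hg', hg''⟩ := fourier_dilation_schwartz k hr R g
    have h1 : (dilationData d k r hr hk R).toIsometry (g.toLp 2) = g'.toLp 2 := by
      ext1
      filter_upwards [(dilationData d k r hr hk R).toIsometry_ae (g.toLp 2),
        g'.coeFn_toLp 2 volume,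
        (dilationData d k r hr hk R).quasi.ae (g.coeFn_toLp 2 volume)] with x h1 h2 h3
      rw [h1, h2, h3, hg']; rfl
    have h4 : ∀ q : SchwartzMap (Euc d) ℂ, fourierL2 d (q.toLp 2) = (𝓕 q).toLp 2 :=
      fun q => SchwartzMap.toLp_fourier_eq q
    rw [h1, h4, h4]
    ext1
    filter_upwards [(dilationData d k' r' hr' hk' R).toIsometry_ae ((𝓕 g).toLp 2),
      (𝓕 g').coeFn_toLp 2 volume,
      (dilationData d k' r' hr' hk' R).quasi.ae ((𝓕 g).coeFn_toLp 2 volume)] with x h1 h2 h3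
    rw [h1, h2, h3, hg'', ← e, ← e']
    rfl
  exact eq_of_dense (SchwartzMap.denseRange_toLpCLM (p := 2) (F := ℂ)
    (μ := (volume : Measure (Euc d))) ENNReal.ofNat_ne_top) _ _ _ hS f

theorem V_mul {d : ℕ} (a a' : PosReal) (R R' : SO d) :
    V d (a * a') (R * R') = V d a R * V d a' R' := by
  refine WeightedComp.toIsometry_eq_mul (fun x => ?_) (fun x => ?_) (fun v => rfl)
  · change (((a : ℝ) * a') ^ (-1 * (d / 4 : ℝ)) : ℝ) = (_ : ℂ) * _
    rw [Real.mul_rpow a.2.le a'.2.le]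
    push_cast; rfl
  · change (((a : ℝ) * a') ^ (-1 * (1 / 2 : ℝ)) : ℝ) • rot d (R * R')⁻¹ x =
      ((a' : ℝ) ^ (-1 * (1 / 2 : ℝ)) : ℝ) • rot d R'⁻¹ (((a : ℝ) ^ (-1 * (1 / 2 : ℝ)) : ℝ) • rot d R⁻¹ x)
    rw [Real.mul_rpow a.2.le a'.2.le, map_smul, smul_smul, mul_inv_rev, map_mul, mul_comm]
    rfl

theorem U_add {d : ℕ} (b b' : ℝ) : U d (b + b') = U d b * U d b' := by
  have h : (phaseData d (b + b')).toIsometry =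
      (phaseData d b).toIsometry * (phaseData d b').toIsometry := by
    refine WeightedComp.toIsometry_eq_mul (fun x => ?_) (fun x => rfl) (fun v => rfl)
    change Complex.exp _ = Complex.exp _ * Complex.exp (((-2 * Real.pi * b' * ‖x‖ ^ 2 : ℝ) : ℂ) * Complex.I)
    rw [← Complex.exp_add]
    congr 1
    push_cast
    ring
  ext f : 1
  change (fourierL2 d).symm ((phaseData d (b + b')).toIsometry (fourierL2 d f)) =
    (fourierL2 d).symm ((phaseData d b).toIsometry (fourierL2 d
      ((fourierL2 d).symm ((phaseData d b').toIsometry (fourierL2 d f)))))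
  rw [h, LinearIsometryEquiv.apply_symm_apply]
  rfl

theorem V_mul_U {d : ℕ} (a : PosReal) (R : SO d) (b : ℝ) :
    V d a R * U d b = U d (a * b) * V d a R := by
  have hF := fun f => fourier_dilation (d := d) (k' := (a : ℝ) ^ (1 * (d / 4 : ℝ)))
    (r' := (a : ℝ) ^ (1 * (1 / 2 : ℝ))) (Real.rpow_pos_of_pos a.2 (-1 * (1 / 2 : ℝ)))
    (rpow_quarter_sq d a.2) (Real.rpow_pos_of_pos a.2 _) (rpow_quarter_sq d a.2) R⁻¹
    (by rw [← Real.rpow_neg a.2.le]; congr 1; ring)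
    (by
      rw [← rpow_quarter_sq d a.2, ← Real.rpow_natCast, ← Real.rpow_mul a.2.le,
        ← Real.rpow_neg a.2.le, ← Real.rpow_add a.2]
      congr 1; push_cast; ring) f
  have hM : (dilationData d ((a : ℝ) ^ (1 * (d / 4 : ℝ))) ((a : ℝ) ^ (1 * (1 / 2 : ℝ)))
        (Real.rpow_pos_of_pos a.2 _) (rpow_quarter_sq d a.2) R⁻¹).toIsometry *
        (phaseData d b).toIsometry =
      (phaseData d (a * b)).toIsometry *
        (dilationData d ((a : ℝ) ^ (1 * (d / 4 : ℝ))) ((a : ℝ) ^ (1 * (1 / 2 : ℝ)))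
        (Real.rpow_pos_of_pos a.2 _) (rpow_quarter_sq d a.2) R⁻¹).toIsometry := by
    ext f : 1
    ext1
    change (WeightedComp.toIsometry _ (WeightedComp.toIsometry _ f)) =ᵐ[volume]
      (WeightedComp.toIsometry _ (WeightedComp.toIsometry _ f))
    refine (WeightedComp.toIsometry_ae _ _).trans
      (Filter.EventuallyEq.trans ?_ (WeightedComp.toIsometry_ae _ _).symm)
    filter_upwards [WeightedComp.toIsometry_ae (dilationData d ((a : ℝ) ^ (1 * (d / 4 : ℝ)))
        ((a : ℝ) ^ (1 * (1 / 2 : ℝ)))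
        (Real.rpow_pos_of_pos a.2 _) (rpow_quarter_sq d a.2) R⁻¹) f,
      (dilationData d ((a : ℝ) ^ (1 * (d / 4 : ℝ))) ((a : ℝ) ^ (1 * (1 / 2 : ℝ)))
        (Real.rpow_pos_of_pos a.2 _) (rpow_quarter_sq d a.2) R⁻¹).quasi.ae
        ((phaseData d b).toIsometry_ae f)] with x h1 h2
    change _ * _ = _ * (WeightedComp.toIsometry _ f) x
    rw [h1]
    change _ * (WeightedComp.toIsometry _ f) _ = _
    rw [h2]
    have hsq : ((a : ℝ) ^ (1 * (1 / 2 : ℝ))) ^ 2 = a := by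
      rw [← Real.rpow_natCast, ← Real.rpow_mul a.2.le]; norm_num
    have hn : ‖((a : ℝ) ^ (1 * (1 / 2 : ℝ))) • rot d R⁻¹ x‖ ^ 2 = a * ‖x‖ ^ 2 := by
      rw [norm_smul, LinearIsometryEquiv.norm_map, mul_pow, Real.norm_eq_abs, sq_abs, hsq]
    simp only [dilationData, phaseData, hn, smul_eq_mul, id]
    rw [mul_left_comm]
    congr 3
    push_cast
    ring
  ext f : 1
  change V d a R ((fourierL2 d).symm ((phaseData d b).toIsometry (fourierL2 d f))) =
    (fourierL2 d).symm ((phaseData d (a * b)).toIsometry (fourierL2 d (V d a R f)))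
  rw [LinearIsometryEquiv.eq_symm_apply]
  have h1 := hF ((fourierL2 d).symm ((phaseData d b).toIsometry (fourierL2 d f)))
  have h2 := hF f
  rw [LinearIsometryEquiv.apply_symm_apply] at h1
  have h3 := DFunLike.congr_fun hM (fourierL2 d f)
  change WeightedComp.toIsometry _ (WeightedComp.toIsometry _ (fourierL2 d f)) =
    WeightedComp.toIsometry _ (WeightedComp.toIsometry _ (fourierL2 d f)) at h3
  rw [← h2] at h3
  exact h1.trans h3

/-- The Schroedinger representation `π(b,a,R) = U(b) V(a,R)` of `G` on `L²(ℝ^d)`. -/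
def schroedingerRep (d : ℕ) : UnitaryRep (SGroup d) (L2 d) :=
  homOfIsometry
    { toFun := fun g => U d g.b * V d g.a g.R
      map_one' := by
        have h : U d 0 = 1 := by
          ext f : 1
          have : (phaseData d 0).toIsometry = 1 :=
            WeightedComp.toIsometry_eq_one _ (fun x => by simp [phaseData]) (fun _ => rfl)
              (fun _ => rfl)
          change (fourierL2 d).symm ((phaseData d 0).toIsometry (fourierL2 d f)) = f
          rw [this]
          exact (fourierL2 d).symm_apply_apply f
        have h' : V d 1 1 = 1 :=
          WeightedComp.toIsometry_eq_one _ (fun x => by simp [dilationData])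
            (fun x => by simp [dilationData]) (fun _ => rfl)
        change U d 0 * V d 1 1 = 1
        rw [h, h', one_mul]
      map_mul' := fun g h => by
        change U d (g.b + g.a * h.b) * V d (g.a * h.a) (g.R * h.R) = _
        rw [U_add, V_mul, mul_assoc, ← mul_assoc (U d (g.a * h.b)), ← V_mul_U, mul_assoc,
          mul_assoc] }

/-- `η` is admissible for the representation `π` of `G` if
`‖f‖² = ∫_G |⟨f, π(g) η⟩|² dg` for every `f`. -/
def IsAdmissible {d : ℕ} {H : Type*} [NormedAddCommGroup H] [InnerProductSpace ℂ H]
    (π : UnitaryRep (SGroup d) H) (η : H) : Prop :=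
  ∀ f : H, ∫⁻ g, ‖inner ℂ (π g η) f‖ₑ ^ 2 ∂(SGroup.haar d) = ‖f‖ₑ ^ 2

/-! ### The sphere and the spherical harmonics -/

/-- The Riemannian (surface) measure of `S^{d-1}`. -/
abbrev sphereMeasure (d : ℕ) : Measure (Sph d) := (volume : Measure (Euc d)).toSphere

/-- `L²(S^{d-1})`. -/
abbrev L2Sph (d : ℕ) := Lp ℂ 2 (sphereMeasure d)

/-- The action of `SO(d)` on `S^{d-1}`. -/
def sphRot {d : ℕ} (R : SO d) (s : Sph d) : Sph d :=
  ⟨rot d R s, by simp⟩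

theorem measurable_sphRot {d : ℕ} (R : SO d) : Measurable (sphRot (d := d) R) :=
  ((rot d R).continuous.comp continuous_subtype_val).measurable.subtype_mk

open scoped Pointwise in
theorem measurePreserving_sphRot {d : ℕ} (R : SO d) :
    MeasurePreserving (sphRot R) (sphereMeasure d) (sphereMeasure d) := by
  refine ⟨measurable_sphRot R, Measure.ext fun t ht => ?_⟩
  rw [Measure.map_apply (measurable_sphRot R) ht,
    Measure.toSphere_apply' _ (measurable_sphRot R ht), Measure.toSphere_apply' _ ht]
  congr 1
  have hset : (Set.Ioo (0 : ℝ) 1 • (Subtype.val '' (sphRot R ⁻¹' t)) : Set (Euc d)) =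
      rot d R ⁻¹' (Set.Ioo (0 : ℝ) 1 • (Subtype.val '' t)) := by
    ext x
    simp only [Set.mem_smul, Set.mem_image, Set.mem_preimage]
    constructor
    · rintro ⟨c, hc, _, ⟨s, hs, rfl⟩, rfl⟩
      exact ⟨c, hc, _, ⟨_, hs, rfl⟩, ((rot d R).map_smul c _).symm⟩
    · rintro ⟨c, hc, _, ⟨s, hs, rfl⟩, hx⟩
      have hs' : sphRot R (sphRot R⁻¹ s) = s := by
        ext1
        change (rot d R * rot d R⁻¹) (s : Euc d) = s
        rw [← map_mul, mul_inv_cancel, map_one]; rfl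
      refine ⟨c, hc, _, ⟨sphRot R⁻¹ s, by rwa [hs'], rfl⟩, ?_⟩
      apply (rot d R).injective
      rw [← hx, map_smul]
      exact congrArg (fun q : Sph d => c • (q : Euc d)) hs'
  rw [hset]
  exact (rot d R).measurePreserving.measure_preimage_equiv (f := (rot d R).toMeasurableEquiv) _

/-- `φ ↦ (s ↦ φ (R⁻¹ s))` on `L²(S^{d-1})`. -/
def sphereData (d : ℕ) (R : SO d) : WeightedComp (sphereMeasure d) ℂ where
  w := fun _ => 1
  T := sphRot R⁻¹
  A := 1
  measurable_w := measurable_const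
  quasi := (measurePreserving_sphRot R⁻¹).quasiMeasurePreserving
  map_withDensity := by
    simpa using (measurePreserving_sphRot R⁻¹).map_eq

/-- The regular representation `ρ(R) φ (s) = φ (R⁻¹ s)` of `SO(d)` on `L²(S^{d-1})`. -/
def sphereRep (d : ℕ) : UnitaryRep (SO d) (L2Sph d) :=
  homOfIsometry
    { toFun := fun R => (sphereData d R).toIsometry
      map_one' := WeightedComp.toIsometry_eq_one _ (fun _ => rfl)
        (fun x => by ext1; simp [sphereData, sphRot]) (fun _ => rfl)
      map_mul' := fun R Q => WeightedComp.toIsometry_eq_mul (fun _ => by simp [sphereData])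
        (fun x => by ext1; simp [sphereData, sphRot]) (fun _ => rfl) }

theorem sphereRep_ae {d : ℕ} (R : SO d) (φ : L2Sph d) :
    sphereRep d R φ =ᵐ[sphereMeasure d] fun s => φ (sphRot R⁻¹ s) := by
  filter_upwards [(sphereData d R).toIsometry_ae φ] with s h
  exact h.trans (one_mul _)

/-- A finite-dimensional rotation invariant subspace of `L²(S^{d-1})`. -/
structure AngularSpace (d : ℕ) where
  carrier : Submodule ℂ (L2Sph d)
  finite : FiniteDimensional ℂ carrier
  invariant : ∀ R : SO d, ∀ φ ∈ carrier, sphereRep d R φ ∈ carrier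

theorem continuous_memLp {d : ℕ} {u : Sph d → ℂ} (hu : Continuous u) :
    MemLp u 2 (sphereMeasure d) := by
  obtain ⟨C, hC⟩ := isCompact_univ.exists_bound_of_continuousOn (f := u) hu.continuousOn
  exact MemLp.of_bound hu.aestronglyMeasurable C
    (Filter.Eventually.of_forall fun s => hC s (Set.mem_univ s))

theorem continuous_eval_sphere {d : ℕ} (p : MvPolynomial (Fin d) ℂ) :
    Continuous fun s : Sph d => MvPolynomial.eval (fun j => ((s : Euc d) j : ℂ)) p := by
  refine (MvPolynomial.continuous_eval p).comp (continuous_pi fun j => ?_)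
  fun_prop

/-- The restriction of a polynomial to the sphere, as an element of `L²(S^{d-1})`. -/
def polyToSphere (d : ℕ) : MvPolynomial (Fin d) ℂ →ₗ[ℂ] L2Sph d where
  toFun p := (continuous_memLp (continuous_eval_sphere p)).toLp
  map_add' p q := by
    rw [← MemLp.toLp_add]
    simp only [map_add]; rfl
  map_smul' c p := by
    rw [RingHom.id_apply, ← MemLp.toLp_const_smul]
    simp only [MvPolynomial.smul_eval]; rfl

theorem polyToSphere_ae {d : ℕ} (p : MvPolynomial (Fin d) ℂ) :
    polyToSphere d p =ᵐ[sphereMeasure d]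
      fun s => MvPolynomial.eval (fun j => ((s : Euc d) j : ℂ)) p :=
  (continuous_memLp (continuous_eval_sphere p)).coeFn_toLp

/-- The Laplace operator `∑ⱼ ∂ⱼ²` on polynomials. -/
def laplacian (d : ℕ) : MvPolynomial (Fin d) ℂ →ₗ[ℂ] MvPolynomial (Fin d) ℂ :=
  ∑ j, (MvPolynomial.pderiv j).toLinearMap ∘ₗ (MvPolynomial.pderiv j).toLinearMap

theorem laplacian_apply {d : ℕ} (p : MvPolynomial (Fin d) ℂ) :
    laplacian d p = ∑ j, MvPolynomial.pderiv j (MvPolynomial.pderiv j p) := by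
  simp [laplacian, LinearMap.sum_apply]

/-- The complex homogeneous harmonic polynomials of degree `i` in `d` variables. -/
def harmonicPolynomials (d i : ℕ) : Submodule ℂ (MvPolynomial (Fin d) ℂ) :=
  MvPolynomial.homogeneousSubmodule (Fin d) ℂ i ⊓ LinearMap.ker (laplacian d)

/-- The linear change of variables `p ↦ p ∘ R` on polynomials. -/
def polyRot {d : ℕ} (R : SO d) : MvPolynomial (Fin d) ℂ →ₐ[ℂ] MvPolynomial (Fin d) ℂ :=
  MvPolynomial.aeval fun j =>
    ∑ k, MvPolynomial.C (((R : Matrix (Fin d) (Fin d) ℝ) j k : ℂ)) * MvPolynomial.X k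

theorem eval_polyRot {d : ℕ} (R : SO d) (p : MvPolynomial (Fin d) ℂ) (s : Euc d) :
    MvPolynomial.eval (fun j => (s j : ℂ)) (polyRot R p) =
      MvPolynomial.eval (fun j => (rot d R s j : ℂ)) p := by
  induction p using MvPolynomial.induction_on with
  | C c => simp [polyRot]
  | add p q hp hq => simp only [map_add, hp, hq]
  | mul_X p j hp =>
    rw [map_mul, map_mul, map_mul, hp]
    congr 1
    simp [polyRot, rot_apply]

theorem pderiv_polyRot {d : ℕ} (R : SO d) (p : MvPolynomial (Fin d) ℂ) (k : Fin d) :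
    MvPolynomial.pderiv k (polyRot R p) =
      ∑ j, MvPolynomial.C (((R : Matrix (Fin d) (Fin d) ℝ) j k : ℂ)) *
        polyRot R (MvPolynomial.pderiv j p) := by
  induction p using MvPolynomial.induction_on with
  | C c => simp [polyRot]
  | add p q hp hq => simp only [map_add, hp, hq, mul_add, Finset.sum_add_distrib]
  | mul_X p l hp =>
    have h1 : MvPolynomial.pderiv k (polyRot R (MvPolynomial.X l)) =
        MvPolynomial.C (((R : Matrix (Fin d) (Fin d) ℝ) l k : ℂ)) := by
      simp [polyRot, MvPolynomial.pderiv_X, Pi.single_apply]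
    rw [map_mul, Derivation.leibniz, hp, h1]
    simp only [Derivation.leibniz, MvPolynomial.pderiv_X, map_add, smul_eq_mul, map_mul, mul_add,
      Finset.sum_add_distrib, Pi.single_apply]
    congr 1
    · simp [apply_ite, Finset.sum_ite_eq, mul_comm]
    · rw [Finset.mul_sum]
      refine Finset.sum_congr rfl fun j _ => by ring

theorem laplacian_polyRot {d : ℕ} (R : SO d) (p : MvPolynomial (Fin d) ℂ) :
    laplacian d (polyRot R p) = polyRot R (laplacian d p) := by
  have hR : (R : Matrix (Fin d) (Fin d) ℝ) * star (R : Matrix (Fin d) (Fin d) ℝ) = 1 :=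
    Matrix.mem_unitaryGroup_iff.1 (Matrix.mem_specialOrthogonalGroup_iff.1 R.2).1
  have hR' : ∀ j l, ∑ k, (R : Matrix (Fin d) (Fin d) ℝ) j k * (R : Matrix (Fin d) (Fin d) ℝ) l k =
      if j = l then 1 else 0 := fun j l => by
    have := congrFun (congrFun hR j) l
    simpa [Matrix.mul_apply, Matrix.one_apply] using this
  rw [laplacian_apply, laplacian_apply, map_sum]
  calc
    _ = ∑ k, ∑ j, ∑ l, MvPolynomial.C (((R : Matrix (Fin d) (Fin d) ℝ) j k *
          (R : Matrix (Fin d) (Fin d) ℝ) l k : ℝ) : ℂ) *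
          polyRot R (MvPolynomial.pderiv l (MvPolynomial.pderiv j p)) := by
      refine Finset.sum_congr rfl fun k _ => ?_
      rw [pderiv_polyRot, map_sum]
      refine Finset.sum_congr rfl fun j _ => ?_
      rw [Derivation.leibniz, MvPolynomial.pderiv_C, smul_zero, add_zero, pderiv_polyRot,
        smul_eq_mul, Finset.mul_sum]
      refine Finset.sum_congr rfl fun l _ => ?_
      rw [Complex.ofReal_mul, MvPolynomial.C_mul, mul_assoc]
    _ = ∑ j, ∑ l, MvPolynomial.C ((if j = l then 1 else 0 : ℝ) : ℂ) *
          polyRot R (MvPolynomial.pderiv l (MvPolynomial.pderiv j p)) := by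
      rw [Finset.sum_comm]
      refine Finset.sum_congr rfl fun j _ => ?_
      rw [Finset.sum_comm]
      refine Finset.sum_congr rfl fun l _ => ?_
      rw [← hR', ← Finset.sum_mul, Complex.ofReal_sum, map_sum]
    _ = _ := by
      refine Finset.sum_congr rfl fun j _ => ?_
      rw [Finset.sum_eq_single j]
      · simp
      · intro l _ h; simp [Ne.symm h]
      · simp

theorem polyRot_mem {d i : ℕ} (R : SO d) {p : MvPolynomial (Fin d) ℂ}
    (hp : p ∈ harmonicPolynomials d i) : polyRot R p ∈ harmonicPolynomials d i := by
  refine ⟨?_, ?_⟩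
  · have h := MvPolynomial.IsHomogeneous.aeval (n := 1)
      ((MvPolynomial.mem_homogeneousSubmodule _ _).1 hp.1)
      (fun j => ∑ k, MvPolynomial.C (((R : Matrix (Fin d) (Fin d) ℝ) j k : ℂ)) * MvPolynomial.X k)
      (fun j => MvPolynomial.IsHomogeneous.sum _ _ _ fun k _ =>
        (MvPolynomial.isHomogeneous_X ℂ k).C_mul _)
    rw [one_mul] at h
    exact (MvPolynomial.mem_homogeneousSubmodule _ _).2 h
  · change laplacian d (polyRot R p) = 0
    rw [laplacian_polyRot, LinearMap.mem_ker.1 hp.2, map_zero]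

/-- The space `H_i` of spherical harmonics of degree `i`: the homogeneous harmonic polynomials
of degree `i`, regarded as elements of `L²(S^{d-1})`. -/
def sphericalHarmonics (d i : ℕ) : AngularSpace d where
  carrier := (harmonicPolynomials d i).map (polyToSphere d)
  finite := by
    have : FiniteDimensional ℂ (MvPolynomial.homogeneousSubmodule (Fin d) ℂ i) :=
      Module.Finite.iff_fg.2 (MvPolynomial.homogeneousSubmodule_fg _ _ _)
    have : FiniteDimensional ℂ (harmonicPolynomials d i) :=
      Submodule.finiteDimensional_inf_left _ _
    infer_instance
  invariant := by
    rintro R _ ⟨p, hp, rfl⟩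
    refine ⟨polyRot R⁻¹ p, polyRot_mem _ hp, ?_⟩
    ext1
    filter_upwards [sphereRep_ae R (polyToSphere d p), polyToSphere_ae (polyRot R⁻¹ p),
      (measurePreserving_sphRot R⁻¹).quasiMeasurePreserving.ae (polyToSphere_ae p)] with s h1 h2 h3
    rw [h1, h2, h3, eval_polyRot]; rfl

/-- The coordinate `z = s₀ + i s₁` on the circle `S¹`, so that `z = exp (iθ)` at the point
`(cos θ, sin θ)`. -/
def circleCoord (s : Sph 2) : ℂ := ((s : Euc 2) 0 : ℂ) + ((s : Euc 2) 1 : ℂ) * Complex.I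

theorem circleCoord_ne_zero (s : Sph 2) : circleCoord s ≠ 0 := by
  intro h
  have h0 : (s : Euc 2) 0 = 0 := by simpa [circleCoord] using congrArg Complex.re h
  have h1 : (s : Euc 2) 1 = 0 := by simpa [circleCoord] using congrArg Complex.im h
  have : (s : Euc 2) = 0 := by
    ext j
    fin_cases j
    · exact h0
    · exact h1
  have hs : ‖(s : Euc 2)‖ = 1 := by simp
  rw [this, norm_zero] at hs
  exact zero_ne_one hs

theorem continuous_circleCoord_zpow (n : ℤ) : Continuous fun s => circleCoord s ^ n := by
  have : Continuous circleCoord := by unfold circleCoord; fun_prop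
  exact this.zpow₀ n fun s => Or.inl (circleCoord_ne_zero s)

theorem circleCoord_sphRot (R : SO 2) (s : Sph 2) :
    circleCoord (sphRot R s) = (((R : Matrix (Fin 2) (Fin 2) ℝ) 0 0 : ℂ) +
      ((R : Matrix (Fin 2) (Fin 2) ℝ) 1 0 : ℂ) * Complex.I) * circleCoord s := by
  obtain ⟨h1, h2, -⟩ := Matrix.mem_specialOrthogonalGroup_fin_two_iff.1 R.2
  simp only [circleCoord, sphRot, rot_apply, Fin.sum_univ_two, ← h1, h2]
  push_cast
  ring_nf
  rw [Complex.I_sq]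
  ring

/-- The Fourier mode `θ ↦ exp (i n θ)`, as an element of `L²(S¹)`. -/
def fourierMode (n : ℤ) : L2Sph 2 :=
  (continuous_memLp (continuous_circleCoord_zpow n)).toLp

/-- The span of the Fourier mode `θ ↦ exp (i n θ)`. -/
def fourierModes (n : ℤ) : AngularSpace 2 where
  carrier := Submodule.span ℂ {fourierMode n}
  finite := inferInstance
  invariant := by
    intro R φ hφ
    obtain ⟨c, rfl⟩ := Submodule.mem_span_singleton.1 hφ
    rw [map_smul]
    refine Submodule.smul_mem _ _ (Submodule.mem_span_singleton.2
      ⟨((((R⁻¹ : SO 2) : Matrix (Fin 2) (Fin 2) ℝ) 0 0 : ℂ) +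
      (((R⁻¹ : SO 2) : Matrix (Fin 2) (Fin 2) ℝ) 1 0 : ℂ) * Complex.I) ^ n, ?_⟩)
    have hm : fourierMode n =ᵐ[sphereMeasure 2] fun s => circleCoord s ^ n :=
      MemLp.coeFn_toLp _
    ext1
    filter_upwards [sphereRep_ae R (fourierMode n), hm,
      (measurePreserving_sphRot R⁻¹).quasiMeasurePreserving.ae hm, Lp.coeFn_smul
        (((((R⁻¹ : SO 2) : Matrix (Fin 2) (Fin 2) ℝ) 0 0 : ℂ) +
      (((R⁻¹ : SO 2) : Matrix (Fin 2) (Fin 2) ℝ) 1 0 : ℂ) * Complex.I) ^ n) (fourierMode n)]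
      with s h1 h2 h3 h4
    rw [h1, h3, h4, Pi.smul_apply, h2, circleCoord_sphRot, mul_zpow, smul_eq_mul]

theorem map_mul_restrict {a : ℝ} (ha : 0 < a) :
    (volume.restrict (Set.Ioi (0 : ℝ))).map (fun ω => a * ω) =
      ENNReal.ofReal a⁻¹ • volume.restrict (Set.Ioi (0 : ℝ)) := by
  have hpre : (fun ω : ℝ => a * ω) ⁻¹' Set.Ioi 0 = Set.Ioi 0 := by
    ext x
    simp [ha]
  have h := Measure.restrict_map (μ := (volume : Measure ℝ)) (measurable_const_mul a)
    (measurableSet_Ioi (a := (0 : ℝ)))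
  rw [hpre] at h
  rw [← h, Real.map_volume_mul_left ha.ne', Measure.restrict_smul, abs_of_pos (inv_pos.2 ha)]

/-- `J f̂ (ω, s) = ω^{(d-2)/4} / √2 · f̂ (√ω s)`. -/
def J (d : ℕ) (F : Euc d → ℂ) (ω : ℝ) (s : Sph d) : ℂ :=
  ((ω ^ (((d : ℝ) - 2) / 4) / √2 : ℝ) : ℂ) * F (√ω • (s : Euc d))

namespace AngularSpace

variable {d : ℕ} (K : AngularSpace d)

instance : FiniteDimensional ℂ K.carrier := K.finite

/-- The restriction of the regular representation of `SO(d)` to the invariant subspace `K`. -/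
def rep : UnitaryRep (SO d) K.carrier :=
  homOfIsometry
    { toFun := fun R =>
        { toLinearMap := (sphereRep d R).toLinearEquiv.toLinearMap.restrict (K.invariant R)
          norm_map' := fun φ => (sphereRep d R).norm_map φ }
      map_one' := by
        ext1 φ
        apply Subtype.ext
        change sphereRep d 1 φ = φ
        rw [map_one]; rfl
      map_mul' := fun R Q => by
        ext1 φ
        apply Subtype.ext
        change sphereRep d (R * Q) φ = sphereRep d R (sphereRep d Q φ)
        rw [map_mul]; rfl }

/-- `L²((0,∞), K) = L²((0,∞)) ⊗ K`. -/
abbrev L2Radial := Lp K.carrier 2 (volume.restrict (Set.Ioi (0 : ℝ)))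

/-- `φ ↦ (ω ↦ a^{1/2} exp (-2πi b ω) ρ(R) (φ (a ω)))`. -/
def tensorData (g : SGroup d) :
    WeightedComp (volume.restrict (Set.Ioi (0 : ℝ))) K.carrier where
  w := fun ω => ((g.a : ℝ) ^ (1 / 2 : ℝ) : ℝ) *
    Complex.exp (((-2 * Real.pi * g.b * ω : ℝ) : ℂ) * Complex.I)
  T := fun ω => g.a * ω
  A := (K.rep g.R).toLinearIsometry
  measurable_w := by fun_prop
  quasi := by
    refine ⟨measurable_const_mul _, ?_⟩
    rw [map_mul_restrict g.a.2]
    exact Measure.smul_absolutelyContinuous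
  map_withDensity := by
    have h : ∀ ω : ℝ, ‖(((g.a : ℝ) ^ (1 / 2 : ℝ) : ℝ) : ℂ) *
        Complex.exp (((-2 * Real.pi * g.b * ω : ℝ) : ℂ) * Complex.I)‖ₑ ^ 2 =
        ENNReal.ofReal g.a := fun ω => by
      rw [← ofReal_norm, norm_mul, Complex.norm_exp_ofReal_mul_I, mul_one, Complex.norm_real,
        Real.norm_of_nonneg (Real.rpow_nonneg g.a.2.le _),
        ← ENNReal.ofReal_pow (Real.rpow_nonneg g.a.2.le _), ← Real.rpow_natCast,
        ← Real.rpow_mul g.a.2.le]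
      norm_num
    simp only [h]
    rw [withDensity_const, Measure.map_smul, map_mul_restrict g.a.2, smul_smul,
      ← ENNReal.ofReal_mul g.a.2.le, mul_inv_cancel₀ g.a.2.ne', ENNReal.ofReal_one, one_smul]

/-- The representation `W⁺ ⊗ ρ_K` of `G` on `L²((0,∞), K)`, where
`W⁺(b,a) φ (ω) = a^{1/2} exp (-2πi b ω) φ (a ω)`. -/
def tensorRep : UnitaryRep (SGroup d) K.L2Radial :=
  homOfIsometry
    { toFun := fun g => (K.tensorData g).toIsometry
      map_one' := by
        refine WeightedComp.toIsometry_eq_one _ (fun ω => ?_) (fun ω => ?_) (fun v => ?_)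
        · simp [tensorData]
        · simp [tensorData]
        · change K.rep 1 v = v
          rw [map_one]; rfl
      map_mul' := fun g h => by
        refine WeightedComp.toIsometry_eq_mul (fun ω => ?_) (fun ω => ?_) (fun v => ?_)
        · simp only [tensorData, SGroup.mul_a, SGroup.mul_b, Positive.val_mul]
          rw [Real.mul_rpow g.a.2.le h.a.2.le, Complex.ofReal_mul, mul_mul_mul_comm,
            ← Complex.exp_add]
          congr 2
          push_cast
          ring
        · simp only [tensorData, SGroup.mul_a, Positive.val_mul]
          ring
        · change K.rep (g.R * h.R) v = K.rep g.R (K.rep h.R v)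
          rw [map_mul]; rfl }

open Classical in
/-- The function `ω ↦ P_K (J f̂ (ω, ·))` on `(0,∞)`, where `f̂` is the Fourier transform of `f` and
`P_K` is the orthogonal projection of `L²(S^{d-1})` onto `K` (the section `J f̂ (ω, ·)` is in
`L²(S^{d-1})` for almost every `ω`). -/
def component (f : L2 d) (ω : ℝ) : K.carrier :=
  if h : MemLp (J d (fourierL2 d f) ω) 2 (sphereMeasure d) then
    K.carrier.orthogonalProjectionOnto h.toLp
  else 0

end AngularSpace

/-! ### Irreducibility and equivalence -/

/-- A unitary representation on a nonzero space is irreducible if it has no closed invariant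
subspaces but the trivial ones. -/
def IsIrreducibleRep {G H : Type*} [Group G] [NormedAddCommGroup H] [InnerProductSpace ℂ H]
    (π : UnitaryRep G H) : Prop :=
  Nontrivial H ∧ ∀ M : Submodule ℂ H, IsClosed (M : Set H) →
    (∀ g, ∀ v ∈ M, π g v ∈ M) → M = ⊥ ∨ M = ⊤

/-- Unitary equivalence. -/
def AreEquivalent {G H₁ H₂ : Type*} [Group G] [NormedAddCommGroup H₁] [InnerProductSpace ℂ H₁]
    [NormedAddCommGroup H₂] [InnerProductSpace ℂ H₂] (π₁ : UnitaryRep G H₁)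
    (π₂ : UnitaryRep G H₂) : Prop :=
  ∃ T : H₁ ≃ₗᵢ[ℂ] H₂, ∀ g v, T (π₁ g v) = π₂ g (T v)

end Schroedinger

end

noncomputable section

namespace Schroedinger

open MeasureTheory FourierTransform
open scoped ENNReal

/-! ### Transitivity of `SO(d)` -/

/-! On the Fourier side use the coordinates ω = |ξ|² and s = ξ/|ξ|. The weight ω^{(d-2)/4}/√2 in `J`
is the square root of the Jacobian, so `J` is an isometry onto L²((0,∞) × S^{d-1}), and π(b,a,R)
becomes multiplication by e^{-2πibω}, dilation in ω and rotation in s. Decomposing L²(S^{d-1}) into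
the invariant spaces H_k then gives S, its unitarity and the intertwining relation.

Everything else follows from a single identity, `lintegral_haar_enorm_sq_inner`: ∫_G |⟨π(g)η, f⟩|²
dg = Σ_k d_k⁻¹ (∫ ‖(Sη)_k(ω)‖² dω/ω) ‖(Sf)_k‖². Comparison with ‖f‖² = Σ_k ‖(Sf)_k‖² gives the
admissibility criterion. If f is orthogonal to the orbit of η, every term vanishes, so (Sη)_k = 0 or
(Sf)_k = 0 for each k; this yields irreducibility (a proper closed invariant subspace would contain
such an η, its complement such an f) and inequivalence (an equivalence T between the summands k and
l makes φ + Tφ and φ - Tφ have vanishing matrix coefficients).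

The identity is integrated one variable at a time. For fixed (a,R) the coefficient is, in b, the
Fourier transform of an integrable function of ω, so Plancherel's theorem removes b
(`lintegral_enorm_sq_inner_schroedingerRep`). The rotations are handled by the Schur relations ∫
|⟨ρ(R)E, F⟩|² dR = Σ_k ‖P_k E‖² ‖P_k F‖² / d_k (`integral_norm_sq_inner_sphereRep`). What remains in
a is an integral against da/a, which is invariant under a ↦ aω.

The Schur relations are proved through zonal functions. The operator A_E F = ∫ ⟨ρ(R)E, F⟩ ρ(R)E dR
is symmetric and commutes with rotations. Let Z_k in H_k represent evaluation at a fixed point n.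
Each P_j A_E Z_k is fixed by the stabilizer of n, hence is a multiple of Z_j; the multiples with j ≠
k vanish, so A_E is a scalar on H_k, found by taking a trace. The properties of the H_k used here
are collected in `ZonalDecomposition`.

It remains to verify them. On the circle each H_k is a line. For d ≥ 3, orthogonality comes from the
distinct eigenvalues of the Casimir operator, totality from Stone–Weierstrass and the decomposition
of polynomials into harmonic ones modulo |x|² = 1, and uniqueness of zonal vectors from the fact
that a polynomial function on the sphere invariant about an axis is a polynomial in one coordinate.
For d = 2 the harmonics of degree k ≥ 1 split into two characters of SO(2), whence the separate
family `fourierModes`. -/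

theorem exists_rot_eq {d : ℕ} (L : Euc d ≃ₗᵢ[ℝ] Euc d)
    (hL : LinearMap.det (L.toLinearEquiv : Euc d →ₗ[ℝ] Euc d) = 1) :
    ∃ R : SO d, ∀ x, rot d R x = L x := by
  set T : Euc d →L[ℝ] Euc d := (L.toContinuousLinearEquiv : Euc d →L[ℝ] Euc d) with hT
  set M : Matrix (Fin d) (Fin d) ℝ := (Matrix.toEuclideanCLM (𝕜 := ℝ) (n := Fin d)).symm T with hM
  have hMT : Matrix.toEuclideanCLM (𝕜 := ℝ) M = T := StarAlgEquiv.apply_symm_apply _ _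
  have hTu : star T * T = 1 := by
    rw [ContinuousLinearMap.star_eq_adjoint]
    exact (ContinuousLinearMap.norm_map_iff_adjoint_comp_self T).1 fun x => L.norm_map x
  have hu : star M * M = 1 := by
    apply (Matrix.toEuclideanCLM (𝕜 := ℝ) (n := Fin d)).injective
    have h := congrArg (fun T' => star T' * T') hMT
    simp only [hTu, ← map_star, ← map_mul] at h
    exact h.trans (map_one (Matrix.toEuclideanCLM (𝕜 := ℝ) (n := Fin d))).symm
  have hdet : M.det = 1 := by
    have h1 : Matrix.toLin (EuclideanSpace.basisFun (Fin d) ℝ).toBasis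
        (EuclideanSpace.basisFun (Fin d) ℝ).toBasis M = (L.toLinearEquiv : Euc d →ₗ[ℝ] Euc d) := by
      rw [← Matrix.toEuclideanLin_eq_toLin_orthonormal]
      ext1 x
      change Matrix.toEuclideanCLM (𝕜 := ℝ) M x = _
      rw [hMT]; rfl
    rw [← hL, ← h1, LinearMap.det_toLin]
  refine ⟨⟨M, Matrix.mem_specialOrthogonalGroup_iff.2
    ⟨Matrix.mem_unitaryGroup_iff'.2 hu, hdet⟩⟩, fun x => ?_⟩
  change Matrix.toEuclideanCLM (𝕜 := ℝ) M x = _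
  rw [hMT]; rfl

theorem det_reflection_orthogonal_span_singleton {d : ℕ} {v : Euc d} (hv : v ≠ 0) :
    LinearMap.det ((ℝ ∙ v)ᗮ.reflection.toLinearEquiv : Euc d →ₗ[ℝ] Euc d) = -1 := by
  have h := Submodule.det_reflection (ℝ ∙ v)ᗮ
  rw [Submodule.orthogonal_orthogonal, finrank_span_singleton hv, pow_one] at h
  exact h

/-- Two vectors of equal norm are related by a rotation fixing any given vector which has the same
inner product with both, provided that there is a vector orthogonal to all of them. -/
theorem exists_rot_of_orthogonal {d : ℕ} {x y n w : Euc d} (hxy : ‖x‖ = ‖y‖)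
    (hn : inner ℝ x n = inner ℝ y n) (hw : w ≠ 0) (hwy : inner ℝ w y = 0)
    (hwn : inner ℝ w n = 0) : ∃ R : SO d, rot d R x = y ∧ rot d R n = n := by
  rcases eq_or_ne x y with rfl | hne
  · exact ⟨1, by simp, by simp⟩
  -- The reflection exchanging `x` and `y` fixes `n` because `x - y` is orthogonal to `n`. A second
  -- reflection, along `w`, fixes `y` and `n` and restores determinant one.
  obtain ⟨R, hR⟩ := exists_rot_eq
    ((ℝ ∙ (x - y))ᗮ.reflection.trans (ℝ ∙ w)ᗮ.reflection) (by
      have : (((ℝ ∙ (x - y))ᗮ.reflection.trans (ℝ ∙ w)ᗮ.reflection).toLinearEquiv :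
          Euc d →ₗ[ℝ] Euc d) =
        ((ℝ ∙ w)ᗮ.reflection.toLinearEquiv : Euc d →ₗ[ℝ] Euc d) ∘ₗ
          ((ℝ ∙ (x - y))ᗮ.reflection.toLinearEquiv : Euc d →ₗ[ℝ] Euc d) := rfl
      rw [this, LinearMap.det_comp, det_reflection_orthogonal_span_singleton hw,
        det_reflection_orthogonal_span_singleton (sub_ne_zero.2 hne)]
      norm_num)
  have hwf : ∀ z, inner ℝ w z = 0 → (ℝ ∙ w)ᗮ.reflection z = z := fun z hz =>
    Submodule.reflection_mem_subspace_eq_self (Submodule.mem_orthogonal_singleton_iff_inner_right.2 hz)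
  have hnf : (ℝ ∙ (x - y))ᗮ.reflection n = n :=
    Submodule.reflection_mem_subspace_eq_self
      (Submodule.mem_orthogonal_singleton_iff_inner_right.2 (by rw [inner_sub_left, hn, sub_self]))
  refine ⟨R, ?_, ?_⟩
  · rw [hR]
    change (ℝ ∙ w)ᗮ.reflection ((ℝ ∙ (x - y))ᗮ.reflection x) = y
    rw [Submodule.reflection_sub hxy, hwf y hwy]
  · rw [hR]
    change (ℝ ∙ w)ᗮ.reflection ((ℝ ∙ (x - y))ᗮ.reflection n) = n
    rw [hnf, hwf n hwn]

theorem exists_ne_zero_orthogonal {d : ℕ} (s : Finset (Euc d)) (hs : s.card < d) :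
    ∃ w : Euc d, w ≠ 0 ∧ ∀ v ∈ s, inner ℝ w v = 0 := by
  have hlt : Module.finrank ℝ (Submodule.span ℝ (s : Set (Euc d))) < d :=
    (finrank_span_finset_le_card s).trans_lt hs
  have hne : (Submodule.span ℝ (s : Set (Euc d)))ᗮ ≠ ⊥ := by
    intro h
    rw [Submodule.orthogonal_eq_bot_iff] at h
    rw [h, finrank_top, finrank_euclideanSpace_fin] at hlt
    exact lt_irrefl _ hlt
  obtain ⟨w, hw, hw0⟩ := Submodule.exists_mem_ne_zero_of_ne_bot hne
  exact ⟨w, hw0, fun v hv => Submodule.inner_left_of_mem_orthogonal (Submodule.subset_span hv) hw⟩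

theorem exists_sphRot_eq {d : ℕ} (hd : 2 ≤ d) (x y : Sph d) : ∃ R : SO d, sphRot R x = y := by
  obtain ⟨w, hw, hv⟩ := exists_ne_zero_orthogonal ({(y : Euc d)} : Finset (Euc d)) (by simp; omega)
  obtain ⟨R, hR, -⟩ := exists_rot_of_orthogonal (x := (x : Euc d)) (y := y) (n := 0) (w := w)
    (by simp) (by simp) hw (hv _ (by simp)) (by simp)
  exact ⟨R, Subtype.ext hR⟩

/-- A direction orthogonal to both `y` and `n` is needed, hence `d ≥ 3`. On the circle the
stabilizer of `n` is trivial and mirror images cannot be exchanged. -/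
theorem exists_sphRot_eq_of_inner_eq {d : ℕ} (hd : 3 ≤ d) (n x y : Sph d)
    (h : inner ℝ (x : Euc d) (n : Euc d) = inner ℝ (y : Euc d) (n : Euc d)) :
    ∃ R : SO d, sphRot R x = y ∧ sphRot R n = n := by
  classical
  obtain ⟨w, hw, hv⟩ := exists_ne_zero_orthogonal ({(y : Euc d), (n : Euc d)} : Finset (Euc d))
    (lt_of_le_of_lt Finset.card_le_two (by omega))
  obtain ⟨R, hR, hR'⟩ := exists_rot_of_orthogonal (x := (x : Euc d)) (y := y) (n := n) (w := w)
    (by simp) h hw (hv _ (by simp)) (hv _ (by simp))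
  exact ⟨R, Subtype.ext hR, Subtype.ext hR'⟩

theorem sphRot_mul {d : ℕ} (R Q : SO d) (s : Sph d) : sphRot (R * Q) s = sphRot R (sphRot Q s) :=
  Subtype.ext (by simp [sphRot])

@[simp] theorem sphRot_one {d : ℕ} (s : Sph d) : sphRot (1 : SO d) s = s :=
  Subtype.ext (by simp [sphRot])

theorem continuous_entry {d : ℕ} (j k : Fin d) :
    Continuous fun R : SO d => (R : Matrix (Fin d) (Fin d) ℝ) j k :=
  Continuous.matrix_elem continuous_subtype_val j k

theorem continuous_sphRot {d : ℕ} : Continuous fun p : SO d × Sph d => sphRot p.1 p.2 := by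
  refine Continuous.subtype_mk ?_ _
  rw [(PiLp.homeomorph 2 (fun _ : Fin d => ℝ)).isInducing.continuous_iff]
  refine continuous_pi fun j => ?_
  change Continuous fun p : SO d × Sph d => rot d p.1 p.2 j
  simp only [rot_apply]
  refine continuous_finsetSum _ fun k _ => Continuous.mul ?_ ?_
  · exact (continuous_entry j k).comp continuous_fst
  · fun_prop

theorem continuous_sphRot_inv {d : ℕ} :
    Continuous fun p : SO d × Sph d => sphRot p.1⁻¹ p.2 := by
  have h : Continuous fun R : SO d => R⁻¹ := continuous_inv
  have h₁ : Continuous fun p : SO d × Sph d => p.1⁻¹ := h.comp continuous_fst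
  have h₂ : Continuous fun p : SO d × Sph d => (p.1⁻¹, p.2) := h₁.prodMk continuous_snd
  have h₃ : Continuous ((fun p : SO d × Sph d => sphRot p.1 p.2) ∘
      fun p : SO d × Sph d => (p.1⁻¹, p.2)) := continuous_sphRot.comp h₂
  exact h₃

/-- Strong continuity: currying makes `R ↦ R⁻¹ ·` a continuous family of measure preserving maps for
the compact-open topology, and composition in `L²` is continuous along such families. It makes all
the averages over `SO(d)` below integrals of continuous functions on a compact group. -/
theorem continuous_sphereRep {d : ℕ} (φ : L2Sph d) : Continuous fun R : SO d => sphereRep d R φ := by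
  obtain ⟨c, hc⟩ : ∃ c : C(SO d, C(Sph d, Sph d)), ∀ R s, c R s = sphRot R⁻¹ s :=
    ⟨ContinuousMap.curry ⟨_, continuous_sphRot_inv⟩, fun _ _ => rfl⟩
  have hm : ∀ R : SO d, MeasurePreserving (c R) (sphereMeasure d) (sphereMeasure d) := fun R => by
    rw [show ⇑(c R) = sphRot R⁻¹ from funext (hc R)]
    exact measurePreserving_sphRot R⁻¹
  have h := Continuous.compMeasurePreservingLp (p := 2) (f := fun _ : SO d => φ) (g := c)
    continuous_const c.continuous hm ENNReal.ofNat_ne_top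
  refine h.congr fun R => ?_
  ext1
  refine (Lp.coeFn_compMeasurePreserving φ (hm R)).trans ?_
  filter_upwards [sphereRep_ae R φ] with s hs
  rw [hs, Function.comp, hc]

/-! ### Zonal decompositions of `L²(S^{d-1})` -/

theorem inner_sphereRep_left {d : ℕ} (R : SO d) (φ ψ : L2Sph d) :
    inner ℂ (sphereRep d R φ) ψ = inner ℂ φ (sphereRep d R⁻¹ ψ) := by
  rw [← (sphereRep d R).inner_map_map φ]
  congr 1
  change ψ = (sphereRep d R * sphereRep d R⁻¹) ψ
  rw [← map_mul, mul_inv_cancel, map_one]; rfl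

theorem sphereRep_mul_apply {d : ℕ} (R Q : SO d) (φ : L2Sph d) :
    sphereRep d (R * Q) φ = sphereRep d R (sphereRep d Q φ) := by
  rw [map_mul]; rfl

theorem sphereRep_ae_of_ae {d : ℕ} (R : SO d) {φ : L2Sph d} {u : Sph d → ℂ}
    (h : φ =ᵐ[sphereMeasure d] u) :
    sphereRep d R φ =ᵐ[sphereMeasure d] fun s => u (sphRot R⁻¹ s) := by
  filter_upwards [sphereRep_ae R φ,
    (measurePreserving_sphRot R⁻¹).quasiMeasurePreserving.ae h] with s h1 h2
  rw [h1, h2]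

namespace AngularSpace

variable {d : ℕ} (K : AngularSpace d)

/-- The orthogonal projection of `L²(S^{d-1})` onto an angular space. -/
abbrev proj : L2Sph d →L[ℂ] K.carrier := K.carrier.orthogonalProjectionOnto

theorem inner_proj (v : K.carrier) (F : L2Sph d) :
    inner ℂ v (K.proj F) = inner ℂ (v : L2Sph d) F :=
  Submodule.inner_orthogonalProjectionOnto_eq_of_mem_left v F

theorem inner_proj_of_mem {φ : L2Sph d} (hφ : φ ∈ K.carrier) (F : L2Sph d) :
    inner ℂ φ (K.proj F : L2Sph d) = inner ℂ φ F :=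
  K.inner_proj ⟨φ, hφ⟩ F

theorem proj_eq_zero_iff (F : L2Sph d) :
    K.proj F = 0 ↔ ∀ φ ∈ K.carrier, inner ℂ φ F = 0 := by
  rw [Submodule.orthogonalProjectionOnto_eq_zero_iff, Submodule.mem_orthogonal]

/-- Invariance under `R⁻¹` allows the rotation to be moved to the test vector without leaving the
space, so the projection intertwines. -/
theorem proj_sphereRep (R : SO d) (F : L2Sph d) :
    K.proj (sphereRep d R F) = K.rep R (K.proj F) := by
  refine ext_inner_left ℂ fun v => ?_
  rw [inner_proj]
  have h1 : (inner ℂ (v : L2Sph d) (sphereRep d R F) : ℂ) =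
      inner ℂ (sphereRep d R⁻¹ v) F := by rw [inner_sphereRep_left, inv_inv]
  have h2 : (inner ℂ v (K.rep R (K.proj F)) : ℂ) =
      inner ℂ (sphereRep d R⁻¹ v) (K.proj F : L2Sph d) := by
    rw [inner_sphereRep_left, inv_inv]; rfl
  rw [h1, h2]
  exact (K.inner_proj ⟨_, K.invariant R⁻¹ _ v.2⟩ F).symm

end AngularSpace

/-- A family of angular spaces consisting of continuous functions, whose Hilbert sum is
`L²(S^{d-1})`, and in each of which the vectors fixed by the stabilizer of the point `n` form a
space of dimension at most one. -/
structure ZonalDecomposition {d : ℕ} {ι : Type*} (K : ι → AngularSpace d) (n : Sph d) : Prop where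
  continuous : ∀ i, ∀ φ ∈ (K i).carrier, ∃ u : Sph d → ℂ, Continuous u ∧ φ =ᵐ[sphereMeasure d] u
  ne_bot : ∀ i, (K i).carrier ≠ ⊥
  orthogonal : ∀ i j, i ≠ j → ∀ φ ∈ (K i).carrier, ∀ ψ ∈ (K j).carrier, inner ℂ φ ψ = 0
  total : ∀ F : L2Sph d, (∀ i, ∀ φ ∈ (K i).carrier, inner ℂ φ F = 0) → F = 0
  zonal : ∀ i, ∀ φ ∈ (K i).carrier, ∀ ψ ∈ (K i).carrier, φ ≠ 0 →
    (∀ R, sphRot R n = n → sphereRep d R φ = φ) →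
    (∀ R, sphRot R n = n → sphereRep d R ψ = ψ) → ∃ c : ℂ, ψ = c • φ

/-- The normalized Haar measure of `SO(d)`. -/
abbrev haarSO (d : ℕ) : Measure (SO d) :=
  Measure.haarMeasure (⊤ : TopologicalSpace.PositiveCompacts (SO d))

theorem haarSO_univ (d : ℕ) : haarSO d Set.univ = 1 := by
  have h := Measure.haarMeasure_self (K₀ := (⊤ : TopologicalSpace.PositiveCompacts (SO d)))
  rwa [TopologicalSpace.PositiveCompacts.coe_top] at h

instance (d : ℕ) : IsProbabilityMeasure (haarSO d) := ⟨haarSO_univ d⟩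

/-- The average of `⟨ρ(R) E, F⟩ ρ(R) E` over `SO(d)`. -/
def rotAverage {d : ℕ} (E F : L2Sph d) : L2Sph d :=
  ∫ R, (inner ℂ (sphereRep d R E) F : ℂ) • sphereRep d R E ∂haarSO d

/-! ### The averaging operator attached to a vector -/

section RotAverage

variable {d : ℕ} (E : L2Sph d)

theorem continuous_inner_sphereRep (F : L2Sph d) :
    Continuous fun R : SO d => (inner ℂ (sphereRep d R E) F : ℂ) :=
  (continuous_sphereRep E).inner continuous_const

theorem integrable_of_continuous {X : Type*} [NormedAddCommGroup X] {u : SO d → X}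
    (hu : Continuous u) : Integrable u (haarSO d) :=
  hu.integrable_of_hasCompactSupport (HasCompactSupport.of_compactSpace u)

theorem inner_rotAverage (F G : L2Sph d) : inner ℂ G (rotAverage E F) =
    ∫ R, inner ℂ (sphereRep d R E) F * inner ℂ G (sphereRep d R E) ∂haarSO d := by
  have h := integral_inner (𝕜 := ℂ) (integrable_of_continuous
    ((continuous_inner_sphereRep E F).smul (continuous_sphereRep E))) G
  refine h.symm.trans (integral_congr_ae (Filter.Eventually.of_forall fun R => ?_))
  exact inner_smul_right _ _ _

theorem rotAverage_symmetric (F G : L2Sph d) :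
    inner ℂ (rotAverage E G) F = inner ℂ G (rotAverage E F) := by
  rw [← inner_conj_symm, inner_rotAverage, inner_rotAverage, ← integral_conj]
  congr 1
  ext R
  rw [map_mul, inner_conj_symm, inner_conj_symm, mul_comm]

/-- The integral in the Schur relations is the quadratic form of `rotAverage E`; proving those
relations thus means diagonalizing this operator. -/
theorem inner_rotAverage_self (F : L2Sph d) : inner ℂ F (rotAverage E F) =
    ((∫ R, ‖(inner ℂ (sphereRep d R E) F : ℂ)‖ ^ 2 ∂haarSO d : ℝ) : ℂ) := by
  rw [inner_rotAverage, ← integral_complex_ofReal]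
  congr 1
  ext R
  rw [← inner_conj_symm F, Complex.mul_conj, Complex.normSq_eq_norm_sq]

/-- Left invariance of Haar measure, through the substitution `R ↦ Q R`. -/
theorem rotAverage_sphereRep (Q : SO d) (F : L2Sph d) :
    rotAverage E (sphereRep d Q F) = sphereRep d Q (rotAverage E F) := by
  have h := integral_mul_left_eq_self (μ := haarSO d)
    (fun R => (inner ℂ (sphereRep d R E) (sphereRep d Q F) : ℂ) • sphereRep d R E) Q
  rw [rotAverage, ← h, rotAverage]
  have h2 := (sphereRep d Q).toContinuousLinearEquiv.toContinuousLinearMap.integral_comp_comm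
    (integrable_of_continuous ((continuous_inner_sphereRep E F).smul (continuous_sphereRep E)))
  refine Eq.trans ?_ h2
  congr 1
  ext1 R
  rw [sphereRep_mul_apply, (sphereRep d Q).inner_map_map]
  exact ((sphereRep d Q).map_smul _ _).symm

end RotAverage

/-! ### Zonal vectors are eigenvectors of the averaging operators -/

namespace ZonalDecomposition

variable {d : ℕ} {ι : Type*} {K : ι → AngularSpace d} {n : Sph d}

/-- Continuous functions that agree almost everywhere on the sphere agree, so evaluation at `n` is a
well defined linear form; it is continuous since the space is finite-dimensional, and Riesz
represents it. -/
theorem exists_evaluation (hK : ZonalDecomposition K n) (i : ι) :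
    ∃ Z : (K i).carrier, ∀ φ : (K i).carrier, ∀ u : Sph d → ℂ, Continuous u →
      (φ : L2Sph d) =ᵐ[sphereMeasure d] u → inner ℂ (Z : L2Sph d) (φ : L2Sph d) = u n := by
  choose u hu hφu using fun φ : (K i).carrier => hK.continuous i φ φ.2
  have huniq : ∀ φ : (K i).carrier, ∀ v : Sph d → ℂ, Continuous v →
      (φ : L2Sph d) =ᵐ[sphereMeasure d] v → u φ = v := fun φ v hv hφ =>
    (Continuous.ae_eq_iff_eq _ (hu φ) hv).1 ((hφu φ).symm.trans hφ)
  let ev : (K i).carrier →ₗ[ℂ] ℂ :=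
    { toFun := fun φ => u φ n
      map_add' := fun φ ψ => by
        have h := huniq (φ + ψ) (u φ + u ψ) ((hu φ).add (hu ψ))
          ((Lp.coeFn_add _ _).trans ((hφu φ).add (hφu ψ)))
        rw [h]; rfl
      map_smul' := fun c φ => by
        have h := huniq (c • φ) (c • u φ) ((hu φ).const_smul c)
          ((Lp.coeFn_smul _ _).trans ((hφu φ).const_smul c))
        rw [h]; rfl }
  refine ⟨(InnerProductSpace.toDual ℂ (K i).carrier).symm (LinearMap.toContinuousLinearMap ev),
    fun φ v hv hφ => ?_⟩
  rw [← huniq φ v hv hφ]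
  exact InnerProductSpace.toDual_symm_apply (𝕜 := ℂ) (E := (K i).carrier) (x := φ)
    (y := LinearMap.toContinuousLinearMap ev)

/-- The zonal vector: evaluation at `n`, as a vector of the angular space. -/
def zonalVector (hK : ZonalDecomposition K n) (i : ι) : (K i).carrier :=
  (hK.exists_evaluation i).choose

variable (hK : ZonalDecomposition K n)

theorem inner_zonalVector (i : ι) {φ : L2Sph d} (hφ : φ ∈ (K i).carrier)
    {u : Sph d → ℂ} (hu : Continuous u) (h : φ =ᵐ[sphereMeasure d] u) (R : SO d) :
    inner ℂ (sphereRep d R (hK.zonalVector i)) φ = u (sphRot R n) := by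
  have hc : Continuous fun s => u (sphRot R s) := by
    have h₁ : Continuous fun s : Sph d => (R, s) := Continuous.prodMk_right R
    have h₂ : Continuous ((fun p : SO d × Sph d => sphRot p.1 p.2) ∘ fun s => (R, s)) :=
      continuous_sphRot.comp h₁
    exact hu.comp h₂
  rw [inner_sphereRep_left]
  refine (hK.exists_evaluation i).choose_spec ⟨_, (K i).invariant R⁻¹ φ hφ⟩ _ hc ?_
  have := sphereRep_ae_of_ae R⁻¹ h
  rwa [inv_inv] at this

/-- The rotated zonal vectors evaluate at all points `R n`, and these exhaust the sphere. -/
theorem eq_zero_of_inner_zonalVector (hd : 2 ≤ d) (i : ι) {φ : L2Sph d} (hφ : φ ∈ (K i).carrier)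
    (h : ∀ R, inner ℂ (sphereRep d R (hK.zonalVector i)) φ = 0) : φ = 0 := by
  obtain ⟨u, hu, hφu⟩ := hK.continuous i φ hφ
  have hu0 : ∀ s, u s = 0 := fun s => by
    obtain ⟨R, hR⟩ := exists_sphRot_eq hd n s
    rw [← hR, ← hK.inner_zonalVector i hφ hu hφu, h]
  ext1
  filter_upwards [hφu, Lp.coeFn_zero ℂ 2 (sphereMeasure d)] with s h1 h2
  rw [h1, h2, hu0]; rfl

theorem zonalVector_ne_zero (hd : 2 ≤ d) (i : ι) : (hK.zonalVector i : L2Sph d) ≠ 0 := by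
  intro h
  refine hK.ne_bot i ((Submodule.eq_bot_iff _).2 fun φ hφ => ?_)
  refine hK.eq_zero_of_inner_zonalVector hd i hφ fun R => ?_
  rw [h, map_zero, inner_zero_left]

/-- Both vectors represent evaluation at `n = R n`, so their difference is orthogonal to itself. -/
theorem sphereRep_zonalVector (i : ι) {R : SO d} (hR : sphRot R n = n) :
    sphereRep d R (hK.zonalVector i) = hK.zonalVector i := by
  have hmem : sphereRep d R (hK.zonalVector i) ∈ (K i).carrier := (K i).invariant R _ (hK.zonalVector i).2
  rw [← sub_eq_zero, ← inner_self_eq_zero (𝕜 := ℂ)]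
  have hsub := Submodule.sub_mem _ hmem (hK.zonalVector i).2
  obtain ⟨u, hu, hφu⟩ := hK.continuous i _ hsub
  conv_lhs => rw [inner_sub_left, hK.inner_zonalVector i hsub hu hφu, hR]
  have h1 := hK.inner_zonalVector i hsub hu hφu 1
  rw [map_one, sphRot_one] at h1
  rw [← h1]
  exact sub_self _

/-- By the reproducing property the hypothesis says that `a Z_i = b Z_j` as functions on the sphere,
since every point is some `R n`. Orthogonality of the two spaces and `Z_i ≠ 0` then force `a = 0`.
-/
theorem eq_zero_of_zonalVector_proportional (hd : 2 ≤ d) {i j : ι} (hij : i ≠ j) {a b : ℂ}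
    (h : ∀ R, a * inner ℂ (sphereRep d R (hK.zonalVector i)) (hK.zonalVector i : L2Sph d) =
      b * inner ℂ (sphereRep d R (hK.zonalVector j)) (hK.zonalVector j : L2Sph d)) : a = 0 := by
  obtain ⟨u, hu, hφu⟩ := hK.continuous i _ (hK.zonalVector i).2
  obtain ⟨v, hv, hφv⟩ := hK.continuous j _ (hK.zonalVector j).2
  have huv : ∀ s, a * u s = b * v s := fun s => by
    obtain ⟨R, hR⟩ := exists_sphRot_eq hd n s
    have := h R
    rwa [hK.inner_zonalVector i (hK.zonalVector i).2 hu hφu,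
      hK.inner_zonalVector j (hK.zonalVector j).2 hv hφv, hR] at this
  have heq : a • (hK.zonalVector i : L2Sph d) = b • (hK.zonalVector j : L2Sph d) := by
    ext1
    filter_upwards [hφu, hφv, Lp.coeFn_smul a (hK.zonalVector i : L2Sph d),
      Lp.coeFn_smul b (hK.zonalVector j : L2Sph d)] with s h1 h2 h3 h4
    rw [h3, h4, Pi.smul_apply, Pi.smul_apply, h1, h2, smul_eq_mul, smul_eq_mul, huv]
  have h1 := congrArg (fun x => inner ℂ (hK.zonalVector i : L2Sph d) x) heq
  simp only [inner_smul_right] at h1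
  rw [hK.orthogonal i j hij _ (hK.zonalVector i).2 _ (hK.zonalVector j).2, mul_zero] at h1
  exact (mul_eq_zero.1 h1).resolve_right
    (inner_self_ne_zero.2 (hK.zonalVector_ne_zero hd i))

theorem eq_of_inner_eq (hK : ZonalDecomposition K n) {F G : L2Sph d}
    (h : ∀ i, ∀ φ ∈ (K i).carrier, inner ℂ φ F = inner ℂ φ G) : F = G := by
  rw [← sub_eq_zero]
  refine hK.total _ fun i φ hφ => ?_
  rw [inner_sub_right, h i φ hφ, sub_self]

/-- The average commutes with rotations, so each component of the image of `Z_i` is fixed by the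
stabilizer of `n` and is `c i j` times `Z_j`. Only the diagonal coefficient survives, which replaces
the inequivalence of the `K i` in Schur's lemma. -/
theorem exists_rotAverage_zonalVector (hd : 2 ≤ d) (E : L2Sph d) (i : ι) :
    ∃ c : ℂ, rotAverage E (hK.zonalVector i) = c • (hK.zonalVector i : L2Sph d) := by
  have hA : ∀ i j, ∃ c : ℂ, ((K j).proj (rotAverage E (hK.zonalVector i)) : L2Sph d) =
      c • (hK.zonalVector j : L2Sph d) := fun i j => by
    refine hK.zonal j _ (hK.zonalVector j).2 _ (Subtype.prop _) (hK.zonalVector_ne_zero hd j)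
      (fun R hR => hK.sphereRep_zonalVector j hR) fun R hR => ?_
    have h1 := (K j).proj_sphereRep R (rotAverage E (hK.zonalVector i))
    rw [← rotAverage_sphereRep, hK.sphereRep_zonalVector i hR] at h1
    exact (congrArg Subtype.val h1).symm
  choose c hc using hA
  have hin : ∀ i j R, (inner ℂ (sphereRep d R (hK.zonalVector j))
      (rotAverage E (hK.zonalVector i)) : ℂ) =
      c i j * inner ℂ (sphereRep d R (hK.zonalVector j)) (hK.zonalVector j : L2Sph d) :=
    fun i j R => by
      rw [← (K j).inner_proj_of_mem ((K j).invariant R _ (hK.zonalVector j).2), hc,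
        inner_smul_right]
  -- By symmetry and covariance the pairing of the image of `Z_i` with `ρ(R) Z_j` can be computed
  -- from either side; this gives `c i j` times the matrix coefficient of `Z_j` equal to the
  -- conjugate of `c j i` times that of `Z_i`.
  have hoff : ∀ j, j ≠ i → c i j = 0 := fun j hj => by
    refine hK.eq_zero_of_zonalVector_proportional hd hj (b := star (c j i)) fun R => ?_
    rw [← hin, ← rotAverage_symmetric, rotAverage_sphereRep, inner_sphereRep_left,
      ← inner_conj_symm, hin, map_mul]
    congr 1
    rw [inner_conj_symm, inner_sphereRep_left]
  refine ⟨c i i, hK.eq_of_inner_eq fun j φ hφ => ?_⟩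
  rw [← (K j).inner_proj_of_mem hφ, hc]
  rcases eq_or_ne j i with rfl | hj
  · rfl
  · rw [hoff j hj, zero_smul, inner_zero_right, inner_smul_right,
      hK.orthogonal j i hj _ hφ _ (hK.zonalVector i).2, mul_zero]

end ZonalDecomposition

theorem enorm_sq_eq_ofReal {X : Type*} [NormedAddCommGroup X] (x : X) :
    ‖x‖ₑ ^ 2 = ENNReal.ofReal (‖x‖ ^ 2) := by
  rw [ENNReal.ofReal_pow (norm_nonneg _), ofReal_norm]

theorem AngularSpace.inner_self {d : ℕ} (K : AngularSpace d) (v : K.carrier) :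
    (inner ℂ v v : ℂ) = ((‖v‖ ^ 2 : ℝ) : ℂ) :=
  (inner_self_eq_norm_sq_to_K (𝕜 := ℂ) v).trans (by push_cast; rfl)

/-! ### Schur orthogonality on the sphere -/

namespace ZonalDecomposition

variable {d : ℕ} {ι : Type*} {K : ι → AngularSpace d} {n : Sph d}

/-- The eigenvalue on `Z_i` extends to all of `K i`: moving the symmetric operator onto `ρ(R) Z_j`
gives the pairing `c j ⟨ρ(R) Z_j, φ⟩`, and pairings with rotated zonal vectors determine each
component. Symmetry also makes the eigenvalues real. -/
theorem exists_rotAverage_eq_smul (hK : ZonalDecomposition K n) (hd : 2 ≤ d) (E : L2Sph d) :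
    ∃ c : ι → ℝ, ∀ i, ∀ φ ∈ (K i).carrier, rotAverage E φ = (c i : ℂ) • φ := by
  choose c hc using hK.exists_rotAverage_zonalVector hd E
  have hreal : ∀ i, star (c i) = c i := fun i => by
    have h := rotAverage_symmetric E (hK.zonalVector i : L2Sph d) (hK.zonalVector i)
    rw [hc, inner_smul_left, inner_smul_right] at h
    exact mul_right_cancel₀ (inner_self_ne_zero.2 (hK.zonalVector_ne_zero hd i)) h
  have hre : ∀ i, ((c i).re : ℂ) = c i := fun i => Complex.conj_eq_iff_re.1 (hreal i)
  refine ⟨fun i => (c i).re, fun i φ hφ => ?_⟩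
  rw [hre]
  have hA : ∀ j R, (inner ℂ (sphereRep d R (hK.zonalVector j)) (rotAverage E φ) : ℂ) =
      c j * inner ℂ (sphereRep d R (hK.zonalVector j)) φ := fun j R => by
    rw [← rotAverage_symmetric, rotAverage_sphereRep, hc, map_smul, inner_smul_left]
    congr 1
    exact hreal j
  rw [← sub_eq_zero]
  refine hK.total _ fun j ψ hψ => ?_
  rw [← (K j).inner_proj_of_mem hψ]
  have h0 : ((K j).proj (rotAverage E φ - c i • φ) : L2Sph d) = 0 := by
    refine hK.eq_zero_of_inner_zonalVector hd j (Subtype.prop _) fun R => ?_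
    have hmem := (K j).invariant R _ (hK.zonalVector j).2
    rw [(K j).inner_proj_of_mem hmem, inner_sub_right, hA, inner_smul_right]
    rcases eq_or_ne j i with rfl | hj
    · exact sub_self _
    · rw [hK.orthogonal j i hj _ hmem _ hφ, mul_zero, mul_zero, sub_zero]
  rw [h0, inner_zero_right]

theorem isHilbertSum (hK : ZonalDecomposition K n) :
    IsHilbertSum ℂ (fun i => (K i).carrier) fun i => (K i).carrier.subtypeₗᵢ := by
  refine IsHilbertSum.mkInternal (F := fun i => (K i).carrier)
    (fun i j hij φ ψ => hK.orthogonal i j hij _ φ.2 _ ψ.2) ?_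
  rw [top_le_iff, Submodule.topologicalClosure_eq_top_iff, Submodule.eq_bot_iff]
  refine fun F hF => hK.total F fun i φ hφ => ?_
  exact (Submodule.mem_orthogonal _ _).1 hF φ (Submodule.mem_iSup_of_mem i hφ)

theorem hasSum_inner_proj (hK : ZonalDecomposition K n) (F G : L2Sph d) :
    HasSum (fun i => (inner ℂ ((K i).proj F) ((K i).proj G) : ℂ)) (inner ℂ F G) := by
  classical
  -- The coordinates of the abstract Hilbert sum isometry are the orthogonal projections, as seen by
  -- pairing with sequences supported at one index.
  have hW : ∀ F i, hK.isHilbertSum.linearIsometryEquiv F i = (K i).proj F := fun F i => by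
    refine ext_inner_left ℂ fun v => ?_
    have h1 := lp.inner_single_left (𝕜 := ℂ) i v (hK.isHilbertSum.linearIsometryEquiv F)
    rw [← hK.isHilbertSum.linearIsometryEquiv.symm.inner_map_map,
      hK.isHilbertSum.linearIsometryEquiv_symm_apply_single,
      LinearIsometryEquiv.symm_apply_apply] at h1
    exact h1.symm.trans ((K i).inner_proj v F).symm
  have h := lp.hasSum_inner (𝕜 := ℂ) (hK.isHilbertSum.linearIsometryEquiv F)
    (hK.isHilbertSum.linearIsometryEquiv G)
  rw [LinearIsometryEquiv.inner_map_map] at h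
  have h' : (fun i => (inner ℂ ((K i).proj F) ((K i).proj G) : ℂ)) = fun i =>
      inner ℂ (hK.isHilbertSum.linearIsometryEquiv F i) (hK.isHilbertSum.linearIsometryEquiv G i) :=
    funext fun i => congrArg₂ (fun v w : (K i).carrier => (inner ℂ v w : ℂ)) (hW F i).symm (hW G i).symm
  rw [h']
  exact h

theorem hasSum_norm_sq_proj (hK : ZonalDecomposition K n) (F : L2Sph d) :
    HasSum (fun i => ‖(K i).proj F‖ ^ 2) (‖F‖ ^ 2) := by
  have h := hK.hasSum_inner_proj F F
  simp only [AngularSpace.inner_self] at h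
  rw [inner_self_eq_norm_sq_to_K] at h
  exact Complex.hasSum_ofReal.1 (by push_cast; simpa using h)

theorem tsum_enorm_sq_proj (hK : ZonalDecomposition K n) (F : L2Sph d) :
    ∑' i, ‖(K i).proj F‖ₑ ^ 2 = ‖F‖ₑ ^ 2 := by
  have h := hK.hasSum_norm_sq_proj F
  rw [enorm_sq_eq_ofReal F, ← h.tsum_eq, ENNReal.ofReal_tsum_of_nonneg (fun i => by positivity) h.summable]
  simp only [enorm_sq_eq_ofReal]

/-- The Schur orthogonality relations, for the matrix coefficients of the regular representation
on the sphere. -/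
theorem integral_norm_sq_inner_sphereRep (hK : ZonalDecomposition K n) (hd : 2 ≤ d)
    (E F : L2Sph d) :
    HasSum (fun i => ‖(K i).proj E‖ ^ 2 / Module.finrank ℂ (K i).carrier * ‖(K i).proj F‖ ^ 2)
      (∫ R, ‖(inner ℂ (sphereRep d R E) F : ℂ)‖ ^ 2 ∂haarSO d) := by
  obtain ⟨c, hc⟩ := hK.exists_rotAverage_eq_smul hd E
  -- The trace of the average on `K i` is `c i` times the dimension. Computed under the integral it
  -- is the sum of `|⟨ρ(R)E, b m⟩|²` over an orthonormal basis, which is `‖P_i E‖²` for every `R`.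
  have htrace : ∀ i, c i = ‖(K i).proj E‖ ^ 2 / Module.finrank ℂ (K i).carrier := fun i => by
    let b := stdOrthonormalBasis ℂ (K i).carrier
    have hpos : (0 : ℝ) < Module.finrank ℂ (K i).carrier := by
      have := Submodule.nontrivial_iff_ne_bot.2 (hK.ne_bot i)
      exact_mod_cast Module.finrank_pos
    have hm : ∀ m, ∫ R, ‖(inner ℂ (sphereRep d R E) (b m : L2Sph d) : ℂ)‖ ^ 2 ∂haarSO d = c i :=
      fun m => by
        have h1 := inner_rotAverage_self E (b m : L2Sph d)
        rw [hc i _ (b m).2, inner_smul_right] at h1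
        have h2 : (inner ℂ (b m : L2Sph d) (b m : L2Sph d) : ℂ) = 1 := by
          have := b.orthonormal.1 m
          rw [inner_self_eq_norm_sq_to_K]
          change ((‖b m‖ : ℂ)) ^ 2 = 1
          rw [this]; simp
        rw [h2, mul_one] at h1
        exact_mod_cast h1.symm
    have hR : ∀ R : SO d, ∑ m, ‖(inner ℂ (sphereRep d R E) (b m : L2Sph d) : ℂ)‖ ^ 2 =
        ‖(K i).proj E‖ ^ 2 := fun R => by
      have h1 : ‖(K i).proj E‖ = ‖(K i).proj (sphereRep d R E)‖ := by
        rw [(K i).proj_sphereRep, LinearIsometryEquiv.norm_map]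
      rw [h1, ← b.sum_sq_norm_inner_right]
      refine Finset.sum_congr rfl fun m _ => ?_
      rw [(K i).inner_proj, ← inner_conj_symm, RCLike.norm_conj]
    have hsum : ∫ R, ∑ m, ‖(inner ℂ (sphereRep d R E) (b m : L2Sph d) : ℂ)‖ ^ 2 ∂haarSO d =
        ∑ m, ∫ R, ‖(inner ℂ (sphereRep d R E) (b m : L2Sph d) : ℂ)‖ ^ 2 ∂haarSO d :=
      integral_finsetSum _ fun m _ =>
        integrable_of_continuous ((continuous_inner_sphereRep E _).norm.pow 2)
    simp only [hR, hm, integral_const, Finset.sum_const, Finset.card_univ, Fintype.card_fin,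
      probReal_univ, one_smul, nsmul_eq_mul] at hsum
    rw [hsum]
    field_simp
  -- Parseval for the quadratic form. Although `F` need not lie in one `K i`, the operator can be
  -- moved onto the projection of `F`, where it is the scalar `c i`.
  have h := hK.hasSum_inner_proj F (rotAverage E F)
  rw [inner_rotAverage_self] at h
  have hproj : ∀ i, (inner ℂ ((K i).proj F) ((K i).proj (rotAverage E F)) : ℂ) =
      ((‖(K i).proj E‖ ^ 2 / Module.finrank ℂ (K i).carrier * ‖(K i).proj F‖ ^ 2 : ℝ) : ℂ) :=
    fun i => by
      rw [(K i).inner_proj, ← rotAverage_symmetric, hc i _ (Subtype.prop _), inner_smul_left,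
        ← (K i).inner_proj, (K i).inner_self, Complex.conj_ofReal, htrace, Complex.ofReal_mul]
  simp only [hproj] at h
  exact_mod_cast h

theorem lintegral_enorm_sq_inner_sphereRep (hK : ZonalDecomposition K n) (hd : 2 ≤ d)
    (E F : L2Sph d) :
    ∫⁻ R, ‖(inner ℂ (sphereRep d R E) F : ℂ)‖ₑ ^ 2 ∂haarSO d =
      ∑' i, ‖(K i).proj E‖ₑ ^ 2 / Module.finrank ℂ (K i).carrier * ‖(K i).proj F‖ₑ ^ 2 := by
  have h := hK.integral_norm_sq_inner_sphereRep hd E F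
  have hpos : ∀ i, (0 : ℝ) < Module.finrank ℂ (K i).carrier := fun i => by
    have := Submodule.nontrivial_iff_ne_bot.2 (hK.ne_bot i)
    exact_mod_cast Module.finrank_pos
  have h1 : ∫⁻ R, ‖(inner ℂ (sphereRep d R E) F : ℂ)‖ₑ ^ 2 ∂haarSO d =
      ENNReal.ofReal (∫ R, ‖(inner ℂ (sphereRep d R E) F : ℂ)‖ ^ 2 ∂haarSO d) := by
    have hi : Integrable (fun R => ‖(inner ℂ (sphereRep d R E) F : ℂ)‖ ^ 2) (haarSO d) :=
      integrable_of_continuous ((continuous_inner_sphereRep E F).norm.pow 2)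
    rw [ofReal_integral_eq_lintegral_ofReal hi
      (Filter.Eventually.of_forall fun R => sq_nonneg _)]
    simp only [enorm_sq_eq_ofReal]
  rw [h1, ← h.tsum_eq, ENNReal.ofReal_tsum_of_nonneg
    (fun i => mul_nonneg (div_nonneg (sq_nonneg _) (hpos i).le) (sq_nonneg _)) h.summable]
  refine tsum_congr fun i => ?_
  rw [ENNReal.ofReal_mul (div_nonneg (sq_nonneg _) (hpos i).le), ENNReal.ofReal_div_of_pos (hpos i), ← enorm_sq_eq_ofReal, ← enorm_sq_eq_ofReal,
    ENNReal.ofReal_natCast]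

end ZonalDecomposition

/-! ### Polar coordinates -/

theorem lintegral_polar {d : ℕ} (hd : 1 ≤ d) {g : Euc d → ℝ≥0∞} (hg : Measurable g) :
    ∫⁻ x, g x = ∫⁻ r in Set.Ioi (0 : ℝ), ∫⁻ s : Sph d,
      ENNReal.ofReal (r ^ (d - 1)) * g (r • (s : Euc d)) ∂sphereMeasure d := by
  have : NeZero d := ⟨by omega⟩
  have hG : Measurable fun p : Sph d × Set.Ioi (0 : ℝ) => g ((p.2 : ℝ) • (p.1 : Euc d)) :=
    hg.comp (by fun_prop)
  calc
    ∫⁻ x, g x = ∫⁻ x : ({(0 : Euc d)}ᶜ : Set (Euc d)), g x ∂(volume.comap Subtype.val) := by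
      rw [lintegral_subtype_comap (measurableSet_singleton _).compl, restrict_compl_singleton]
    _ = ∫⁻ p, g ((p.2 : ℝ) • (p.1 : Euc d))
          ∂((sphereMeasure d).prod (Measure.volumeIoiPow (Module.finrank ℝ (Euc d) - 1))) := by
      rw [← (Measure.measurePreserving_homeomorphUnitSphereProd
        (volume : Measure (Euc d))).lintegral_comp hG]
      refine lintegral_congr fun x => ?_
      have hx := congrArg Subtype.val ((homeomorphUnitSphereProd (Euc d)).symm_apply_apply x)
      rw [homeomorphUnitSphereProd_symm_apply_coe] at hx
      rw [hx]
    _ = ∫⁻ r : Set.Ioi (0 : ℝ), ENNReal.ofReal ((r : ℝ) ^ (d - 1)) *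
          ∫⁻ s : Sph d, g ((r : ℝ) • (s : Euc d)) ∂sphereMeasure d ∂(volume.comap Subtype.val) := by
      rw [lintegral_prod_symm _ hG.aemeasurable, Measure.volumeIoiPow, finrank_euclideanSpace_fin,
        lintegral_withDensity_eq_lintegral_mul₀ (by fun_prop)
          hG.lintegral_prod_left'.aemeasurable]
      rfl
    _ = ∫⁻ r in Set.Ioi (0 : ℝ), ENNReal.ofReal (r ^ (d - 1)) *
          ∫⁻ s : Sph d, g (r • (s : Euc d)) ∂sphereMeasure d :=
      lintegral_subtype_comap measurableSet_Ioi fun r : ℝ => ENNReal.ofReal (r ^ (d - 1)) *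
          ∫⁻ s : Sph d, g (r • (s : Euc d)) ∂sphereMeasure d
    _ = _ := by
      refine lintegral_congr fun r => ?_
      rw [lintegral_const_mul]
      exact hg.comp (by fun_prop)

theorem lintegral_Ioi_comp_sqrt (g : ℝ → ℝ≥0∞) :
    ∫⁻ r in Set.Ioi (0 : ℝ), g r =
      ∫⁻ ω in Set.Ioi (0 : ℝ), ENNReal.ofReal (1 / (2 * √ω)) * g √ω := by
  have himg : Real.sqrt '' Set.Ioi 0 = Set.Ioi 0 := by
    ext x
    constructor
    · rintro ⟨y, hy, rfl⟩
      exact Real.sqrt_pos.2 hy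
    · intro hx
      exact ⟨x ^ 2, pow_pos (Set.mem_Ioi.1 hx) 2, Real.sqrt_sq (le_of_lt hx)⟩
  have h := lintegral_image_eq_lintegral_abs_deriv_mul (f := Real.sqrt) measurableSet_Ioi
    (fun x (hx : x ∈ Set.Ioi (0 : ℝ)) =>
      (Real.hasDerivAt_sqrt (ne_of_gt hx)).hasDerivWithinAt)
    (fun x hx y hy hxy => (Real.sqrt_inj (le_of_lt hx) (le_of_lt hy)).1 hxy) g
  rw [himg] at h
  rw [h]
  refine lintegral_congr fun x => ?_
  rw [abs_of_nonneg (by positivity)]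

/-- The reason for the normalization of `J`: the Jacobian of `r = √ω` times the polar density
`r^(d-1)` is the square of the weight in `J`. -/
theorem sqrt_density {d : ℕ} (hd : 1 ≤ d) {ω : ℝ} (hω : 0 < ω) :
    1 / (2 * √ω) * √ω ^ (d - 1) = (ω ^ (((d : ℝ) - 2) / 4) / √2) ^ 2 := by
  have h1 : (ω ^ (((d : ℝ) - 2) / 4)) ^ 2 = ω ^ (((d : ℝ) - 2) / 2) := by
    rw [← Real.rpow_natCast, ← Real.rpow_mul hω.le]; congr 1; push_cast; ring
  have h2 : √ω ^ (d - 1) = ω ^ (((d : ℝ) - 1) / 2) := by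
    rw [Real.sqrt_eq_rpow, ← Real.rpow_natCast, ← Real.rpow_mul hω.le, Nat.cast_sub hd]
    congr 1; push_cast; ring
  have h3 : ω ^ (((d : ℝ) - 1) / 2) = ω ^ (((d : ℝ) - 2) / 2) * √ω := by
    rw [Real.sqrt_eq_rpow, ← Real.rpow_add hω]; congr 1; ring
  rw [div_pow, h1, h2, h3, Real.sq_sqrt zero_le_two]
  have := Real.sqrt_pos.2 hω
  field_simp

theorem lintegral_polar_sqrt {d : ℕ} (hd : 1 ≤ d) {g : Euc d → ℝ≥0∞} (hg : Measurable g) :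
    ∫⁻ x, g x = ∫⁻ ω in Set.Ioi (0 : ℝ), ∫⁻ s : Sph d,
      ENNReal.ofReal ((ω ^ (((d : ℝ) - 2) / 4) / √2) ^ 2) * g (√ω • (s : Euc d))
        ∂sphereMeasure d := by
  rw [lintegral_polar hd hg, lintegral_Ioi_comp_sqrt]
  refine setLIntegral_congr_fun measurableSet_Ioi fun ω hω => ?_
  have hm : Measurable fun s : Sph d => g (√ω • (s : Euc d)) := hg.comp (by fun_prop)
  rw [lintegral_const_mul _ hm, lintegral_const_mul _ hm, ← mul_assoc,
    ← ENNReal.ofReal_mul (by positivity), sqrt_density hd hω]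

theorem measurable_J {d : ℕ} {F : Euc d → ℂ} (hF : Measurable F) :
    Measurable fun p : ℝ × Sph d => J d F p.1 p.2 := by
  unfold J
  refine Measurable.mul ?_ (hF.comp (by fun_prop))
  fun_prop

theorem measurable_J_apply {d : ℕ} {F : Euc d → ℂ} (hF : Measurable F) (ω : ℝ) :
    Measurable (J d F ω) :=
  (measurable_J hF).comp measurable_prodMk_left

theorem lintegral_enorm_sq_J {d : ℕ} (hd : 1 ≤ d) {F : Euc d → ℂ} (hF : Measurable F) :
    ∫⁻ ω in Set.Ioi (0 : ℝ), ∫⁻ s : Sph d, ‖J d F ω s‖ₑ ^ 2 ∂sphereMeasure d =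
      ∫⁻ x, ‖F x‖ₑ ^ 2 := by
  rw [lintegral_polar_sqrt hd (by fun_prop)]
  refine lintegral_congr fun ω => lintegral_congr fun s => ?_
  rw [J, enorm_mul, mul_pow, enorm_sq_eq_ofReal (_ : ℂ), Complex.norm_real, Real.norm_eq_abs, sq_abs]

/-- A property which holds almost everywhere on `ℝ^d` holds almost everywhere on almost every
sphere. -/
theorem ae_polar {d : ℕ} (hd : 1 ≤ d) {p : Euc d → Prop} (h : ∀ᵐ x, p x) :
    ∀ᵐ ω ∂volume.restrict (Set.Ioi (0 : ℝ)), ∀ᵐ s : Sph d ∂sphereMeasure d, p (√ω • (s : Euc d)) := by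
  obtain ⟨t, hts, ht, ht0⟩ := exists_measurable_superset_of_null (ae_iff.1 h)
  have h0 := lintegral_polar_sqrt hd (g := t.indicator 1) (measurable_one.indicator ht)
  rw [lintegral_indicator_one ht, ht0, eq_comm, lintegral_eq_zero_iff'] at h0
  · filter_upwards [h0, ae_restrict_mem measurableSet_Ioi] with ω hω hpos
    have hm : Measurable fun s : Sph d => √ω • (s : Euc d) := by fun_prop
    rw [Pi.zero_apply, lintegral_eq_zero_iff'] at hω
    · filter_upwards [hω] with s hs
      by_contra hps
      have hmem : √ω • (s : Euc d) ∈ t := hts hps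
      rw [Set.indicator_of_mem hmem, Pi.one_apply, mul_one, Pi.zero_apply,
        ENNReal.ofReal_eq_zero] at hs
      have : (0 : ℝ) < (ω ^ (((d : ℝ) - 2) / 4) / √2) ^ 2 := by
        have := Real.rpow_pos_of_pos hpos (((d : ℝ) - 2) / 4)
        positivity
      exact absurd hs (not_le.2 this)
    · exact ((measurable_one.indicator ht).comp hm).const_mul _ |>.aemeasurable
  · refine Measurable.aemeasurable (Measurable.lintegral_prod_right' (f := fun p : ℝ × Sph d =>
      ENNReal.ofReal ((p.1 ^ (((d : ℝ) - 2) / 4) / √2) ^ 2) *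
        t.indicator (1 : Euc d → ℝ≥0∞) (√p.1 • (p.2 : Euc d))) ?_)
    refine Measurable.mul (by fun_prop) ((measurable_one.indicator ht).comp (by fun_prop))

/-! ### Radial sections -/

theorem enorm_sq_Lp {α E : Type*} [MeasurableSpace α] [NormedAddCommGroup E] {μ : Measure α}
    (f : Lp E 2 μ) : ‖f‖ₑ ^ 2 = ∫⁻ x, ‖f x‖ₑ ^ 2 ∂μ := by
  have h := eLpNorm_nnreal_pow_eq_lintegral (f := f) (μ := μ) (p := 2) (by norm_num)
  rw [Lp.enorm_def]
  simpa using h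

theorem enorm_sq_toLp {α E : Type*} [MeasurableSpace α] [NormedAddCommGroup E] {μ : Measure α}
    {f : α → E} (hf : MemLp f 2 μ) : ‖hf.toLp‖ₑ ^ 2 = ∫⁻ x, ‖f x‖ₑ ^ 2 ∂μ := by
  rw [enorm_sq_Lp]
  refine lintegral_congr_ae ?_
  filter_upwards [hf.coeFn_toLp] with x hx
  rw [hx]

theorem memLp_two_of_lintegral {α E : Type*} [MeasurableSpace α] [NormedAddCommGroup E]
    {μ : Measure α} {f : α → E} (hf : AEStronglyMeasurable f μ) (h : ∫⁻ x, ‖f x‖ₑ ^ 2 ∂μ ≠ ∞) :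
    MemLp f 2 μ := by
  refine ⟨hf, ?_⟩
  have h2 := eLpNorm_nnreal_pow_eq_lintegral (f := f) (μ := μ) (p := 2) (by norm_num)
  have h3 : eLpNorm f 2 μ ^ (2 : ℝ) = ∫⁻ x, ‖f x‖ₑ ^ 2 ∂μ := by simpa using h2
  rw [← h3] at h
  rw [lt_top_iff_ne_top]
  intro htop
  exact h (by rw [htop]; simp)

theorem lintegral_enorm_sq_ne_top {α E : Type*} [MeasurableSpace α] [NormedAddCommGroup E]
    {μ : Measure α} {f : α → E} (hf : MemLp f 2 μ) : ∫⁻ x, ‖f x‖ₑ ^ 2 ∂μ ≠ ∞ := by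
  rw [← enorm_sq_toLp hf]
  exact ENNReal.pow_ne_top enorm_ne_top

/-- Lebesgue measure on the half line. -/
abbrev halfLine : Measure ℝ := volume.restrict (Set.Ioi (0 : ℝ))

open Classical in
/-- The function `J F (ω, ·)` as an element of `L²(S^{d-1})`. -/
def radialSection (d : ℕ) (F : Euc d → ℂ) (ω : ℝ) : L2Sph d :=
  if h : MemLp (J d F ω) 2 (sphereMeasure d) then h.toLp else 0

theorem radialSection_ae {d : ℕ} {F : Euc d → ℂ} {ω : ℝ}
    (h : MemLp (J d F ω) 2 (sphereMeasure d)) :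
    radialSection d F ω =ᵐ[sphereMeasure d] J d F ω := by
  rw [radialSection, dif_pos h]
  exact h.coeFn_toLp

theorem radialSection_eq_of_ae {d : ℕ} {F : Euc d → ℂ} {ω : ℝ} {φ : L2Sph d}
    (h : J d F ω =ᵐ[sphereMeasure d] φ) : radialSection d F ω = φ := by
  ext1
  exact (radialSection_ae ((memLp_congr_ae h).2 (Lp.memLp φ))).trans h

theorem component_eq {d : ℕ} (K : AngularSpace d) (f : L2 d) (ω : ℝ) :
    K.component f ω = K.proj (radialSection d (fourierL2 d f) ω) := by
  rw [AngularSpace.component, radialSection]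
  split_ifs with h
  · rfl
  · rw [map_zero]

section Sections

variable {d : ℕ} (hd : 1 ≤ d) {F G : Euc d → ℂ}

theorem measurable_lintegral_J (hF : Measurable F) :
    Measurable fun ω => ∫⁻ s : Sph d, ‖J d F ω s‖ₑ ^ 2 ∂sphereMeasure d :=
  Measurable.lintegral_prod_right' (f := fun p : ℝ × Sph d => ‖J d F p.1 p.2‖ₑ ^ 2)
    ((measurable_J hF).enorm.pow_const 2)

include hd

theorem memLp_J (hF : Measurable F) (h : MemLp F 2) :
    ∀ᵐ ω ∂halfLine, MemLp (J d F ω) 2 (sphereMeasure d) := by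
  have hne : ∫⁻ ω, ∫⁻ s : Sph d, ‖J d F ω s‖ₑ ^ 2 ∂sphereMeasure d ∂halfLine ≠ ∞ := by
    rw [lintegral_enorm_sq_J hd hF]
    exact lintegral_enorm_sq_ne_top h
  filter_upwards [ae_lt_top (measurable_lintegral_J hF) hne] with ω hω
  exact memLp_two_of_lintegral (measurable_J_apply hF ω).aestronglyMeasurable hω.ne

/-- A single sphere is a null set of `ℝ^d`, so changing the representative of an `L²` class may
spoil some sections, but only for a null set of `ω`. -/
theorem radialSection_congr (h : F =ᵐ[volume] G) :
    ∀ᵐ ω ∂halfLine, J d F ω =ᵐ[sphereMeasure d] J d G ω := by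
  filter_upwards [ae_polar hd h] with ω hω
  filter_upwards [hω] with s hs
  rw [J, J, hs]

theorem lintegral_enorm_sq_radialSection (hF : Measurable F) (h : MemLp F 2) :
    ∫⁻ ω, ‖radialSection d F ω‖ₑ ^ 2 ∂halfLine = ∫⁻ x, ‖F x‖ₑ ^ 2 := by
  rw [← lintegral_enorm_sq_J hd hF]
  refine lintegral_congr_ae ?_
  filter_upwards [memLp_J hd hF h] with ω hω
  rw [radialSection, dif_pos hω, enorm_sq_toLp]

theorem inner_radialSection (hF : Measurable F) (h : MemLp F 2) (φ : L2Sph d) :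
    (fun ω => (inner ℂ φ (radialSection d F ω) : ℂ)) =ᵐ[halfLine]
      fun ω => ∫ s, inner ℂ (φ s) (J d F ω s) ∂sphereMeasure d := by
  filter_upwards [memLp_J hd hF h] with ω hω
  rw [L2.inner_def]
  refine integral_congr_ae ?_
  filter_upwards [radialSection_ae hω] with s hs
  rw [hs]

theorem aestronglyMeasurable_inner_radialSection (hF : Measurable F) (h : MemLp F 2)
    (φ : L2Sph d) :
    AEStronglyMeasurable (fun ω => (inner ℂ φ (radialSection d F ω) : ℂ)) halfLine := by
  refine AEStronglyMeasurable.congr ?_ (inner_radialSection hd hF h φ).symm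
  refine StronglyMeasurable.aestronglyMeasurable (StronglyMeasurable.integral_prod_right
    (f := fun ω s => (inner ℂ (φ s) (J d F ω s) : ℂ)) ?_)
  exact ((Lp.stronglyMeasurable φ).comp_measurable measurable_snd).inner
    (measurable_J hF).stronglyMeasurable

/-- Finite dimension reduces measurability to that of the scalar pairings with a basis, which are
parametric integrals; measurability of the `L²(S^{d-1})`-valued map itself is never needed. -/
theorem aestronglyMeasurable_proj_radialSection (K : AngularSpace d) (hF : Measurable F)
    (h : MemLp F 2) :
    AEStronglyMeasurable (fun ω => K.proj (radialSection d F ω)) halfLine := by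
  let b := stdOrthonormalBasis ℂ K.carrier
  have hb : (fun ω => K.proj (radialSection d F ω)) =
      fun ω => ∑ m, (inner ℂ (b m : L2Sph d) (radialSection d F ω) : ℂ) • b m := by
    ext1 ω
    conv_lhs => rw [← b.sum_repr' (K.proj (radialSection d F ω))]
    refine Finset.sum_congr rfl fun m _ => ?_
    rw [K.inner_proj]
  rw [hb]
  exact Finset.aestronglyMeasurable_fun_sum _ fun m _ =>
    (aestronglyMeasurable_inner_radialSection hd hF h _).smul_const _

end Sections

section Component

variable {d : ℕ} (K : AngularSpace d)

theorem measurable_coe (f : L2 d) : Measurable f := (Lp.stronglyMeasurable f).measurable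

theorem memLp_component (hd : 1 ≤ d) (f : L2 d) : MemLp (K.component f) 2 halfLine := by
  have hF := measurable_coe (fourierL2 d f)
  have h := Lp.memLp (fourierL2 d f)
  simp only [funext (component_eq K f)]
  refine memLp_two_of_lintegral (aestronglyMeasurable_proj_radialSection hd K hF h) ?_
  refine ne_top_of_le_ne_top (lintegral_enorm_sq_ne_top h) ?_
  rw [← lintegral_enorm_sq_radialSection hd hF h]
  refine lintegral_mono fun ω => ?_
  gcongr
  exact enorm_le_iff_norm_le.2 (Submodule.norm_orthogonalProjectionOnto_apply_le _ _)

theorem radialSection_add (hd : 1 ≤ d) (F G : L2 d) : ∀ᵐ ω ∂halfLine,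
    radialSection d (F + G : L2 d) ω = radialSection d F ω + radialSection d G ω := by
  filter_upwards [memLp_J hd (measurable_coe F) (Lp.memLp F),
    memLp_J hd (measurable_coe G) (Lp.memLp G),
    radialSection_congr hd (Lp.coeFn_add F G)] with ω h1 h2 h3
  refine radialSection_eq_of_ae ?_
  filter_upwards [h3, Lp.coeFn_add (radialSection d F ω) (radialSection d G ω),
    radialSection_ae h1, radialSection_ae h2] with s h4 h5 h6 h7
  rw [h4, h5, Pi.add_apply, h6, h7, J, J, J, Pi.add_apply, mul_add]

theorem radialSection_smul (hd : 1 ≤ d) (c : ℂ) (F : L2 d) : ∀ᵐ ω ∂halfLine,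
    radialSection d (c • F : L2 d) ω = c • radialSection d F ω := by
  filter_upwards [memLp_J hd (measurable_coe F) (Lp.memLp F),
    radialSection_congr hd (Lp.coeFn_smul c F)] with ω h1 h3
  refine radialSection_eq_of_ae ?_
  filter_upwards [h3, Lp.coeFn_smul c (radialSection d F ω), radialSection_ae h1] with s h4 h5 h6
  rw [h4, h5, Pi.smul_apply, h6, J, J, Pi.smul_apply, smul_eq_mul, smul_eq_mul]
  ring

/-- The map `f ↦ (ω ↦ P_K (J f̂ (ω, ·)))`. -/
def componentMap (hd : 1 ≤ d) : L2 d →ₗ[ℂ] K.L2Radial where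
  toFun f := (memLp_component K hd f).toLp
  map_add' f g := by
    ext1
    filter_upwards [(memLp_component K hd (f + g)).coeFn_toLp,
      (memLp_component K hd f).coeFn_toLp, (memLp_component K hd g).coeFn_toLp,
      Lp.coeFn_add (memLp_component K hd f).toLp (memLp_component K hd g).toLp,
      radialSection_add hd (fourierL2 d f) (fourierL2 d g)] with ω h1 h2 h3 h4 h5
    rw [h1, h4, Pi.add_apply, h2, h3, component_eq, component_eq, component_eq, map_add, h5,
      map_add]
  map_smul' c f := by
    ext1
    filter_upwards [(memLp_component K hd (c • f)).coeFn_toLp,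
      (memLp_component K hd f).coeFn_toLp, Lp.coeFn_smul c (memLp_component K hd f).toLp,
      radialSection_smul hd c (fourierL2 d f)] with ω h1 h2 h4 h5
    rw [RingHom.id_apply, h1, h4, Pi.smul_apply, h2, component_eq, component_eq, map_smul, h5,
      map_smul]

theorem componentMap_ae (hd : 1 ≤ d) (f : L2 d) :
    componentMap K hd f =ᵐ[halfLine] K.component f :=
  (memLp_component K hd f).coeFn_toLp

end Component

/-! ### The decomposition of `L²(ℝ^d)` -/

section Decomposition

variable {d : ℕ} {ι : Type*} {K : ι → AngularSpace d} {n : Sph d}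

/-- Parseval on almost every sphere, integrated over `ω`; countability of the index set lets the sum
and the integral be exchanged. -/
theorem tsum_enorm_sq_componentMap [Countable ι] (hK : ZonalDecomposition K n) (hd : 1 ≤ d)
    (f : L2 d) : ∑' i, ‖componentMap (K i) hd f‖ₑ ^ 2 = ‖f‖ₑ ^ 2 := by
  have hF := measurable_coe (fourierL2 d f)
  have h := Lp.memLp (fourierL2 d f)
  have h1 : ∀ i, ‖componentMap (K i) hd f‖ₑ ^ 2 =
      ∫⁻ ω, ‖(K i).proj (radialSection d (fourierL2 d f) ω)‖ₑ ^ 2 ∂halfLine := fun i => by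
    rw [enorm_sq_Lp]
    refine lintegral_congr_ae ?_
    filter_upwards [componentMap_ae (K i) hd f] with ω hω
    rw [hω, component_eq]
  simp only [h1]
  rw [← lintegral_tsum fun i =>
    (aestronglyMeasurable_proj_radialSection hd (K i) hF h).enorm.pow_const 2]
  simp only [hK.tsum_enorm_sq_proj]
  rw [lintegral_enorm_sq_radialSection hd hF h, ← enorm_sq_Lp]
  congr 1
  exact enorm_eq_iff_norm_eq.2 ((fourierL2 d).norm_map f)

theorem lp_norm_sq_eq_tsum {ι : Type*} {E : ι → Type*} [∀ i, NormedAddCommGroup (E i)]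
    (x : lp E 2) : ‖x‖ ^ 2 = ∑' i, ‖x i‖ ^ 2 := by
  simpa using lp.norm_rpow_eq_tsum (p := 2) (by norm_num) x

/-- The range of an isometry from a complete space is closed, and it contains the finitely supported
sequences, which are dense. -/
theorem surjective_of_forall_single {ι H : Type*} {E : ι → Type*} [∀ i, NormedAddCommGroup (E i)]
    [∀ i, Module ℂ (E i)] [∀ i, IsBoundedSMul ℂ (E i)] [NormedAddCommGroup H] [Module ℂ H]
    [CompleteSpace H] (T : H →ₗᵢ[ℂ] lp E 2)
    (hT : ∀ i (φ : E i), ∃ f, T f i = φ ∧ ∀ j, j ≠ i → T f j = 0) : Function.Surjective T := by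
  classical
  intro x
  have hclosed : IsClosed (LinearMap.range T.toLinearMap : Set (lp E 2)) :=
    T.isometry.isClosedEmbedding.isClosed_range
  have hx := lp.hasSum_single (p := 2) (by norm_num) x
  have hmem : x ∈ LinearMap.range T.toLinearMap := by
    refine hclosed.mem_of_tendsto hx (Filter.Eventually.of_forall fun s => ?_)
    refine Submodule.sum_mem _ fun i _ => ?_
    obtain ⟨f, h1, h2⟩ := hT i (x i)
    refine ⟨f, Subtype.ext (funext fun j => ?_)⟩
    rcases eq_or_ne j i with rfl | hj
    · exact h1.trans (lp.single_apply_self 2 j (x j)).symm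
    · exact (h2 j hj).trans (lp.single_apply_ne 2 i (x i) hj).symm
  exact hmem

theorem memℓp_two_of_summable {ι : Type*} {E : ι → Type*} [∀ i, NormedAddCommGroup (E i)]
    {x : ∀ i, E i} (h : Summable fun i => ‖x i‖ ^ 2) : Memℓp x 2 :=
  memℓp_gen (by simpa using h)

theorem hasSum_norm_sq_componentMap [Countable ι] (hK : ZonalDecomposition K n) (hd : 1 ≤ d)
    (f : L2 d) : HasSum (fun i => ‖componentMap (K i) hd f‖ ^ 2) (‖f‖ ^ 2) := by
  have h := tsum_enorm_sq_componentMap hK hd f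
  have h0 : ∀ i, ENNReal.ofReal (‖componentMap (K i) hd f‖ ^ 2) =
      ‖componentMap (K i) hd f‖ₑ ^ 2 := fun i =>
    (enorm_sq_eq_ofReal (X := (K i).L2Radial) (componentMap (K i) hd f)).symm
  have hne : ∑' i, ENNReal.ofReal (‖componentMap (K i) hd f‖ ^ 2) ≠ ∞ := by
    rw [tsum_congr h0, h]
    exact ENNReal.pow_ne_top enorm_ne_top
  have hs : Summable fun i => ‖componentMap (K i) hd f‖ ^ 2 := by
    have := ENNReal.summable_toReal hne
    simpa only [ENNReal.toReal_ofReal (sq_nonneg _)] using this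
  have h2 : ENNReal.ofReal (∑' i, ‖componentMap (K i) hd f‖ ^ 2) = ENNReal.ofReal (‖f‖ ^ 2) := by
    rw [ENNReal.ofReal_tsum_of_nonneg (fun i => sq_nonneg _) hs, tsum_congr h0, h]
    exact enorm_sq_eq_ofReal f
  rw [ENNReal.ofReal_eq_ofReal_iff (tsum_nonneg fun i => sq_nonneg _) (sq_nonneg _)] at h2
  rw [← h2]
  exact hs.hasSum

theorem memℓp_componentMap [Countable ι] (hK : ZonalDecomposition K n) (hd : 1 ≤ d) (f : L2 d) :
    Memℓp (E := fun i => (K i).L2Radial) (fun i => componentMap (K i) hd f) 2 :=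
  memℓp_two_of_summable (E := fun i => (K i).L2Radial) (hasSum_norm_sq_componentMap hK hd f).summable

/-- The isometry `f ↦ (P_k (J f̂))_k`. -/
def decompositionIsometry [Countable ι] (hK : ZonalDecomposition K n) (hd : 1 ≤ d) :
    L2 d →ₗᵢ[ℂ] lp (fun i => (K i).L2Radial) 2 where
  toFun f := ⟨fun i => componentMap (K i) hd f, memℓp_componentMap hK hd f⟩
  map_add' f g := Subtype.ext (funext fun i => map_add (componentMap (K i) hd) f g)
  map_smul' c f := Subtype.ext (funext fun i => map_smul (componentMap (K i) hd) c f)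
  norm_map' f := by
    refine (sq_eq_sq₀ (norm_nonneg _) (norm_nonneg _)).1 ?_
    exact (lp_norm_sq_eq_tsum _).trans (hasSum_norm_sq_componentMap hK hd f).tsum_eq

/-- The inverse of `J` written explicitly in an orthonormal basis with continuous representatives `e
m`: divide by the weight and put `ω = ‖x‖²`, `s = x/‖x‖`. -/
theorem exists_J_eq (hK : ZonalDecomposition K n) (i : ι) (φ : (K i).L2Radial) :
    ∃ F : Euc d → ℂ, Measurable F ∧
      ∀ ω, 0 < ω → J d F ω =ᵐ[sphereMeasure d] ((φ ω : (K i).carrier) : L2Sph d) := by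
  let b := stdOrthonormalBasis ℂ (K i).carrier
  choose e he hbe using fun m => hK.continuous i (b m) (b m).2
  -- Tietze extension serves only to make `x ↦ g (‖x‖⁻¹ • x)` meaningful and measurable on all of
  -- `ℝ^d`, the origin included.
  have hext : ∀ m, ∃ g : C(Euc d, ℂ), ∀ s : Sph d, g s = e m s := fun m => by
    obtain ⟨g, hg⟩ := ContinuousMap.exists_extension (Y := ℂ)
      (Metric.isClosed_sphere (x := (0 : Euc d)) (ε := 1)).isClosedEmbedding_subtypeVal
      ⟨e m, he m⟩
    exact ⟨g, fun s => DFunLike.congr_fun hg s⟩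
  choose g hg using hext
  refine ⟨fun x => ((√2 * (‖x‖ ^ 2) ^ (-(((d : ℝ) - 2) / 4)) : ℝ) : ℂ) *
    ∑ m, inner ℂ (b m) (φ (‖x‖ ^ 2)) * g m (‖x‖⁻¹ • x), ?_, fun ω hω => ?_⟩
  · refine Measurable.mul (by fun_prop) (Finset.measurable_fun_sum _ fun m _ => ?_)
    refine Measurable.mul ?_ ?_
    · have h1 : Measurable fun ω : ℝ => (inner ℂ (b m) (φ ω) : ℂ) :=
        (stronglyMeasurable_const.inner (Lp.stronglyMeasurable φ)).measurable
      exact h1.comp (by fun_prop)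
    · exact (g m).continuous.measurable.comp (by fun_prop)
  · have hJ : ∀ s : Sph d, J d (fun x => ((√2 * (‖x‖ ^ 2) ^ (-(((d : ℝ) - 2) / 4)) : ℝ) : ℂ) *
        ∑ m, inner ℂ (b m) (φ (‖x‖ ^ 2)) * g m (‖x‖⁻¹ • x)) ω s =
        ∑ m, inner ℂ (b m) (φ ω) * e m s := fun s => by
      have hs : √ω ≠ 0 := (Real.sqrt_pos.2 hω).ne'
      have hn : ‖√ω • (s : Euc d)‖ = √ω := by
        rw [norm_smul, Real.norm_of_nonneg (Real.sqrt_nonneg _), norm_eq_of_mem_sphere, mul_one]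
      have hr : ω ^ (((d : ℝ) - 2) / 4) / √2 * (√2 * ω ^ (-(((d : ℝ) - 2) / 4))) = 1 := by
        rw [Real.rpow_neg hω.le]
        have := (Real.rpow_pos_of_pos hω (((d : ℝ) - 2) / 4)).ne'
        field_simp
      simp only [J, hn, Real.sq_sqrt hω.le, smul_smul, inv_mul_cancel₀ hs, one_smul, hg]
      rw [← mul_assoc, ← Complex.ofReal_mul, hr, Complex.ofReal_one, one_mul]
    have hsum : ((φ ω : (K i).carrier) : L2Sph d) =
        ∑ m, (inner ℂ (b m) (φ ω) : ℂ) • (b m : L2Sph d) := by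
      conv_lhs => rw [← b.sum_repr' (φ ω)]
      rw [Submodule.coe_sum]
      rfl
    have h1 : ∀ᵐ s ∂sphereMeasure d, ∀ m, (b m : L2Sph d) s = e m s := ae_all_iff.2 hbe
    have h2 : ∀ᵐ s ∂sphereMeasure d, ∀ m, ((inner ℂ (b m) (φ ω) : ℂ) • (b m : L2Sph d) : L2Sph d) s =
        (inner ℂ (b m) (φ ω) : ℂ) * (b m : L2Sph d) s :=
      ae_all_iff.2 fun m => Lp.coeFn_smul _ _
    rw [hsum]
    filter_upwards [h1, h2, Lp.coeFn_finsetSum Finset.univ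
      fun m => (inner ℂ (b m) (φ ω) : ℂ) • (b m : L2Sph d)] with s h1 h2 h3
    rw [hJ, h3, Finset.sum_apply]
    exact Finset.sum_congr rfl fun m _ => by rw [h2, h1]

theorem exists_radialSection_eq (hK : ZonalDecomposition K n) (hd : 1 ≤ d) (i : ι)
    (φ : (K i).L2Radial) : ∃ F : L2 d, ∀ᵐ ω ∂halfLine,
      radialSection d F ω = ((φ ω : (K i).carrier) : L2Sph d) := by
  obtain ⟨F, hF, hJ⟩ := exists_J_eq hK i φ
  have hmem : MemLp F 2 := by
    refine memLp_two_of_lintegral hF.aestronglyMeasurable ?_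
    rw [← lintegral_enorm_sq_J hd hF]
    have h1 : ∫⁻ ω, ∫⁻ s : Sph d, ‖J d F ω s‖ₑ ^ 2 ∂sphereMeasure d ∂halfLine =
        ∫⁻ ω, ‖φ ω‖ₑ ^ 2 ∂halfLine := by
      refine setLIntegral_congr_fun measurableSet_Ioi fun ω hω => ?_
      have h2 : ‖φ ω‖ₑ ^ 2 = ‖((φ ω : (K i).carrier) : L2Sph d)‖ₑ ^ 2 := rfl
      refine Eq.trans ?_ h2.symm
      rw [enorm_sq_Lp]
      refine lintegral_congr_ae ?_
      filter_upwards [hJ ω hω] with s hs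
      rw [hs]
    rw [h1, ← enorm_sq_Lp]
    exact ENNReal.pow_ne_top enorm_ne_top
  refine ⟨hmem.toLp, ?_⟩
  filter_upwards [radialSection_congr hd hmem.coeFn_toLp, ae_restrict_mem measurableSet_Ioi]
    with ω h1 h2
  exact radialSection_eq_of_ae (h1.trans (hJ ω h2))

theorem componentMap_eq_of_radialSection (hK : ZonalDecomposition K n) (hd : 1 ≤ d) {i : ι}
    {φ : (K i).L2Radial} {F : L2 d} (hF : ∀ᵐ ω ∂halfLine,
      radialSection d F ω = ((φ ω : (K i).carrier) : L2Sph d)) :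
    componentMap (K i) hd ((fourierL2 d).symm F) = φ ∧
      ∀ j, j ≠ i → componentMap (K j) hd ((fourierL2 d).symm F) = 0 := by
  have hcomp : ∀ j, componentMap (K j) hd ((fourierL2 d).symm F) =ᵐ[halfLine]
      fun ω => (K j).proj ((φ ω : (K i).carrier) : L2Sph d) := fun j => by
    filter_upwards [componentMap_ae (K j) hd ((fourierL2 d).symm F), hF] with ω h1 h2
    rw [h1, component_eq, LinearIsometryEquiv.apply_symm_apply, h2]
  constructor
  · ext1
    filter_upwards [hcomp i] with ω hω
    rw [hω]
    exact Submodule.orthogonalProjectionOnto_mem_subspace_eq_self _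
  · intro j hj
    ext1
    filter_upwards [hcomp j, Lp.coeFn_zero (K j).carrier 2 halfLine] with ω hω h0
    rw [hω, h0]
    exact ((K j).proj_eq_zero_iff _).2 fun ψ hψ => hK.orthogonal j i hj ψ hψ _ (φ ω).2

theorem exists_componentMap_eq_single (hK : ZonalDecomposition K n)
    (hd : 1 ≤ d) (i : ι) (φ : (K i).L2Radial) : ∃ f : L2 d, componentMap (K i) hd f = φ ∧
      ∀ j, j ≠ i → componentMap (K j) hd f = 0 := by
  obtain ⟨F, hF⟩ := exists_radialSection_eq hK hd i φ
  exact ⟨(fourierL2 d).symm F, componentMap_eq_of_radialSection hK hd hF⟩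

theorem decompositionIsometry_surjective [Countable ι] (hK : ZonalDecomposition K n)
    (hd : 1 ≤ d) : Function.Surjective (decompositionIsometry hK hd) :=
  surjective_of_forall_single (E := fun i => (K i).L2Radial) (decompositionIsometry hK hd)
    fun i φ => exists_componentMap_eq_single hK hd i φ

/-- The unitary operator `f ↦ (P_k (J f̂))_k` from `L²(ℝ^d)` onto the Hilbert sum. -/
def decomposition [Countable ι] (hK : ZonalDecomposition K n) (hd : 1 ≤ d) :
    L2 d ≃ₗᵢ[ℂ] lp (fun i => (K i).L2Radial) 2 :=
  LinearIsometryEquiv.ofSurjective (decompositionIsometry hK hd)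
    (decompositionIsometry_surjective hK hd)

end Decomposition

/-! ### Covariance -/

theorem fourierL2_schroedingerRep {d : ℕ} (g : SGroup d) (f : L2 d) :
    fourierL2 d (schroedingerRep d g f) =ᵐ[volume] fun x =>
      Complex.exp (((-2 * Real.pi * g.b * ‖x‖ ^ 2 : ℝ) : ℂ) * Complex.I) *
        ((((g.a : ℝ) ^ (1 * (d / 4 : ℝ)) : ℝ) : ℂ) *
          fourierL2 d f (((g.a : ℝ) ^ (1 * (1 / 2 : ℝ))) • rot d g.R⁻¹ x)) := by
  have hF := fourier_dilation (d := d) (k' := (g.a : ℝ) ^ (1 * (d / 4 : ℝ)))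
    (r' := (g.a : ℝ) ^ (1 * (1 / 2 : ℝ))) (Real.rpow_pos_of_pos g.a.2 (-1 * (1 / 2 : ℝ)))
    (rpow_quarter_sq d g.a.2) (Real.rpow_pos_of_pos g.a.2 _) (rpow_quarter_sq d g.a.2) g.R⁻¹
    (by rw [← Real.rpow_neg g.a.2.le]; congr 1; ring)
    (by
      rw [← rpow_quarter_sq d g.a.2, ← Real.rpow_natCast, ← Real.rpow_mul g.a.2.le,
        ← Real.rpow_neg g.a.2.le, ← Real.rpow_add g.a.2]
      congr 1; push_cast; ring) f
  have h1 : fourierL2 d (schroedingerRep d g f) =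
      (phaseData d g.b).toIsometry (fourierL2 d (V d g.a g.R f)) :=
    (fourierL2 d).apply_symm_apply _
  have h2 : fourierL2 d (V d g.a g.R f) = _ := hF
  rw [h1, h2]
  refine ((phaseData d g.b).toIsometry_ae _).trans ?_
  filter_upwards [(dilationData d ((g.a : ℝ) ^ (1 * (d / 4 : ℝ))) ((g.a : ℝ) ^ (1 * (1 / 2 : ℝ)))
        (Real.rpow_pos_of_pos g.a.2 _) (rpow_quarter_sq d g.a.2) g.R⁻¹).toIsometry_ae
          (fourierL2 d f)] with x hx
  change _ * (WeightedComp.toIsometry _ _) x = _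
  rw [hx]
  rfl

/-- The weight `a^{1/2} exp (-2πi b ω)`. -/
def radialWeight {d : ℕ} (g : SGroup d) (ω : ℝ) : ℂ :=
  ((g.a : ℝ) ^ (1 / 2 : ℝ) : ℝ) * Complex.exp (((-2 * Real.pi * g.b * ω : ℝ) : ℂ) * Complex.I)

/-- Since `|√ω s|² = ω`, the phase depends on `ω` alone. The dilation factor splits as `a^(d/4) =
a^(1/2) a^((d-2)/4)`, and the second factor turns the weight of `J` at `ω` into the weight at `a ω`.
-/
theorem J_schroedinger {d : ℕ} (g : SGroup d) (F : Euc d → ℂ) {ω : ℝ} (hω : 0 < ω) (s : Sph d) :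
    J d (fun x => Complex.exp (((-2 * Real.pi * g.b * ‖x‖ ^ 2 : ℝ) : ℂ) * Complex.I) *
        ((((g.a : ℝ) ^ (1 * (d / 4 : ℝ)) : ℝ) : ℂ) *
          F (((g.a : ℝ) ^ (1 * (1 / 2 : ℝ))) • rot d g.R⁻¹ x))) ω s =
      radialWeight g ω * J d F (g.a * ω) (sphRot g.R⁻¹ s) := by
  have ha := g.a.2
  have hn : ‖√ω • (s : Euc d)‖ ^ 2 = ω := by
    rw [norm_smul, Real.norm_of_nonneg (Real.sqrt_nonneg _), norm_eq_of_mem_sphere, mul_one,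
      Real.sq_sqrt hω.le]
  have hv : ((g.a : ℝ) ^ (1 * (1 / 2 : ℝ))) • rot d g.R⁻¹ (√ω • (s : Euc d)) =
      √(g.a * ω) • ((sphRot g.R⁻¹ s : Sph d) : Euc d) := by
    rw [one_mul, ← Real.sqrt_eq_rpow, map_smul, smul_smul, ← Real.sqrt_mul ha.le]
    rfl
  have hs : ω ^ (((d : ℝ) - 2) / 4) / √2 * (g.a : ℝ) ^ (1 * (d / 4 : ℝ)) =
      (g.a : ℝ) ^ (1 / 2 : ℝ) * ((g.a * ω) ^ (((d : ℝ) - 2) / 4) / √2) := by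
    have : (g.a : ℝ) ^ (1 * (d / 4 : ℝ)) =
        (g.a : ℝ) ^ (1 / 2 : ℝ) * (g.a : ℝ) ^ (((d : ℝ) - 2) / 4) := by
      rw [← Real.rpow_add ha]; congr 1; ring
    rw [Real.mul_rpow ha.le hω.le, this]
    ring
  have hs' := congrArg (fun t : ℝ => (t : ℂ)) hs
  simp only [Complex.ofReal_mul] at hs'
  simp only [J, hn, hv, radialWeight]
  linear_combination (Complex.exp (((-2 * Real.pi * g.b * ω : ℝ) : ℂ) * Complex.I) *
    F (√(g.a * ω) • ((sphRot g.R⁻¹ s : Sph d) : Euc d))) * hs'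

theorem ae_halfLine_comp_mul {a : ℝ} (ha : 0 < a) {p : ℝ → Prop} (h : ∀ᵐ ω ∂halfLine, p ω) :
    ∀ᵐ ω ∂halfLine, p (a * ω) := by
  have hq : Measure.QuasiMeasurePreserving (fun ω : ℝ => a * ω) halfLine halfLine := by
    refine ⟨measurable_const_mul _, ?_⟩
    rw [map_mul_restrict ha]
    exact Measure.smul_absolutelyContinuous
  exact hq.ae h

theorem radialSection_schroedingerRep {d : ℕ} (hd : 1 ≤ d) (g : SGroup d) (f : L2 d) :
    ∀ᵐ ω ∂halfLine, radialSection d (fourierL2 d (schroedingerRep d g f)) ω =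
      radialWeight g ω • sphereRep d g.R (radialSection d (fourierL2 d f) (g.a * ω)) := by
  filter_upwards [radialSection_congr hd (fourierL2_schroedingerRep g f),
    ae_halfLine_comp_mul g.a.2 (memLp_J hd (measurable_coe (fourierL2 d f))
      (Lp.memLp (fourierL2 d f))), ae_restrict_mem measurableSet_Ioi] with ω h1 h2 hω
  refine radialSection_eq_of_ae ?_
  filter_upwards [h1, Lp.coeFn_smul (radialWeight g ω)
    (sphereRep d g.R (radialSection d (fourierL2 d f) (g.a * ω))),
    sphereRep_ae_of_ae g.R (radialSection_ae h2)] with s h3 h4 h5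
  rw [h3, h4, Pi.smul_apply, h5, J_schroedinger g _ hω, smul_eq_mul]

theorem componentMap_schroedingerRep {d : ℕ} (K : AngularSpace d) (hd : 1 ≤ d) (g : SGroup d)
    (f : L2 d) :
    componentMap K hd (schroedingerRep d g f) = K.tensorRep g (componentMap K hd f) := by
  ext1
  refine Filter.EventuallyEq.trans ?_ ((K.tensorData g).toIsometry_ae (componentMap K hd f)).symm
  filter_upwards [componentMap_ae K hd (schroedingerRep d g f),
    radialSection_schroedingerRep hd g f,
    ae_halfLine_comp_mul g.a.2 (componentMap_ae K hd f)] with ω h1 h2 h3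
  rw [h1, component_eq, h2, map_smul, K.proj_sphereRep]
  change _ = radialWeight g ω • K.rep g.R (componentMap K hd f (g.a * ω))
  rw [h3, component_eq]

/-! ### Plancherel's theorem for integrable functions -/

section Plancherel

variable {E : Type*} [NormedAddCommGroup E] [InnerProductSpace ℝ E] [FiniteDimensional ℝ E]
  [MeasurableSpace E] [BorelSpace E]

theorem integral_smul_fourier_Lp (u : Lp (α := E) ℂ 2) (φ : SchwartzMap E ℂ) :
    ∫ x, φ x • (𝓕 u : Lp (α := E) ℂ 2) x = ∫ x, (𝓕 φ : SchwartzMap E ℂ) x • u x := by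
  have h := congrArg (fun T => T φ) (Lp.fourier_toTemperedDistribution_eq u)
  simp only [TemperedDistribution.fourier_apply, Lp.toTemperedDistribution_apply] at h
  exact h.symm

theorem integral_smul_fourier {h : E → ℂ} (hh : Integrable h) (φ : SchwartzMap E ℂ) :
    ∫ x, φ x • 𝓕 h x = ∫ x, (𝓕 φ : SchwartzMap E ℂ) x • h x := by
  have := VectorFourier.integral_fourierIntegral_smul_eq_flip (L := innerₗ E)
    Real.continuous_fourierChar continuous_inner (φ.integrable (μ := volume)) hh
  simpa using! this.symm

theorem ae_eq_of_integral_schwartz_eq {f g : E → ℂ} (hf : LocallyIntegrable f)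
    (hg : LocallyIntegrable g)
    (h : ∀ φ : SchwartzMap E ℂ, ∫ x, φ x • f x = ∫ x, φ x • g x) : f =ᵐ[volume] g := by
  refine ae_eq_of_integral_contDiff_smul_eq hf hg fun u hu hu' => ?_
  have hc : HasCompactSupport fun x => (u x : ℂ) := hu'.comp_left (g := fun t : ℝ => (t : ℂ)) rfl
  have hs : ContDiff ℝ (↑(⊤ : ℕ∞)) fun x => (u x : ℂ) := Complex.ofRealCLM.contDiff.comp hu
  have := h (hc.toSchwartzMap hs)
  simpa using this

/-- The `L²` Fourier transform and the Fourier integral have the same pairings with Schwartz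
functions, so they agree almost everywhere and the isometry of the former applies to the latter. -/
theorem lintegral_enorm_sq_fourier_of_memLp {h : E → ℂ} (hh : Integrable h) (h2 : MemLp h 2) :
    ∫⁻ x, ‖𝓕 h x‖ₑ ^ 2 = ∫⁻ x, ‖h x‖ₑ ^ 2 := by
  have hae : (𝓕 (h2.toLp : Lp (α := E) ℂ 2) : Lp (α := E) ℂ 2) =ᵐ[volume] 𝓕 h := by
    refine ae_eq_of_integral_schwartz_eq
      (MemLp.locallyIntegrable (Lp.memLp _) (by norm_num)) ?_ fun φ => ?_
    · exact (VectorFourier.fourierIntegral_continuous Real.continuous_fourierChar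
        (L := innerₗ E) continuous_inner hh).locallyIntegrable
    · rw [integral_smul_fourier_Lp, integral_smul_fourier hh]
      refine integral_congr_ae ?_
      filter_upwards [h2.coeFn_toLp] with x hx
      rw [hx]
  rw [← enorm_sq_toLp h2, ← enorm_eq_iff_norm_eq.2 (Lp.norm_fourier_eq h2.toLp), enorm_sq_Lp]
  refine lintegral_congr_ae ?_
  filter_upwards [hae] with x hx
  rw [hx]

/-- The `L²` inverse transform of `𝓕 h` and `h` itself have the same pairings with Schwartz
functions, every one of which is a Fourier transform. -/
theorem memLp_of_memLp_fourier {h : E → ℂ} (hh : Integrable h) (h2 : MemLp (𝓕 h) 2) :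
    MemLp h 2 := by
  obtain ⟨v, hv⟩ : ∃ v : Lp (α := E) ℂ 2 volume, (𝓕 v : Lp (α := E) ℂ 2 volume) = h2.toLp :=
    ⟨𝓕⁻ (h2.toLp : Lp (α := E) ℂ 2 volume), FourierTransform.fourier_fourierInv_eq _⟩
  have hae : (v : E → ℂ) =ᵐ[volume] h := by
    refine ae_eq_of_integral_schwartz_eq
      (MemLp.locallyIntegrable (Lp.memLp v) (by norm_num)) hh.locallyIntegrable fun φ => ?_
    have hφ : (𝓕 (𝓕⁻ φ) : SchwartzMap E ℂ) = φ := FourierTransform.fourier_fourierInv_eq _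
    rw [← hφ, ← integral_smul_fourier_Lp, ← integral_smul_fourier hh, hv]
    refine integral_congr_ae ?_
    filter_upwards [h2.coeFn_toLp] with x hx
    rw [hx]
  exact (memLp_congr_ae hae).1 (Lp.memLp v)

/-- Square integrability is not assumed and both sides may be infinite: if one of them is finite,
the function is in `L²`. This generality matters because the matrix coefficients are Fourier
transforms of functions known only to be integrable. -/
theorem lintegral_enorm_sq_fourier {h : E → ℂ} (hh : Integrable h) :
    ∫⁻ x, ‖𝓕 h x‖ₑ ^ 2 = ∫⁻ x, ‖h x‖ₑ ^ 2 := by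
  have hc : Continuous (𝓕 h) := VectorFourier.fourierIntegral_continuous
    Real.continuous_fourierChar (L := innerₗ E) continuous_inner hh
  by_cases h1 : ∫⁻ x, ‖h x‖ₑ ^ 2 = ∞
  · by_cases h2 : ∫⁻ x, ‖𝓕 h x‖ₑ ^ 2 = ∞
    · rw [h1, h2]
    · exact lintegral_enorm_sq_fourier_of_memLp hh
        (memLp_of_memLp_fourier hh (memLp_two_of_lintegral hc.aestronglyMeasurable h2))
  · exact lintegral_enorm_sq_fourier_of_memLp hh
      (memLp_two_of_lintegral hh.aestronglyMeasurable h1)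

end Plancherel

/-! ### Matrix coefficients of the Schroedinger representation -/

theorem map_polar {d : ℕ} (hd : 1 ≤ d) :
    ((halfLine.prod (sphereMeasure d)).withDensity fun p =>
      ENNReal.ofReal ((p.1 ^ (((d : ℝ) - 2) / 4) / √2) ^ 2)).map
        (fun p => √p.1 • (p.2 : Euc d)) = volume := by
  refine Measure.ext_of_lintegral _ fun g hg => ?_
  have hT : Measurable fun p : ℝ × Sph d => √p.1 • (p.2 : Euc d) := by fun_prop
  have hm : Measurable fun p : ℝ × Sph d => ENNReal.ofReal ((p.1 ^ (((d : ℝ) - 2) / 4) / √2) ^ 2) := by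
    fun_prop
  rw [lintegral_map hg hT, lintegral_withDensity_eq_lintegral_mul _ hm
      (show Measurable fun p : ℝ × Sph d => g (√p.1 • (p.2 : Euc d)) from hg.comp hT),
    lintegral_prod _ (Measurable.mul hm (show Measurable fun p : ℝ × Sph d =>
      g (√p.1 • (p.2 : Euc d)) from hg.comp hT)).aemeasurable, lintegral_polar_sqrt hd hg]
  rfl

theorem integrable_polar {d : ℕ} (hd : 1 ≤ d) {g : Euc d → ℂ} (hg : Integrable g) :
    Integrable (fun p : ℝ × Sph d =>
      ((p.1 ^ (((d : ℝ) - 2) / 4) / √2) ^ 2) • g (√p.1 • (p.2 : Euc d)))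
      (halfLine.prod (sphereMeasure d)) ∧
    ∫ ω, ∫ s : Sph d, ((ω ^ (((d : ℝ) - 2) / 4) / √2) ^ 2) • g (√ω • (s : Euc d))
      ∂sphereMeasure d ∂halfLine = ∫ x, g x := by
  have hT : Measurable fun p : ℝ × Sph d => √p.1 • (p.2 : Euc d) := by fun_prop
  have hm : Measurable fun p : ℝ × Sph d => ENNReal.ofReal ((p.1 ^ (((d : ℝ) - 2) / 4) / √2) ^ 2) := by
    fun_prop
  have hlt : ∀ᵐ p ∂halfLine.prod (sphereMeasure d),
      ENNReal.ofReal ((p.1 ^ (((d : ℝ) - 2) / 4) / √2) ^ 2) < ∞ :=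
    Filter.Eventually.of_forall fun p => ENNReal.ofReal_lt_top
  have hg' := hg
  rw [← map_polar hd] at hg'
  have h1 := (integrable_map_measure hg'.aestronglyMeasurable hT.aemeasurable).1 hg'
  have h2 := (integrable_withDensity_iff_integrable_smul' hm hlt).1 h1
  simp only [ENNReal.toReal_ofReal (sq_nonneg _)] at h2
  refine ⟨h2, ?_⟩
  conv_rhs => rw [← map_polar hd]
  rw [integral_map hT.aemeasurable hg'.aestronglyMeasurable,
    integral_withDensity_eq_integral_toReal_smul hm hlt]
  simp only [ENNReal.toReal_ofReal (sq_nonneg _)]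
  exact (integral_prod _ h2).symm

theorem integral_inner_J {d : ℕ} (hd : 1 ≤ d) {F G : Euc d → ℂ} (hF : MemLp F 2) (hG : MemLp G 2) :
    Integrable (fun ω => ∫ s : Sph d, inner ℂ (J d F ω s) (J d G ω s) ∂sphereMeasure d) halfLine ∧
    ∫ ω, ∫ s : Sph d, inner ℂ (J d F ω s) (J d G ω s) ∂sphereMeasure d ∂halfLine =
      ∫ x, inner ℂ (F x) (G x) := by
  have hint : Integrable fun x => inner ℂ (F x) (G x) := by
    have h := L2.integrable_inner (𝕜 := ℂ) hF.toLp hG.toLp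
    refine h.congr ?_
    filter_upwards [hF.coeFn_toLp, hG.coeFn_toLp] with x h1 h2
    rw [h1, h2]
  have hJ : ∀ ω (s : Sph d), ((ω ^ (((d : ℝ) - 2) / 4) / √2) ^ 2) •
      (inner ℂ (F (√ω • (s : Euc d))) (G (√ω • (s : Euc d))) : ℂ) =
      inner ℂ (J d F ω s) (J d G ω s) := fun ω s => by
    simp only [J, RCLike.inner_apply, map_mul, Complex.conj_ofReal, Complex.real_smul]
    push_cast
    ring
  obtain ⟨h1, h2⟩ := integrable_polar hd hint
  simp only [hJ] at h1 h2
  exact ⟨h1.integral_prod_left, h2⟩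

/-- The inner product of `J f (ω, ·)` with the rotation by `R` of `J η (a ω, ·)`. -/
def rotCoeff {d : ℕ} (η f : Euc d → ℂ) (a : ℝ) (R : SO d) (ω : ℝ) : ℂ :=
  ∫ s : Sph d, inner ℂ (J d η (a * ω) (sphRot R⁻¹ s)) (J d f ω s) ∂sphereMeasure d

/-- The matrix coefficient in polar coordinates. The variable `b` enters only through the phase of
`radialWeight`, so this is a Fourier integral in `ω`; its absolute convergence is what Plancherel's
theorem for integrable functions requires. -/
theorem inner_schroedingerRep {d : ℕ} (hd : 1 ≤ d) (g : SGroup d) (η f : L2 d) :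
    Integrable (fun ω => star (radialWeight g ω) *
      rotCoeff (fourierL2 d η) (fourierL2 d f) g.a g.R ω) halfLine ∧
    ∫ ω, star (radialWeight g ω) * rotCoeff (fourierL2 d η) (fourierL2 d f) g.a g.R ω ∂halfLine =
      inner ℂ (schroedingerRep d g η) f := by
  have hae := fourierL2_schroedingerRep g η
  have h := integral_inner_J hd ((memLp_congr_ae hae).1 (Lp.memLp _)) (Lp.memLp (fourierL2 d f))
  have hJ : ∀ ω ∈ Set.Ioi (0 : ℝ), ∫ s : Sph d, inner ℂ (J d (fun x =>
      Complex.exp (((-2 * Real.pi * g.b * ‖x‖ ^ 2 : ℝ) : ℂ) * Complex.I) *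
        ((((g.a : ℝ) ^ (1 * (d / 4 : ℝ)) : ℝ) : ℂ) *
          fourierL2 d η (((g.a : ℝ) ^ (1 * (1 / 2 : ℝ))) • rot d g.R⁻¹ x))) ω s)
      (J d (fourierL2 d f) ω s) ∂sphereMeasure d = star (radialWeight g ω) *
        rotCoeff (fourierL2 d η) (fourierL2 d f) g.a g.R ω := fun ω hω => by
    rw [rotCoeff, ← integral_const_mul]
    refine integral_congr_ae (Filter.Eventually.of_forall fun s => ?_)
    beta_reduce
    rw [J_schroedinger g _ hω, RCLike.inner_apply, RCLike.inner_apply, map_mul,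
      starRingEnd_apply]
    ring
  refine ⟨h.1.congr ?_, ?_⟩
  · filter_upwards [ae_restrict_mem measurableSet_Ioi] with ω hω using hJ ω hω
  · rw [← setIntegral_congr_fun measurableSet_Ioi hJ, h.2, ← (fourierL2 d).inner_map_map,
      L2.inner_def]
    refine integral_congr_ae ?_
    filter_upwards [hae] with x hx
    rw [hx]

theorem star_radialWeight {d : ℕ} (g : SGroup d) (ω : ℝ) :
    star (radialWeight g ω) = Complex.exp (((-2 * Real.pi * ω * (-g.b) : ℝ) : ℂ) * Complex.I) *
      ((g.a : ℝ) ^ (1 / 2 : ℝ) : ℝ) := by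
  rw [radialWeight, star_mul', Complex.star_def, Complex.conj_ofReal, ← Complex.exp_conj,
    map_mul, Complex.conj_I, Complex.conj_ofReal, mul_comm]
  congr 2
  push_cast
  ring

/-- As a function of `b` the coefficient is the Fourier transform, at `-b`, of `a^(1/2)` times
`rotCoeff` extended by zero to the line. Plancherel's theorem removes `b` and leaves the factor `a`.
-/
theorem lintegral_enorm_sq_inner_schroedingerRep {d : ℕ} (hd : 1 ≤ d) (a : PosReal) (R : SO d)
    (η f : L2 d) :
    ∫⁻ b, ‖(inner ℂ (schroedingerRep d ⟨b, a, R⟩ η) f : ℂ)‖ₑ ^ 2 =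
      ∫⁻ ω, ENNReal.ofReal a * ‖rotCoeff (fourierL2 d η) (fourierL2 d f) a R ω‖ₑ ^ 2 ∂halfLine := by
  set h : ℝ → ℂ := (Set.Ioi (0 : ℝ)).indicator fun ω => (((a : ℝ) ^ (1 / 2 : ℝ) : ℝ) : ℂ) *
    rotCoeff (fourierL2 d η) (fourierL2 d f) a R ω with hh
  have hint : Integrable h := by
    rw [hh, integrable_indicator_iff measurableSet_Ioi]
    -- At `b = 0` the phase is one, and the integrand of the coefficient is `h` itself.
    have := (inner_schroedingerRep hd ⟨0, a, R⟩ η f).1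
    refine this.congr (Filter.Eventually.of_forall fun ω => ?_)
    beta_reduce
    rw [star_radialWeight]
    simp
  have hb : ∀ b, (inner ℂ (schroedingerRep d ⟨b, a, R⟩ η) f : ℂ) = 𝓕 h (-b) := fun b => by
    rw [← (inner_schroedingerRep hd ⟨b, a, R⟩ η f).2, Real.fourier_real_eq_integral_exp_smul,
      ← integral_indicator measurableSet_Ioi]
    congr 1
    ext1 ω
    rw [hh]
    by_cases hω : ω ∈ Set.Ioi (0 : ℝ)
    · simp only [Set.indicator_of_mem hω, star_radialWeight, smul_eq_mul, mul_assoc]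
    · simp only [Set.indicator_of_notMem hω, smul_zero]
  simp only [hb]
  rw [lintegral_neg_eq_self (fun b => ‖𝓕 h b‖ₑ ^ 2), lintegral_enorm_sq_fourier hint,
    ← lintegral_indicator measurableSet_Ioi]
  refine lintegral_congr fun ω => ?_
  by_cases hω : ω ∈ Set.Ioi (0 : ℝ)
  · rw [hh, Set.indicator_of_mem hω, Set.indicator_of_mem hω, enorm_mul, mul_pow,
      enorm_sq_eq_ofReal (_ : ℂ), Complex.norm_real,
      Real.norm_of_nonneg (Real.rpow_nonneg a.2.le _), ← Real.rpow_natCast,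
      ← Real.rpow_mul a.2.le]
    norm_num
  · rw [hh, Set.indicator_of_notMem hω, Set.indicator_of_notMem hω]
    simp

/-! ### The integral of the squared matrix coefficients -/

instance (d : ℕ) : SecondCountableTopology (SO d) := by
  have : SecondCountableTopology (Matrix (Fin d) (Fin d) ℝ) :=
    inferInstanceAs (SecondCountableTopology (Fin d → Fin d → ℝ))
  exact Topology.IsEmbedding.subtypeVal.secondCountableTopology

/-- The density `r ^ 0` is one, so this is the radial measure `volumeIoiPow 0`. -/
instance : SFinite ((volume : Measure ℝ).comap (Subtype.val : PosReal → ℝ)) := by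
  have h : SFinite (Measure.volumeIoiPow 0) := inferInstance
  have h' : Measure.volumeIoiPow 0 = (volume : Measure ℝ).comap (Subtype.val : PosReal → ℝ) := by
    simp [Measure.volumeIoiPow]
    rfl
  exact h' ▸ h

/-- The identification of the measurable space `G` with `ℝ × ℝ₊ × SO(d)`. -/
def SGroup.prodEquiv (d : ℕ) : ℝ × PosReal × SO d ≃ᵐ SGroup d where
  toFun p := ⟨p.1, p.2.1, p.2.2⟩
  invFun g := (g.b, g.a, g.R)
  left_inv _ := rfl
  right_inv _ := rfl
  measurable_toFun := measurable_comap_iff.2 measurable_id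
  measurable_invFun := comap_measurable _

theorem exists_measurable_sphRot_inv (d : ℕ) :
    ∃ T : SO d × Sph d → Sph d, Measurable T ∧ ∀ R s, sphRot R⁻¹ s = T (R, s) :=
  ⟨_, continuous_sphRot_inv.measurable, fun _ _ => rfl⟩

theorem measurable_integral_inner {Ω X : Type*} [MeasurableSpace Ω] [MeasurableSpace X]
    {μ : Measure X} [SFinite μ] {u v : Ω × X → ℂ} (hu : Measurable u) (hv : Measurable v) :
    Measurable fun p => ∫ x, (inner ℂ (u (p, x)) (v (p, x)) : ℂ) ∂μ := by
  have h : StronglyMeasurable fun q => (inner ℂ (u q) (v q) : ℂ) :=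
    hu.stronglyMeasurable.inner hv.stronglyMeasurable
  exact (h.integral_prod_right' (ν := μ)).measurable

theorem measurable_integral_mul {Ω X : Type*} [MeasurableSpace Ω] [MeasurableSpace X]
    {μ : Measure X} [SFinite μ] {u v : Ω × X → ℂ} (hu : Measurable u) (hv : Measurable v) :
    Measurable fun p => ∫ x, u (p, x) * v (p, x) ∂μ :=
  ((hu.mul hv).stronglyMeasurable.integral_prod_right' (ν := μ)).measurable

/-- Joint measurability in `(a, R, ω)` is the reason why `rotCoeff` is an integral of
representatives rather than an inner product of `radialSection`s: it is a parametric integral of a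
measurable function. -/
theorem measurable_rotCoeff {d : ℕ} {η f : Euc d → ℂ} (hη : Measurable η) (hf : Measurable f) :
    Measurable fun p : ℝ × SO d × ℝ => rotCoeff η f p.1 p.2.1 p.2.2 := by
  obtain ⟨T, hT, hTe⟩ := exists_measurable_sphRot_inv d
  have hJ := measurable_J hη
  have hJf := measurable_J hf
  simp only [rotCoeff, hTe]
  have h1 : Measurable fun q : (ℝ × SO d × ℝ) × Sph d => (q.1.2.1, q.2) :=
    measurable_fst.snd.fst.prodMk measurable_snd
  have h3 : Measurable fun q : (ℝ × SO d × ℝ) × Sph d => q.1.1 * q.1.2.2 :=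
    measurable_fst.fst.mul measurable_fst.snd.snd
  have h5 : Measurable fun q : (ℝ × SO d × ℝ) × Sph d => (q.1.2.2, q.2) :=
    measurable_fst.snd.snd.prodMk measurable_snd
  exact measurable_integral_inner (hJ.comp (h3.prodMk (hT.comp h1))) (hJf.comp h5)

theorem measurable_inner_schroedingerRep {d : ℕ} (hd : 1 ≤ d) (η f : L2 d) :
    Measurable fun p : ℝ × PosReal × SO d =>
      (inner ℂ (schroedingerRep d ⟨p.1, p.2.1, p.2.2⟩ η) f : ℂ) := by
  have hm := measurable_rotCoeff (measurable_coe (fourierL2 d η)) (measurable_coe (fourierL2 d f))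
  have h := fun p : ℝ × PosReal × SO d =>
    (inner_schroedingerRep hd ⟨p.1, p.2.1, p.2.2⟩ η f).2
  simp only [star_radialWeight] at h
  rw [← funext h]
  have h1 : Measurable fun q : (ℝ × PosReal × SO d) × ℝ => ((q.1.2.1 : ℝ), q.1.2.2, q.2) :=
    (measurable_subtype_coe.comp measurable_fst.snd.fst).prodMk
      (measurable_fst.snd.snd.prodMk measurable_snd)
  have h2 : Measurable fun q : (ℝ × PosReal × SO d) × ℝ =>
      Complex.exp (((-2 * Real.pi * q.2 * (-q.1.1) : ℝ) : ℂ) * Complex.I) *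
      (((q.1.2.1 : ℝ) ^ (1 / 2 : ℝ) : ℝ) : ℂ) := by
    have ha : Measurable fun q : (ℝ × PosReal × SO d) × ℝ => (q.1.2.1 : ℝ) := h1.fst
    have hb : Measurable fun q : (ℝ × PosReal × SO d) × ℝ => q.1.1 := measurable_fst.fst
    have hω : Measurable fun q : (ℝ × PosReal × SO d) × ℝ => q.2 := measurable_snd
    exact ((Complex.measurable_ofReal.comp ((hω.const_mul _).mul hb.neg)).mul_const _).cexp.mul
      (Complex.measurable_ofReal.comp (ha.pow_const _))
  exact measurable_integral_mul h2 (hm.comp h1)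

theorem lintegral_posReal (F : ℝ → ℝ≥0∞) :
    ∫⁻ a : PosReal, F a ∂(volume : Measure ℝ).comap (Subtype.val : PosReal → ℝ) =
      ∫⁻ a, F a ∂halfLine := by
  have h := lintegral_subtype_comap (μ := volume) (measurableSet_Ioi (a := (0 : ℝ))) F
  exact h

/-- Tonelli on the group in the order suited to the proof: `b` is traded for `ω` by the hypothesis
`h`, and then `R` is moved inside `ω`, so that the Schur relations can be applied at fixed `a` and
`ω`. -/
theorem lintegral_haar {d : ℕ} {u : SGroup d → ℝ≥0∞} {v : ℝ × SO d × ℝ → ℝ≥0∞}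
    (hu : Measurable fun p : ℝ × PosReal × SO d => u ⟨p.1, p.2.1, p.2.2⟩) (hv : Measurable v)
    (h : ∀ (a : PosReal) (R : SO d),
      ∫⁻ b, u ⟨b, a, R⟩ = ∫⁻ ω, ENNReal.ofReal a * v (a, R, ω) ∂halfLine) :
    ∫⁻ g, u g ∂SGroup.haar d = ∫⁻ a, ∫⁻ ω, ENNReal.ofReal ((a ^ 2)⁻¹) * (ENNReal.ofReal a *
      ∫⁻ R, v (a, R, ω) ∂haarSO d) ∂halfLine ∂halfLine := by
  have hw : Measurable fun a : PosReal => ENNReal.ofReal (((a : ℝ) ^ 2)⁻¹) := by fun_prop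
  have hmap : SGroup.haar d = ((volume : Measure ℝ).prod
    (((volume : Measure ℝ).comap (Subtype.val : PosReal → ℝ)).withDensity
      (fun a => ENNReal.ofReal (((a : ℝ) ^ 2)⁻¹)) |>.prod (haarSO d))).map
      (SGroup.prodEquiv d) := rfl
  have hmul : Measurable fun q : ℝ × SO d × ℝ => ENNReal.ofReal q.1 * v q :=
    (ENNReal.measurable_ofReal.comp measurable_fst).mul hv
  have hAR : Measurable fun p : PosReal × SO d =>
      ∫⁻ ω, ENNReal.ofReal p.1 * v (p.1, p.2, ω) ∂halfLine := by
    have h1 : Measurable fun q : (PosReal × SO d) × ℝ => ((q.1.1 : ℝ), q.1.2, q.2) :=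
      (measurable_subtype_coe.comp measurable_fst.fst).prodMk
        (measurable_fst.snd.prodMk measurable_snd)
    exact Measurable.lintegral_prod_right' (f := fun q : (PosReal × SO d) × ℝ =>
      ENNReal.ofReal q.1.1 * v (q.1.1, q.1.2, q.2)) (hmul.comp h1)
  have hinner : ∀ a : ℝ, ENNReal.ofReal ((a ^ 2)⁻¹) *
      ∫⁻ R, ∫⁻ ω, ENNReal.ofReal a * v (a, R, ω) ∂halfLine ∂haarSO d =
      ∫⁻ ω, ENNReal.ofReal ((a ^ 2)⁻¹) * (ENNReal.ofReal a *
        ∫⁻ R, v (a, R, ω) ∂haarSO d) ∂halfLine := by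
    intro a
    have hm : Measurable fun p : SO d × ℝ => ENNReal.ofReal a * v (a, p.1, p.2) :=
      hmul.comp measurable_prodMk_left
    rw [lintegral_lintegral_swap hm.aemeasurable, ← lintegral_const_mul' _ _ ENNReal.ofReal_ne_top]
    refine lintegral_congr fun ω => ?_
    rw [lintegral_const_mul' _ _ ENNReal.ofReal_ne_top]
  calc
    _ = ∫⁻ p : PosReal × SO d, ∫⁻ ω, ENNReal.ofReal p.1 * v (p.1, p.2, ω) ∂halfLine
          ∂(((volume : Measure ℝ).comap (Subtype.val : PosReal → ℝ)).withDensity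
      (fun a => ENNReal.ofReal (((a : ℝ) ^ 2)⁻¹)) |>.prod (haarSO d)) := by
      rw [hmap, lintegral_map_equiv, lintegral_prod_symm _ (by exact hu.aemeasurable)]
      exact lintegral_congr fun p => h p.1 p.2
    _ = ∫⁻ a : PosReal, (fun a : ℝ => ENNReal.ofReal ((a ^ 2)⁻¹) *
          ∫⁻ R, ∫⁻ ω, ENNReal.ofReal a * v (a, R, ω) ∂halfLine ∂haarSO d) a
          ∂(volume : Measure ℝ).comap (Subtype.val : PosReal → ℝ) := by
      rw [lintegral_prod _ hAR.aemeasurable]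
      exact lintegral_withDensity_eq_lintegral_mul _ hw hAR.lintegral_prod_right'
    _ = _ := by
      refine (lintegral_posReal fun a : ℝ => ENNReal.ofReal ((a ^ 2)⁻¹) *
        ∫⁻ R, ∫⁻ ω, ENNReal.ofReal a * v (a, R, ω) ∂halfLine ∂haarSO d).trans ?_
      exact lintegral_congr fun a => hinner a

theorem rotCoeff_eq_inner {d : ℕ} {η f : Euc d → ℂ} {a ω : ℝ}
    (hη : MemLp (J d η (a * ω)) 2 (sphereMeasure d)) (hf : MemLp (J d f ω) 2 (sphereMeasure d))
    (R : SO d) : rotCoeff η f a R ω =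
      inner ℂ (sphereRep d R (radialSection d η (a * ω))) (radialSection d f ω) := by
  rw [rotCoeff, L2.inner_def]
  refine integral_congr_ae ?_
  filter_upwards [sphereRep_ae_of_ae R (radialSection_ae hη), radialSection_ae hf] with s h1 h2
  rw [h1, h2]

/-- Scale invariance of `da/a`. -/
theorem lintegral_comp_mul_div {A : ℝ → ℝ≥0∞} (hA : Measurable A) {ω : ℝ} (hω : 0 < ω) :
    ∫⁻ a, A (a * ω) / ENNReal.ofReal a ∂halfLine = ∫⁻ u, A u / ENNReal.ofReal u ∂halfLine := by
  have hg : Measurable fun u => A u / ENNReal.ofReal u := hA.div ENNReal.measurable_ofReal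
  have h := lintegral_map (μ := halfLine) hg (measurable_const_mul ω)
  rw [map_mul_restrict hω, lintegral_smul_measure, smul_eq_mul] at h
  have h0 : ENNReal.ofReal ω ≠ 0 := by simpa using hω
  have h2 : ∀ a, A (ω * a) / ENNReal.ofReal (ω * a) =
      ENNReal.ofReal ω⁻¹ * (A (a * ω) / ENNReal.ofReal a) := fun a => by
    rw [ENNReal.ofReal_mul hω.le, ENNReal.ofReal_inv_of_pos hω, div_eq_mul_inv, div_eq_mul_inv,
      ENNReal.mul_inv (Or.inl h0) (Or.inl ENNReal.ofReal_ne_top), mul_comm ω a]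
    ring
  simp only [h2] at h
  rw [lintegral_const_mul _ (show Measurable fun a => A (a * ω) / ENNReal.ofReal a from
      (hA.comp (measurable_mul_const ω)).div ENNReal.measurable_ofReal)] at h
  have h3 : ENNReal.ofReal ω⁻¹ ≠ 0 := by simpa using hω
  exact ((ENNReal.mul_right_inj h3 ENNReal.ofReal_ne_top).1 h).symm

/-! ### The orthogonality relation for the Schrödinger representation -/

namespace ZonalDecomposition

variable {d : ℕ} {ι : Type*} [Countable ι] {K : ι → AngularSpace d} {n : Sph d}

theorem measurable_enorm_sq_componentMap (K : AngularSpace d) (hd : 1 ≤ d) (f : L2 d) :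
    Measurable fun ω => ‖componentMap K hd f ω‖ₑ ^ 2 :=
  (Lp.stronglyMeasurable (componentMap K hd f)).enorm.pow_const 2

/-- For almost every `ω` these are the Schur relations for the sections of `η` at radius parameter
`a ω` and of `f` at `ω`. -/
theorem lintegral_rotCoeff (hK : ZonalDecomposition K n) (hd : 2 ≤ d) (hd' : 1 ≤ d) (η f : L2 d)
    {a : ℝ} (ha : 0 < a) : ∀ᵐ ω ∂halfLine,
    ∫⁻ R, ‖rotCoeff (fourierL2 d η) (fourierL2 d f) a R ω‖ₑ ^ 2 ∂haarSO d =
      ∑' i, ‖componentMap (K i) hd' η (a * ω)‖ₑ ^ 2 / Module.finrank ℂ (K i).carrier *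
        ‖componentMap (K i) hd' f ω‖ₑ ^ 2 := by
  have h1 := ae_halfLine_comp_mul ha
    (memLp_J hd' (measurable_coe (fourierL2 d η)) (Lp.memLp (fourierL2 d η)))
  have h2 : ∀ᵐ ω ∂halfLine, ∀ i, componentMap (K i) hd' η (a * ω) = (K i).component η (a * ω) :=
    ae_all_iff.2 fun i => ae_halfLine_comp_mul ha (componentMap_ae (K i) hd' η)
  have h3 : ∀ᵐ ω ∂halfLine, ∀ i, componentMap (K i) hd' f ω = (K i).component f ω :=
    ae_all_iff.2 fun i => componentMap_ae (K i) hd' f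
  filter_upwards [h1, h2, h3, memLp_J hd' (measurable_coe (fourierL2 d f))
    (Lp.memLp (fourierL2 d f))] with ω h1 h2 h3 h4
  simp only [rotCoeff_eq_inner h1 h4, hK.lintegral_enorm_sq_inner_sphereRep hd, h2, h3,
    component_eq]

/-- The Haar density `a⁻²` and the factor `a` from Plancherel combine to `da/a`. With `a` integrated
first, scale invariance makes the inner integral independent of `ω`, and the double integral
factors. -/
theorem lintegral_tsum_comp_mul {A B : ι → ℝ → ℝ≥0∞} (hA : ∀ i, Measurable (A i))
    (hB : ∀ i, Measurable (B i)) (N : ι → ℝ≥0∞) :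
    ∫⁻ a, ∫⁻ ω, ENNReal.ofReal ((a ^ 2)⁻¹) * (ENNReal.ofReal a *
      ∑' i, A i (a * ω) / N i * B i ω) ∂halfLine ∂halfLine =
      ∑' i, (∫⁻ ω, A i ω / ENNReal.ofReal ω ∂halfLine) / N i * ∫⁻ ω, B i ω ∂halfLine := by
  have hpt : ∀ a ∈ Set.Ioi (0 : ℝ), ∀ ω, ENNReal.ofReal ((a ^ 2)⁻¹) * (ENNReal.ofReal a *
      ∑' i, A i (a * ω) / N i * B i ω) =
      ∑' i, (B i ω / N i) * (A i (a * ω) / ENNReal.ofReal a) := fun a ha ω => by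
    have ha : 0 < a := ha
    rw [← mul_assoc, ← ENNReal.ofReal_mul (by positivity), ← ENNReal.tsum_mul_left]
    refine tsum_congr fun i => ?_
    rw [show (a ^ 2)⁻¹ * a = a⁻¹ by field_simp, ENNReal.ofReal_inv_of_pos ha]
    simp only [div_eq_mul_inv]
    ring
  have hAm : ∀ i, Measurable fun p : ℝ × ℝ => A i (p.1 * p.2) :=
    fun i => (hA i).comp measurable_mul
  have hsum : Measurable fun p : ℝ × ℝ => ∑' i, (B i p.2 / N i) *
        (A i (p.1 * p.2) / ENNReal.ofReal p.1) :=
    Measurable.tsum fun i => (((hB i).comp measurable_snd).div_const _).mul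
      ((hAm i).div (ENNReal.measurable_ofReal.comp measurable_fst))
  calc
    _ = ∫⁻ a, ∫⁻ ω, ∑' i, (B i ω / N i) * (A i (a * ω) / ENNReal.ofReal a) ∂halfLine ∂halfLine :=
      setLIntegral_congr_fun measurableSet_Ioi fun a ha => lintegral_congr fun ω => hpt a ha ω
    _ = ∫⁻ ω, ∑' i, (B i ω / N i) * ∫⁻ u, A i u / ENNReal.ofReal u ∂halfLine ∂halfLine := by
      rw [lintegral_lintegral_swap hsum.aemeasurable]
      refine setLIntegral_congr_fun measurableSet_Ioi fun ω hω => ?_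
      have hm : ∀ i, Measurable fun a : ℝ => A i (a * ω) / ENNReal.ofReal a := fun i =>
        ((hA i).comp (measurable_mul_const ω)).div ENNReal.measurable_ofReal
      rw [lintegral_tsum fun i => ((hm i).const_mul _).aemeasurable]
      refine tsum_congr fun i => ?_
      rw [lintegral_const_mul _ (hm i), lintegral_comp_mul_div (hA i) hω]
    _ = _ := by
      rw [lintegral_tsum fun i => (((hB i).div_const _).mul_const _).aemeasurable]
      refine tsum_congr fun i => ?_
      rw [lintegral_mul_const _ ((hB i).div_const _)]
      simp only [div_eq_mul_inv _ (N i)]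
      rw [lintegral_mul_const _ (hB i)]
      ring

/-- The central identity, valid with infinite values: Plancherel in `b`, Schur in `R`, scale
invariance in `a`. Admissibility, irreducibility and inequivalence are all read off from it. -/
theorem lintegral_haar_enorm_sq_inner (hK : ZonalDecomposition K n) (hd : 2 ≤ d) (hd' : 1 ≤ d)
    (η f : L2 d) :
    ∫⁻ g, ‖(inner ℂ (schroedingerRep d g η) f : ℂ)‖ₑ ^ 2 ∂SGroup.haar d =
      ∑' i, (∫⁻ ω, ‖componentMap (K i) hd' η ω‖ₑ ^ 2 / ENNReal.ofReal ω ∂halfLine) /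
        Module.finrank ℂ (K i).carrier * ‖componentMap (K i) hd' f‖ₑ ^ 2 := by
  have hrot := (measurable_rotCoeff (measurable_coe (fourierL2 d η))
    (measurable_coe (fourierL2 d f))).enorm.pow_const 2
  have hinn := (measurable_inner_schroedingerRep hd' η f).enorm.pow_const 2
  rw [lintegral_haar (u := fun g => ‖(inner ℂ (schroedingerRep d g η) f : ℂ)‖ₑ ^ 2) hinn hrot
    fun a R => lintegral_enorm_sq_inner_schroedingerRep hd' a R η f]
  simp only [enorm_sq_Lp (componentMap (K _) hd' f)]
  rw [← lintegral_tsum_comp_mul (fun i => measurable_enorm_sq_componentMap (K i) hd' η)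
    (fun i => measurable_enorm_sq_componentMap (K i) hd' f)]
  refine setLIntegral_congr_fun measurableSet_Ioi fun a ha => lintegral_congr_ae ?_
  filter_upwards [hK.lintegral_rotCoeff hd hd' η f ha] with ω hω
  rw [hω]

end ZonalDecomposition

/-! ### Consequences of the formula for the squared matrix coefficients -/

theorem hasSum_inner_apply {ι H : Type*} {E : ι → Type*} [∀ i, NormedAddCommGroup (E i)]
    [∀ i, InnerProductSpace ℂ (E i)] [NormedAddCommGroup H] [InnerProductSpace ℂ H]
    (U : H ≃ₗᵢ[ℂ] lp E 2) (f g : H) :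
    HasSum (fun i => (inner ℂ (U f i) (U g i) : ℂ)) (inner ℂ f g) := by
  rw [← U.inner_map_map]
  exact lp.hasSum_inner (𝕜 := ℂ) (U f) (U g)

theorem eq_inner_of_hasSum {ι : Type*} {E : ι → Type*} [∀ i, NormedAddCommGroup (E i)]
    [∀ i, InnerProductSpace ℂ (E i)] {u v : ∀ i, E i} {s : ℂ}
    (h : HasSum (fun k => (inner ℂ (u k) (v k) : ℂ)) s) {i : ι} (hv : ∀ k, k ≠ i → v k = 0) :
    s = inner ℂ (u i) (v i) :=
  h.unique (hasSum_single i fun k hk => by rw [hv k hk, inner_zero_right])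

theorem eq_inner_add_inner_of_hasSum {ι : Type*} {E : ι → Type*} [∀ i, NormedAddCommGroup (E i)]
    [∀ i, InnerProductSpace ℂ (E i)] {u v : ∀ i, E i} {s : ℂ}
    (h : HasSum (fun k => (inner ℂ (u k) (v k) : ℂ)) s) {i j : ι} (hij : i ≠ j)
    (hv : ∀ k, k ≠ i → k ≠ j → v k = 0) : s = inner ℂ (u i) (v i) + inner ℂ (u j) (v j) := by
  classical
  have h1 := hasSum_sum_of_ne_finset_zero (s := {i, j})
    (f := fun k => (inner ℂ (u k) (v k) : ℂ)) (L := .unconditional ι) (fun k hk => by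
      simp only [Finset.mem_insert, Finset.mem_singleton, not_or] at hk
      rw [hv k hk.1 hk.2, inner_zero_right])
  rw [Finset.sum_pair hij] at h1
  exact h.unique h1

theorem exists_Lp_ne_zero (E : Type*) [NormedAddCommGroup E] [Nontrivial E] :
    ∃ φ : Lp E 2 halfLine, φ ≠ 0 := by
  obtain ⟨v, hv⟩ := exists_ne (0 : E)
  have hfin : halfLine (Set.Ioo 0 1) ≠ ∞ :=
    ((Measure.restrict_apply_le _ _).trans_lt (by simp)).ne
  refine ⟨indicatorConstLp 2 measurableSet_Ioo hfin v, fun h => ?_⟩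
  have hn := norm_indicatorConstLp (p := 2) (hs := measurableSet_Ioo) (hμs := hfin)
    (c := v) (by norm_num) (by norm_num)
  rw [h, norm_zero, eq_comm, mul_eq_zero] at hn
  rcases hn with hn | hn
  · exact hv (norm_eq_zero.1 hn)
  · have h1 : halfLine.real (Set.Ioo (0 : ℝ) 1) = 1 := by
      rw [measureReal_restrict_apply measurableSet_Ioo, Set.inter_eq_left.2 Set.Ioo_subset_Ioi_self]
      simp
    rw [h1] at hn
    simp at hn

theorem lintegral_enorm_sq_div_eq_zero {E : Type*} [NormedAddCommGroup E] {φ : Lp E 2 halfLine}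
    (h : ∫⁻ ω, ‖φ ω‖ₑ ^ 2 / ENNReal.ofReal ω ∂halfLine = 0) : φ = 0 := by
  have hm : AEMeasurable (fun ω => ‖φ ω‖ₑ ^ 2 / ENNReal.ofReal ω) halfLine :=
    ((Lp.aestronglyMeasurable φ).enorm.pow_const 2).div ENNReal.measurable_ofReal.aemeasurable
  rw [lintegral_eq_zero_iff' hm] at h
  rw [Lp.eq_zero_iff_ae_eq_zero]
  filter_upwards [h] with ω hω
  have := (ENNReal.div_eq_zero_iff.1 hω).resolve_right ENNReal.ofReal_ne_top
  simpa using this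

/-- A vector with a single nonzero component isolates the factor `C i / N i`, which can be cancelled
against a finite nonzero norm. -/
theorem forall_tsum_eq_iff {ι H : Type*} {E : ι → Type*} [∀ i, NormedAddCommGroup (E i)]
    [NormedAddCommGroup H] {c : ∀ i, H → E i} {C N : ι → ℝ≥0∞}
    (hnorm : ∀ f, ∑' i, ‖c i f‖ₑ ^ 2 = ‖f‖ₑ ^ 2)
    (hsingle : ∀ i, ∃ f, c i f ≠ 0 ∧ ∀ j, j ≠ i → c j f = 0)
    (hN : ∀ i, N i ≠ 0) (hN' : ∀ i, N i ≠ ∞) :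
    (∀ f, ∑' i, C i / N i * ‖c i f‖ₑ ^ 2 = ‖f‖ₑ ^ 2) ↔ ∀ i, C i = N i := by
  constructor
  · intro h i
    obtain ⟨f, hf, hf'⟩ := hsingle i
    have h1 := h f
    have hz : ∀ j, j ≠ i → ‖c j f‖ₑ ^ 2 = 0 := fun j hj => by
      rw [hf' j hj]; simp
    rw [← hnorm, tsum_eq_single i hz, tsum_eq_single i fun j hj => by rw [hz j hj, mul_zero]] at h1
    have h0 : ‖c i f‖ₑ ^ 2 ≠ 0 := pow_ne_zero 2 (enorm_ne_zero.2 hf)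
    have htop : ‖c i f‖ₑ ^ 2 ≠ ∞ := ENNReal.pow_ne_top enorm_ne_top
    have h2 := (ENNReal.mul_eq_right h0 htop).1 h1
    exact (ENNReal.div_eq_one_iff (hN i) (hN' i)).1 h2
  · intro h f
    rw [← hnorm]
    refine tsum_congr fun i => ?_
    rw [h, ENNReal.div_self (hN i) (hN' i), one_mul]

/-- A nontrivial closed invariant subspace supplies a nonzero `η` in it and a nonzero `f` in its
orthogonal complement, whose matrix coefficients all vanish. -/
theorem isIrreducibleRep_of_forall {G H : Type*} [Group G] [NormedAddCommGroup H]
    [InnerProductSpace ℂ H] [CompleteSpace H] [Nontrivial H] {π : UnitaryRep G H}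
    (h : ∀ η f : H, (∀ g, (inner ℂ (π g η) f : ℂ) = 0) → η = 0 ∨ f = 0) : IsIrreducibleRep π := by
  refine ⟨inferInstance, fun M hM hinv => ?_⟩
  by_contra! hne
  have : CompleteSpace M := hM.completeSpace_coe
  obtain ⟨η, hη, hη0⟩ := Submodule.exists_mem_ne_zero_of_ne_bot hne.1
  obtain ⟨f, hf, hf0⟩ := Submodule.exists_mem_ne_zero_of_ne_bot
    (fun h => hne.2 (Submodule.orthogonal_eq_bot_iff.1 h) : Mᗮ ≠ ⊥)
  exact (h η f fun g => (Submodule.mem_orthogonal _ _).1 hf _ (hinv g _ hη)).elim hη0 hf0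

theorem exists_of_components {G ι H : Type*} {E : ι → Type*} [Group G] [NormedAddCommGroup H]
    [InnerProductSpace ℂ H] [∀ i, NormedAddCommGroup (E i)] [∀ i, InnerProductSpace ℂ (E i)]
    {π : UnitaryRep G H} {τ : ∀ i, UnitaryRep G (E i)} {c : ∀ i, H →ₗ[ℂ] E i}
    (S : H ≃ₗᵢ[ℂ] lp E 2) (hS : ∀ f i, S f i = c i f)
    (hcov : ∀ i g f, c i (π g f) = τ i g (c i f))
    {R : ∀ i, H → E i → Prop} (hR : ∀ i f, R i f (c i f))
    {P : H → Prop} {Q : ∀ i, E i → Prop} (hP : ∀ f, P f ↔ ∀ i, Q i (c i f)) {T : Prop} (hT : T) 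
    {T' : Prop} (hT' : T') :
    ∃ S : H ≃ₗᵢ[ℂ] lp E 2, (∀ f i, R i f (S f i)) ∧ 
      (∀ g F i, S (π g (S.symm F)) i = τ i g (F i)) ∧ T ∧ T' ∧ 
      ∀ f, P f ↔ ∀ i, Q i (S f i) := by
  refine ⟨S, fun f i => ?_, fun g F i => ?_, hT, hT', fun f => ?_⟩
  · rw [hS]
    exact hR i f
  · obtain ⟨f, rfl⟩ := S.surjective F
    rw [LinearIsometryEquiv.symm_apply_apply, hS, hS, hcov]
  · simp only [hS, hP]

section Components

variable {G ι H : Type*} {E : ι → Type*} [Group G] [NormedAddCommGroup H] [InnerProductSpace ℂ H]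
  [∀ i, NormedAddCommGroup (E i)] [∀ i, InnerProductSpace ℂ (E i)]
  [∀ i, Nontrivial (E i)] {π : UnitaryRep G H} {τ : ∀ i, UnitaryRep G (E i)}
  {c : ∀ i, H →ₗ[ℂ] E i}

/-- Vectors of one summand lift to vectors of `H` with only that component, so the coefficients of
the summand are coefficients of `π`. -/
theorem isIrreducibleRep_of_components [∀ i, CompleteSpace (E i)]
    (hsum : ∀ f g, HasSum (fun i => (inner ℂ (c i f) (c i g) : ℂ)) (inner ℂ f g))
    (hcov : ∀ i g f, c i (π g f) = τ i g (c i f))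
    (hsingle : ∀ i (φ : E i), ∃ f, c i f = φ ∧ ∀ j, j ≠ i → c j f = 0)
    (hvan : ∀ η f, (∀ g, (inner ℂ (π g η) f : ℂ) = 0) → ∀ i, c i η = 0 ∨ c i f = 0) (i : ι) :
    IsIrreducibleRep (τ i) := by
  refine isIrreducibleRep_of_forall fun η₀ f₀ h => ?_
  obtain ⟨η, rfl, -⟩ := hsingle i η₀
  obtain ⟨f, rfl, hf⟩ := hsingle i f₀
  exact hvan η f (fun g => by rw [eq_inner_of_hasSum (hsum (π g η) f) hf, hcov, h g]) i

/-- Given an equivalence `T`, let `u` and `v` have the single components `φ` and `T φ`. The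
coefficients of `u + v` against `u - v` are `⟨τ_i(g)φ, φ⟩ - ⟨τ_j(g)Tφ, Tφ⟩ = 0`, although both
vectors have the nonzero component `φ` at `i`. -/
theorem not_areEquivalent_of_components
    (hsum : ∀ f g, HasSum (fun i => (inner ℂ (c i f) (c i g) : ℂ)) (inner ℂ f g))
    (hcov : ∀ i g f, c i (π g f) = τ i g (c i f))
    (hsingle : ∀ i (φ : E i), ∃ f, c i f = φ ∧ ∀ j, j ≠ i → c j f = 0)
    (hvan : ∀ η f, (∀ g, (inner ℂ (π g η) f : ℂ) = 0) → ∀ i, c i η = 0 ∨ c i f = 0) {i j : ι}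
    (hij : i ≠ j) : ¬ AreEquivalent (τ i) (τ j) := by
  rintro ⟨T, hT⟩
  obtain ⟨φ, hφ⟩ := exists_ne (0 : E i)
  obtain ⟨u, hu, hu'⟩ := hsingle i φ
  obtain ⟨v, hv, hv'⟩ := hsingle j (T φ)
  have hi₁ : c i (u + v) = φ := by rw [map_add, hu, hv' i hij, add_zero]
  have hi₂ : c i (u - v) = φ := by rw [map_sub, hu, hv' i hij, sub_zero]
  have hj₁ : c j (u + v) = T φ := by rw [map_add, hv, hu' j hij.symm, zero_add]
  have hj₂ : c j (u - v) = -T φ := by rw [map_sub, hv, hu' j hij.symm, zero_sub]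
  have h := hvan (u + v) (u - v) (fun g => by
    have h1 := eq_inner_add_inner_of_hasSum (hsum (π g (u + v)) (u - v)) hij
      fun k hki hkj => by rw [map_sub, hu' k hki, hv' k hkj, sub_zero]
    rw [h1, hcov, hcov, hi₁, hi₂, hj₁, hj₂,
      inner_neg_right, ← hT, LinearIsometryEquiv.inner_map_map, add_neg_cancel]) i
  rw [hi₁, hi₂, or_self] at h
  exact hφ h

end Components

/-! ### Admissibility, irreducibility and inequivalence -/

namespace ZonalDecomposition

variable {d : ℕ} {ι : Type*} {K : ι → AngularSpace d} {n : Sph d}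

theorem nontrivial (hK : ZonalDecomposition K n) (i : ι) : Nontrivial (K i).carrier :=
  Submodule.nontrivial_iff_ne_bot.2 (hK.ne_bot i)

theorem nontrivial_L2Radial (hK : ZonalDecomposition K n) (i : ι) : Nontrivial (K i).L2Radial := by
  have := hK.nontrivial i
  obtain ⟨φ, hφ⟩ := exists_Lp_ne_zero (K i).carrier
  exact ⟨φ, 0, hφ⟩

theorem finrank_ne_zero (hK : ZonalDecomposition K n) (i : ι) :
    (Module.finrank ℂ (K i).carrier : ℝ≥0∞) ≠ 0 := by
  have := hK.nontrivial i
  exact_mod_cast (Module.finrank_pos (R := ℂ) (M := (K i).carrier)).ne'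

variable [Countable ι]

theorem hasSum_inner_componentMap (hK : ZonalDecomposition K n) (hd : 1 ≤ d) (f g : L2 d) :
    HasSum (fun i => (inner ℂ (componentMap (K i) hd f) (componentMap (K i) hd g) : ℂ))
      (inner ℂ f g) :=
  hasSum_inner_apply (decomposition hK hd) f g

theorem isAdmissible_iff (hK : ZonalDecomposition K n) (hd : 2 ≤ d) (hd' : 1 ≤ d) (η : L2 d) :
    IsAdmissible (schroedingerRep d) η ↔
      ∀ i, ∫⁻ ω, ‖componentMap (K i) hd' η ω‖ₑ ^ 2 / ENNReal.ofReal ω ∂halfLine =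
        (Module.finrank ℂ (K i).carrier : ℝ≥0∞) := by
  simp only [IsAdmissible, hK.lintegral_haar_enorm_sq_inner hd hd' η]
  refine forall_tsum_eq_iff (E := fun i => (K i).L2Radial) (c := fun i => componentMap (K i) hd')
    (tsum_enorm_sq_componentMap hK hd')
    (fun i => ?_) hK.finrank_ne_zero fun i => ENNReal.natCast_ne_top _
  have := hK.nontrivial_L2Radial i
  obtain ⟨φ, hφ⟩ := exists_ne (0 : (K i).L2Radial)
  obtain ⟨f, hf, hf'⟩ := exists_componentMap_eq_single hK hd' i φ
  exact ⟨f, hf.trans_ne hφ, hf'⟩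

/-- In the central identity a sum of nonnegative terms is zero, so in each term one factor is zero;
the weight `1/ω` and the finite dimension do not hide a nonzero component. -/
theorem eq_zero_of_inner_schroedingerRep_eq_zero (hK : ZonalDecomposition K n) (hd : 2 ≤ d)
    (hd' : 1 ≤ d) {η f : L2 d} (h : ∀ g, (inner ℂ (schroedingerRep d g η) f : ℂ) = 0) (i : ι) :
    componentMap (K i) hd' η = 0 ∨ componentMap (K i) hd' f = 0 := by
  have h1 := hK.lintegral_haar_enorm_sq_inner hd hd' η f
  simp only [h, enorm_zero, ne_eq, OfNat.ofNat_ne_zero, not_false_eq_true, zero_pow,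
    lintegral_zero] at h1
  have h2 := ENNReal.tsum_eq_zero.1 h1.symm i
  rcases mul_eq_zero.1 h2 with h3 | h3
  · left
    exact lintegral_enorm_sq_div_eq_zero
      ((ENNReal.div_eq_zero_iff.1 h3).resolve_right (ENNReal.natCast_ne_top _))
  · right
    simpa using h3

theorem isIrreducibleRep_tensorRep (hK : ZonalDecomposition K n) (hd : 2 ≤ d) (i : ι) :
    IsIrreducibleRep (K i).tensorRep := by
  have hd' : 1 ≤ d := by omega
  have := hK.nontrivial_L2Radial
  exact isIrreducibleRep_of_components (H := L2 d) (E := fun i => (K i).L2Radial)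
    (π := schroedingerRep d) (τ := fun i => (K i).tensorRep) (c := fun i => componentMap (K i) hd') (hK.hasSum_inner_componentMap hd')
    (fun i g f => componentMap_schroedingerRep (K i) hd' g f)
    (fun i φ => exists_componentMap_eq_single hK hd' i φ)
    (fun η f h => hK.eq_zero_of_inner_schroedingerRep_eq_zero hd hd' h) i

theorem not_areEquivalent_tensorRep (hK : ZonalDecomposition K n) (hd : 2 ≤ d) {i j : ι}
    (hij : i ≠ j) : ¬ AreEquivalent (K i).tensorRep (K j).tensorRep := by
  have hd' : 1 ≤ d := by omega
  have := hK.nontrivial_L2Radial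
  exact not_areEquivalent_of_components (H := L2 d) (E := fun i => (K i).L2Radial)
    (π := schroedingerRep d) (τ := fun i => (K i).tensorRep) (c := fun i => componentMap (K i) hd') (hK.hasSum_inner_componentMap hd')
    (fun i g f => componentMap_schroedingerRep (K i) hd' g f)
    (fun i φ => exists_componentMap_eq_single hK hd' i φ)
    (fun η f h => hK.eq_zero_of_inner_schroedingerRep_eq_zero hd hd' h) hij

theorem exists_decomposition (hK : ZonalDecomposition K n) (hd : 2 ≤ d) :
    ∃ S : L2 d ≃ₗᵢ[ℂ] lp (fun i => (K i).L2Radial) 2,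
      (∀ (f : L2 d) (i : ι), S f i =ᵐ[volume.restrict (Set.Ioi (0 : ℝ))] (K i).component f) ∧
      (∀ (g : SGroup d) (F : lp (fun i => (K i).L2Radial) 2) (i : ι),
        S (schroedingerRep d g (S.symm F)) i = (K i).tensorRep g (F i)) ∧
      (∀ i, IsIrreducibleRep (K i).tensorRep) ∧
      (∀ i j, i ≠ j → ¬ AreEquivalent (K i).tensorRep (K j).tensorRep) ∧
      (∀ η : L2 d, IsAdmissible (schroedingerRep d) η ↔
        ∀ i, ∫⁻ ω in Set.Ioi (0 : ℝ), ‖S η i ω‖ₑ ^ 2 / ENNReal.ofReal ω =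
          (Module.finrank ℂ (K i).carrier : ℝ≥0∞)) :=
  have hd' : 1 ≤ d := by omega
  exists_of_components (H := L2 d) (E := fun i => (K i).L2Radial)
    (π := schroedingerRep d) (τ := fun i => (K i).tensorRep) (c := fun i => componentMap (K i) hd')
    (decomposition hK hd') (fun _ _ => rfl)
    (fun i g f => componentMap_schroedingerRep (K i) hd' g f)
    (R := fun i f φ => φ =ᵐ[volume.restrict (Set.Ioi (0 : ℝ))] (K i).component f)
    (fun i f => componentMap_ae (K i) hd' f)
    (P := fun η => IsAdmissible (schroedingerRep d) η)
    (Q := fun i φ => ∫⁻ ω in Set.Ioi (0 : ℝ), ‖φ ω‖ₑ ^ 2 / ENNReal.ofReal ω =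
          (Module.finrank ℂ (K i).carrier : ℝ≥0∞))
    (fun η => hK.isAdmissible_iff hd hd' η) (hK.isIrreducibleRep_tensorRep hd)
    (fun i j hij => hK.not_areEquivalent_tensorRep hd hij)

end ZonalDecomposition

/-! ### Polynomials on the sphere -/

/-- The restriction of polynomials to the sphere, as continuous functions. -/
def sphEval (d : ℕ) : MvPolynomial (Fin d) ℂ →ₐ[ℂ] C(Sph d, ℂ) :=
  MvPolynomial.aeval fun j => ⟨fun s => ((s : Euc d) j : ℂ), by fun_prop⟩

theorem sphEval_apply {d : ℕ} (p : MvPolynomial (Fin d) ℂ) (s : Sph d) :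
    sphEval d p s = MvPolynomial.eval (fun j => ((s : Euc d) j : ℂ)) p := by
  induction p using MvPolynomial.induction_on with
  | C c => simp [sphEval]
  | add p q hp hq => simp only [map_add, ContinuousMap.add_apply, hp, hq]
  | mul_X p j hp =>
    simp only [map_mul, ContinuousMap.mul_apply, hp]
    simp [sphEval]

/-- Continuous functions on the sphere, as elements of `L²(S^{d-1})`. -/
abbrev sphToLp (d : ℕ) : C(Sph d, ℂ) →L[ℂ] L2Sph d := ContinuousMap.toLp 2 (sphereMeasure d) ℂ

theorem sphToLp_eq {d : ℕ} (u : C(Sph d, ℂ)) : sphToLp d u = (continuous_memLp u.continuous).toLp := by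
  ext1
  exact (ContinuousMap.coeFn_toLp _ u).trans (MemLp.coeFn_toLp _).symm

theorem sphToLp_sphEval {d : ℕ} (p : MvPolynomial (Fin d) ℂ) :
    sphToLp d (sphEval d p) = polyToSphere d p := by
  ext1
  filter_upwards [ContinuousMap.coeFn_toLp (p := 2) (𝕜 := ℂ) (sphereMeasure d) (sphEval d p),
    polyToSphere_ae p] with s h1 h2
  rw [h1, h2, sphEval_apply]

theorem star_sphEval {d : ℕ} (p : MvPolynomial (Fin d) ℂ) :
    star (sphEval d p) = sphEval d (MvPolynomial.map (starRingEnd ℂ) p) := by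
  ext s
  rw [ContinuousMap.star_apply, sphEval_apply, sphEval_apply, MvPolynomial.eval_map,
    Complex.star_def, ← MvPolynomial.eval₂_id, MvPolynomial.eval₂_comp_left]
  congr 1
  · ext1 j
    exact Complex.conj_ofReal _

theorem inner_sphToLp {d : ℕ} (u v : C(Sph d, ℂ)) :
    (inner ℂ (sphToLp d u) (sphToLp d v) : ℂ) = ∫ s : Sph d, star (u s) * v s ∂sphereMeasure d := by
  rw [ContinuousMap.inner_toLp]
  refine integral_congr_ae (Filter.Eventually.of_forall fun s => ?_)
  simp [mul_comm]

/-- A function on the sphere which is orthogonal to all polynomials is zero. -/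
theorem eq_zero_of_inner_polyToSphere {d : ℕ} {F : L2Sph d}
    (h : ∀ p, (inner ℂ (polyToSphere d p) F : ℂ) = 0) : F = 0 := by
  let A : StarSubalgebra ℂ C(Sph d, ℂ) :=
    { (sphEval d).range with
      star_mem' := by
        rintro _ ⟨p, rfl⟩
        exact ⟨MvPolynomial.map (starRingEnd ℂ) p, (star_sphEval p).symm⟩ }
  have hsep : A.SeparatesPoints := by
    intro x y hxy
    obtain ⟨j, hj⟩ : ∃ j, (x : Euc d) j ≠ (y : Euc d) j := by
      by_contra! hall
      exact hxy (Subtype.ext (PiLp.ext hall))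
    refine ⟨_, ⟨sphEval d (MvPolynomial.X j), ⟨MvPolynomial.X j, rfl⟩, rfl⟩, ?_⟩
    beta_reduce
    rw [sphEval_apply, sphEval_apply, MvPolynomial.eval_X, MvPolynomial.eval_X]
    exact_mod_cast hj
  have hA := ContinuousMap.starSubalgebra_topologicalClosure_eq_top_of_separatesPoints A hsep
  have hclosed : IsClosed {u : C(Sph d, ℂ) | (inner ℂ (sphToLp d u) F : ℂ) = 0} :=
    isClosed_eq (((sphToLp d).continuous).inner continuous_const) continuous_const
  have hsub : (A : Set C(Sph d, ℂ)) ⊆ {u | (inner ℂ (sphToLp d u) F : ℂ) = 0} := by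
    rintro _ ⟨p, rfl⟩
    exact (congrArg (fun G => (inner ℂ G F : ℂ)) (sphToLp_sphEval p)).trans (h p)
  have hall : ∀ u : C(Sph d, ℂ), (inner ℂ (sphToLp d u) F : ℂ) = 0 := fun u => by
    have hu : u ∈ A.topologicalClosure := hA ▸ StarSubalgebra.mem_top
    exact closure_minimal hsub hclosed hu
  have hdense := ContinuousMap.toLp_denseRange ℂ ℂ (μ := sphereMeasure d) (p := 2)
    ENNReal.ofNat_ne_top
  have h0 : (inner ℂ F F : ℂ) = 0 :=
    hdense.induction_on (p := fun G => (inner ℂ G F : ℂ) = 0) F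
      (isClosed_eq (continuous_id.inner continuous_const) continuous_const) hall
  exact inner_self_eq_zero.1 h0

theorem integral_comp_sphRot {d : ℕ} (R : SO d) {u : Sph d → ℂ} (hu : Continuous u) :
    ∫ s : Sph d, u (sphRot R s) ∂sphereMeasure d = ∫ s : Sph d, u s ∂sphereMeasure d := by
  conv_rhs => rw [← (measurePreserving_sphRot R).map_eq]
  exact (integral_map (measurable_sphRot R).aemeasurable hu.aestronglyMeasurable).symm

/-! ### The Fourier decomposition of the circle -/

/-- The function `z ^ n` on the circle. -/
def circlePow (n : ℤ) : C(Sph 2, ℂ) := ⟨_, continuous_circleCoord_zpow n⟩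

theorem sphToLp_circlePow (n : ℤ) : sphToLp 2 (circlePow n) = fourierMode n := sphToLp_eq _

theorem star_circleCoord (s : Sph 2) : star (circleCoord s) = (circleCoord s)⁻¹ := by
  refine eq_inv_of_mul_eq_one_left ?_
  have hs : ‖(s : Euc 2)‖ ^ 2 = 1 := by simp
  rw [EuclideanSpace.norm_sq_eq, Fin.sum_univ_two] at hs
  simp only [Real.norm_eq_abs, sq_abs] at hs
  have h : (((s : Euc 2) 0 ^ 2 + (s : Euc 2) 1 ^ 2 : ℝ) : ℂ) = 1 := by rw [hs]; simp
  push_cast at h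
  simp only [circleCoord, star_add, star_mul', Complex.star_def, Complex.conj_ofReal, Complex.conj_I]
  linear_combination h - ((s : Euc 2) 1 : ℂ) ^ 2 * Complex.I_sq

/-- The point `(cos θ, sin θ)`. -/
def circlePoint (θ : ℝ) : Sph 2 :=
  ⟨!₂[Real.cos θ, Real.sin θ], by simp [EuclideanSpace.norm_eq, Fin.sum_univ_two]⟩

theorem circleCoord_circlePoint (θ : ℝ) : circleCoord (circlePoint θ) = Complex.exp (θ * Complex.I) := by
  rw [Complex.exp_mul_I]
  simp [circleCoord, circlePoint]

/-- Rotation by the angle `π/k` changes the sign of `z ^ k` and preserves the integral. -/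
theorem integral_circleCoord_zpow {k : ℤ} (hk : k ≠ 0) :
    ∫ s : Sph 2, circleCoord s ^ k ∂sphereMeasure 2 = 0 := by
  obtain ⟨R, hR⟩ := exists_sphRot_eq le_rfl (circlePoint 0) (circlePoint (Real.pi / k))
  have h := integral_comp_sphRot R (continuous_circleCoord_zpow k)
  have hw := circleCoord_sphRot R (circlePoint 0)
  simp only [hR, circleCoord_circlePoint, Complex.ofReal_zero, zero_mul, Complex.exp_zero,
    mul_one] at hw
  have hk' : (k : ℂ) ≠ 0 := by exact_mod_cast hk
  have hpow : (Complex.exp (((Real.pi / k : ℝ) : ℂ) * Complex.I)) ^ k = -1 := by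
    rw [← Complex.exp_int_mul, ← Complex.exp_pi_mul_I]
    congr 1
    push_cast
    field_simp
  simp only [circleCoord_sphRot, ← hw, mul_zpow, hpow, neg_mul, one_mul, integral_neg] at h
  exact self_eq_neg.1 h.symm

/-- On the circle the conjugate of `z` is `z⁻¹`, so the coordinates are `(z + z⁻¹)/2` and `(z -
z⁻¹)/(2i)`. -/
theorem coord_mul_circlePow (j : Fin 2) (n : ℤ) :
    circlePow n * sphEval 2 (MvPolynomial.X j) ∈ Submodule.span ℂ (Set.range circlePow) := by
  have hmem : ∀ k, circlePow k ∈ Submodule.span ℂ (Set.range circlePow) := fun k =>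
    Submodule.subset_span ⟨k, rfl⟩
  have hz : ∀ s : Sph 2, circleCoord s ^ (n + 1) = circleCoord s ^ n *
      (((s : Euc 2) 0 : ℂ) + ((s : Euc 2) 1 : ℂ) * Complex.I) := fun s =>
    zpow_add_one₀ (circleCoord_ne_zero s) n
  have hz' : ∀ s : Sph 2, circleCoord s ^ (n - 1) = circleCoord s ^ n *
      (((s : Euc 2) 0 : ℂ) - ((s : Euc 2) 1 : ℂ) * Complex.I) := fun s => by
    rw [zpow_sub_one₀ (circleCoord_ne_zero s), ← star_circleCoord]
    simp [circleCoord, sub_eq_add_neg]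
  fin_cases j
  · have : circlePow n * sphEval 2 (MvPolynomial.X 0) =
        (1 / 2 : ℂ) • (circlePow (n + 1) + circlePow (n - 1)) := by
      ext s
      simp only [ContinuousMap.mul_apply, ContinuousMap.smul_apply, ContinuousMap.add_apply,
        sphEval_apply, MvPolynomial.eval_X, smul_eq_mul, circlePow, ContinuousMap.coe_mk, hz, hz']
      ring
    exact this ▸ Submodule.smul_mem _ _ (Submodule.add_mem _ (hmem _) (hmem _))
  · have : circlePow n * sphEval 2 (MvPolynomial.X 1) =
        (-Complex.I / 2 : ℂ) • (circlePow (n + 1) - circlePow (n - 1)) := by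
      ext s
      simp only [ContinuousMap.mul_apply, ContinuousMap.smul_apply, ContinuousMap.sub_apply,
        sphEval_apply, MvPolynomial.eval_X, smul_eq_mul, circlePow, ContinuousMap.coe_mk, hz, hz']
      linear_combination (circleCoord s ^ n * ((s : Euc 2) 1 : ℂ)) * Complex.I_sq
    exact this ▸ Submodule.smul_mem _ _ (Submodule.sub_mem _ (hmem _) (hmem _))

theorem sphEval_mem_span_circlePow (p : MvPolynomial (Fin 2) ℂ) :
    sphEval 2 p ∈ Submodule.span ℂ (Set.range circlePow) := by
  induction p using MvPolynomial.induction_on with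
  | C c =>
    have : sphEval 2 (MvPolynomial.C c) = c • circlePow 0 := by
      ext s
      simp [circlePow]
    exact this ▸ Submodule.smul_mem _ _ (Submodule.subset_span ⟨0, rfl⟩)
  | add p q hp hq => exact map_add (sphEval 2) p q ▸ Submodule.add_mem _ hp hq
  | mul_X p j hp =>
    rw [map_mul]
    generalize sphEval 2 p = w at hp
    induction hp using Submodule.span_induction with
    | mem u hu => obtain ⟨n, rfl⟩ := hu; exact coord_mul_circlePow j n
    | zero => rw [zero_mul]; exact Submodule.zero_mem _
    | add u v _ _ hu hv => rw [add_mul]; exact Submodule.add_mem _ hu hv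
    | smul c u _ hu => rw [smul_mul_assoc]; exact Submodule.smul_mem _ _ hu

theorem fourierMode_ne_zero (n : ℤ) : fourierMode n ≠ 0 := by
  rw [← sphToLp_circlePow, ← map_zero (sphToLp 2)]
  intro h
  have h1 := ContinuousMap.toLp_injective (p := 2) (𝕜 := ℂ) (sphereMeasure 2) h
  exact zpow_ne_zero n (circleCoord_ne_zero (circlePoint 0))
    (DFunLike.congr_fun h1 (circlePoint 0))

/-- The zonal condition needs no invariance here, since each space is a line; totality holds because
polynomials restrict to Laurent polynomials in `z`. -/
theorem zonalDecomposition_fourierModes : ZonalDecomposition fourierModes (circlePoint 0) where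
  continuous k φ hφ := by
    obtain ⟨c, rfl⟩ := Submodule.mem_span_singleton.1 hφ
    rw [← sphToLp_circlePow, ← map_smul]
    exact ⟨_, (c • circlePow k).continuous, ContinuousMap.coeFn_toLp _ _⟩
  ne_bot k h := fourierMode_ne_zero k (Submodule.span_singleton_eq_bot.1 h)
  orthogonal k l hkl φ hφ ψ hψ := by
    obtain ⟨c, rfl⟩ := Submodule.mem_span_singleton.1 hφ
    obtain ⟨c', rfl⟩ := Submodule.mem_span_singleton.1 hψ
    rw [inner_smul_left, inner_smul_right, ← sphToLp_circlePow, ← sphToLp_circlePow,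
      inner_sphToLp]
    have h : ∀ s : Sph 2, star (circlePow k s) * circlePow l s = circleCoord s ^ (l - k) :=
      fun s => by
        simp only [circlePow, ContinuousMap.coe_mk, star_zpow₀, star_circleCoord]
        rw [inv_zpow', ← zpow_add₀ (circleCoord_ne_zero s)]
        congr 1
        ring
    simp only [h]
    rw [integral_circleCoord_zpow (sub_ne_zero.2 hkl.symm), mul_zero, mul_zero]
  total F hF := by
    refine eq_zero_of_inner_polyToSphere fun p => ?_
    rw [← sphToLp_sphEval]
    have hp := sphEval_mem_span_circlePow p
    generalize sphEval 2 p = w at hp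
    induction hp using Submodule.span_induction with
    | mem u hu =>
      obtain ⟨k, rfl⟩ := hu
      rw [sphToLp_circlePow]
      exact hF k _ (Submodule.mem_span_singleton_self _)
    | zero => rw [map_zero, inner_zero_left]
    | add u v _ _ hu hv => rw [map_add, inner_add_left, hu, hv, add_zero]
    | smul c u _ hu => rw [map_smul, inner_smul_left, hu, mul_zero]
  zonal k φ hφ ψ hψ h0 _ _ := by
    obtain ⟨c, rfl⟩ := Submodule.mem_span_singleton.1 hφ
    obtain ⟨c', rfl⟩ := Submodule.mem_span_singleton.1 hψ
    have hc : c ≠ 0 := by rintro rfl; exact h0 (zero_smul _ _)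
    exact ⟨c' / c, by rw [smul_smul, div_mul_cancel₀ _ hc]⟩

/-! ### Plane rotations and infinitesimal rotations -/

/-- The rotation `R` is the rotation by the angle `θ` in the plane of the coordinates `i`, `j`. -/
def IsPlaneRotation {d : ℕ} (i j : Fin d) (θ : ℝ) (R : SO d) : Prop :=
  ∀ x : Euc d, rot d R x i = Real.cos θ * x i - Real.sin θ * x j ∧
    rot d R x j = Real.sin θ * x i + Real.cos θ * x j ∧
    ∀ k, k ≠ i → k ≠ j → rot d R x k = x k

/-- A rotation by `θ` is the product of two reflections whose normals, in the plane of `i` and `j`,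
make the angle `θ/2`. -/
theorem exists_isPlaneRotation {d : ℕ} {i j : Fin d} (hij : i ≠ j) (θ : ℝ) :
    ∃ R : SO d, IsPlaneRotation i j θ R := by
  set v : Euc d := EuclideanSpace.single i 1 with hv
  set w : Euc d := Real.cos (θ / 2) • EuclideanSpace.single i 1 +
    Real.sin (θ / 2) • EuclideanSpace.single j 1 with hw
  have hvn : ‖v‖ ^ 2 = 1 := by simp [hv]
  have hwn : ‖w‖ ^ 2 = 1 := by
    rw [hw, ← real_inner_self_eq_norm_sq]
    simp only [inner_add_left, inner_add_right, real_inner_smul_left, real_inner_smul_right,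
      EuclideanSpace.inner_single_left]
    simp [hij, hij.symm]
    nlinarith [Real.sin_sq_add_cos_sq (θ / 2)]
  have h0 : ∀ u : Euc d, ‖u‖ ^ 2 = 1 → u ≠ 0 := by rintro u hu rfl; simp at hu
  obtain ⟨R, hR⟩ := exists_rot_eq
    ((ℝ ∙ v)ᗮ.reflection.trans (ℝ ∙ w)ᗮ.reflection) (by
      have : (((ℝ ∙ v)ᗮ.reflection.trans (ℝ ∙ w)ᗮ.reflection).toLinearEquiv :
          Euc d →ₗ[ℝ] Euc d) =
        ((ℝ ∙ w)ᗮ.reflection.toLinearEquiv : Euc d →ₗ[ℝ] Euc d) ∘ₗ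
          ((ℝ ∙ v)ᗮ.reflection.toLinearEquiv : Euc d →ₗ[ℝ] Euc d) := rfl
      rw [this, LinearMap.det_comp, det_reflection_orthogonal_span_singleton (h0 w hwn),
        det_reflection_orthogonal_span_singleton (h0 v hvn)]
      norm_num)
  have hrefl : ∀ u : Euc d, ‖u‖ ^ 2 = 1 → ∀ x, (ℝ ∙ u)ᗮ.reflection x = x - (2 * inner ℝ u x) • u :=
    fun u hu x => by
      rw [Submodule.reflection_orthogonal_apply, Submodule.reflection_singleton_apply]
      simp only [RCLike.ofReal_real_eq_id, id, hu, div_one, neg_sub]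
      rw [two_smul, two_mul, add_smul]
  have hc : Real.cos θ = 2 * Real.cos (θ / 2) ^ 2 - 1 := by
    rw [← Real.cos_two_mul]; ring_nf
  have hs : Real.sin θ = 2 * Real.sin (θ / 2) * Real.cos (θ / 2) := by
    rw [← Real.sin_two_mul]; ring_nf
  have hsc := Real.sin_sq_add_cos_sq (θ / 2)
  refine ⟨R, fun x => ?_⟩
  have hx : rot d R x = (x - (2 * x i) • v) -
      (2 * (-Real.cos (θ / 2) * x i + Real.sin (θ / 2) * x j)) • w := by
    rw [hR]
    change (ℝ ∙ w)ᗮ.reflection ((ℝ ∙ v)ᗮ.reflection x) = _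
    rw [hrefl v hvn, hrefl w hwn]
    have e1 : inner ℝ v x = x i := by simp [hv, EuclideanSpace.inner_single_left]
    have e2 : inner ℝ w (x - (2 * x i) • v) =
        -Real.cos (θ / 2) * x i + Real.sin (θ / 2) * x j := by
      simp only [hw, hv, inner_add_left, inner_sub_right, real_inner_smul_left,
        real_inner_smul_right, EuclideanSpace.inner_single_left]
      simp [hij.symm]
      ring
    rw [e1, e2]
  rw [hx]
  refine ⟨?_, ?_, fun k hki hkj => ?_⟩
  · simp [hv, hw, hij]
    rw [hc, hs]; ring
  · simp [hv, hw, hij.symm]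
    rw [hc, hs]; linear_combination (-2 * x j) * hsc
  · simp [hv, hw, hki, hkj]

open MvPolynomial in
/-- The infinitesimal rotation `xᵢ ∂ⱼ - xⱼ ∂ᵢ`. -/
def angularDerivation {d : ℕ} (i j : Fin d) :
    Derivation ℂ (MvPolynomial (Fin d) ℂ) (MvPolynomial (Fin d) ℂ) :=
  (X i : MvPolynomial (Fin d) ℂ) • pderiv j - (X j : MvPolynomial (Fin d) ℂ) • pderiv i

theorem angularDerivation_apply {d : ℕ} (i j : Fin d) (p : MvPolynomial (Fin d) ℂ) :
    angularDerivation i j p = MvPolynomial.X i * MvPolynomial.pderiv j p -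
      MvPolynomial.X j * MvPolynomial.pderiv i p := rfl

/-- The integral of a polynomial over the sphere. -/
def sphIntegral (d : ℕ) : MvPolynomial (Fin d) ℂ →ₗ[ℂ] ℂ where
  toFun p := ∫ s : Sph d, sphEval d p s ∂sphereMeasure d
  map_add' p q := by
    simp only [map_add, ContinuousMap.add_apply]
    exact integral_add ((continuous_memLp (sphEval d p).continuous).integrable (by norm_num))
      ((continuous_memLp (sphEval d q).continuous).integrable (by norm_num))
  map_smul' c p := by
    simp only [map_smul, ContinuousMap.smul_apply, integral_smul, RingHom.id_apply]

/-- `p` is an eigenvector of weight `m` for the rotations in the plane of the coordinates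
`i`, `j`. -/
def IsWeightVector {d : ℕ} (i j : Fin d) (m : ℤ) (p : MvPolynomial (Fin d) ℂ) : Prop :=
  (∀ θ R, IsPlaneRotation i j θ R → ∀ s : Sph d,
    sphEval d p (sphRot R s) = Complex.exp (m * (θ * Complex.I)) * sphEval d p s) ∧
  angularDerivation i j p = (m * Complex.I : ℂ) • p

section Weights

variable {d : ℕ} {i j : Fin d}

theorem IsWeightVector.mul {m n : ℤ} {p q : MvPolynomial (Fin d) ℂ} (hp : IsWeightVector i j m p)
    (hq : IsWeightVector i j n q) : IsWeightVector i j (m + n) (p * q) := by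
  refine ⟨fun θ R hR s => ?_, ?_⟩
  · rw [map_mul, ContinuousMap.mul_apply, ContinuousMap.mul_apply, hp.1 θ R hR, hq.1 θ R hR]
    push_cast
    rw [add_mul, Complex.exp_add]
    ring
  · rw [Derivation.leibniz, hp.2, hq.2]
    simp only [MvPolynomial.smul_eq_C_mul, smul_eq_mul]
    push_cast
    simp only [add_mul, map_add, map_mul]
    ring

theorem isWeightVector_C (c : ℂ) : IsWeightVector i j 0 (MvPolynomial.C c) := by
  refine ⟨fun θ R hR s => by simp, ?_⟩
  simp

theorem isWeightVector_X {k : Fin d} (hi : k ≠ i) (hj : k ≠ j) :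
    IsWeightVector i j 0 (MvPolynomial.X k) := by
  refine ⟨fun θ R hR s => ?_, ?_⟩
  · simp only [sphEval_apply, MvPolynomial.eval_X]
    change ((rot d R s k : ℝ) : ℂ) = _
    rw [(hR s).2.2 k hi hj]
    simp
  · simp [angularDerivation_apply, MvPolynomial.pderiv_X, hi, hj]

theorem isWeightVector_X_add (hij : i ≠ j) :
    IsWeightVector i j 1 (MvPolynomial.X i + MvPolynomial.C Complex.I * MvPolynomial.X j) := by
  refine ⟨fun θ R hR s => ?_, ?_⟩
  · rw [sphEval_apply, sphEval_apply]
    simp only [map_add, map_mul, MvPolynomial.eval_X, MvPolynomial.eval_C]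
    change ((rot d R s i : ℝ) : ℂ) + Complex.I * ((rot d R s j : ℝ) : ℂ) = _
    rw [(hR s).1, (hR s).2.1, Int.cast_one, one_mul, Complex.exp_mul_I]
    push_cast
    linear_combination (Complex.sin θ * ((s : Euc d) j : ℂ)) * (-Complex.I_sq)
  · simp only [angularDerivation_apply, map_add, Derivation.leibniz, MvPolynomial.pderiv_X,
      MvPolynomial.pderiv_C, Pi.single_apply, hij, hij.symm, if_true, if_false, smul_eq_mul,
      MvPolynomial.smul_eq_C_mul, map_mul]
    have : (MvPolynomial.C Complex.I : MvPolynomial (Fin d) ℂ) ^ 2 = -1 := by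
      rw [← map_pow, Complex.I_sq]; simp
    simp only [Int.cast_one, map_one]
    linear_combination (-MvPolynomial.X j) * this

theorem isWeightVector_X_sub (hij : i ≠ j) :
    IsWeightVector i j (-1) (MvPolynomial.X i - MvPolynomial.C Complex.I * MvPolynomial.X j) := by
  refine ⟨fun θ R hR s => ?_, ?_⟩
  · rw [sphEval_apply, sphEval_apply]
    simp only [map_sub, map_mul, MvPolynomial.eval_X, MvPolynomial.eval_C]
    change ((rot d R s i : ℝ) : ℂ) - Complex.I * ((rot d R s j : ℝ) : ℂ) = _
    rw [(hR s).1, (hR s).2.1, Int.cast_neg, Int.cast_one, neg_one_mul, ← neg_mul,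
      Complex.exp_mul_I, Complex.cos_neg, Complex.sin_neg]
    push_cast
    linear_combination (Complex.sin θ * ((s : Euc d) j : ℂ)) * (-Complex.I_sq)
  · simp only [angularDerivation_apply, map_sub, Derivation.leibniz, MvPolynomial.pderiv_X,
      MvPolynomial.pderiv_C, Pi.single_apply, hij, hij.symm, if_true, if_false, smul_eq_mul,
      MvPolynomial.smul_eq_C_mul, map_mul]
    have : (MvPolynomial.C Complex.I : MvPolynomial (Fin d) ℂ) ^ 2 = -1 := by
      rw [← map_pow, Complex.I_sq]; simp
    simp only [Int.cast_neg, Int.cast_one, map_neg, map_one]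
    linear_combination (-MvPolynomial.X j) * this

/-- The forms `x_i ± i x_j` have weights `±1`, the other coordinates have weight zero, and weights
add under multiplication. Every coordinate is a combination of these, so their products span all
polynomials. -/
theorem mem_span_isWeightVector (hij : i ≠ j) (p : MvPolynomial (Fin d) ℂ) :
    p ∈ Submodule.span ℂ {q | ∃ m, IsWeightVector i j m q} := by
  set W := Submodule.span ℂ {q | ∃ m, IsWeightVector i j m q} with hW
  have hmul : ∀ m (q : MvPolynomial (Fin d) ℂ), IsWeightVector i j m q → ∀ p ∈ W, p * q ∈ W := by
    intro m q hq p hp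
    induction hp using Submodule.span_induction with
    | mem p hp =>
      obtain ⟨n, hn⟩ := hp
      exact Submodule.subset_span ⟨n + m, hn.mul hq⟩
    | zero => rw [zero_mul]; exact W.zero_mem
    | add u v _ _ hu hv => rw [add_mul]; exact W.add_mem hu hv
    | smul c u _ hu => rw [smul_mul_assoc]; exact W.smul_mem c hu
  induction p using MvPolynomial.induction_on with
  | C c => exact Submodule.subset_span ⟨0, isWeightVector_C c⟩
  | add p q hp hq => exact W.add_mem hp hq
  | mul_X p k hp =>
    have h1 := hmul _ _ (isWeightVector_X_add hij) p hp
    have h2 := hmul _ _ (isWeightVector_X_sub hij) p hp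
    by_cases hi : k = i
    · subst hi
      have h2' : (MvPolynomial.C (1 / 2 : ℂ) : MvPolynomial (Fin d) ℂ) * 2 = 1 := by
        rw [show (2 : MvPolynomial (Fin d) ℂ) = MvPolynomial.C 2 from (map_ofNat _ 2).symm,
          ← map_mul]
        norm_num
      have : p * MvPolynomial.X k = (1 / 2 : ℂ) •
          (p * (MvPolynomial.X k + MvPolynomial.C Complex.I * MvPolynomial.X j) +
            p * (MvPolynomial.X k - MvPolynomial.C Complex.I * MvPolynomial.X j)) := by
        rw [MvPolynomial.smul_eq_C_mul]
        linear_combination (-p * MvPolynomial.X k) * h2'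
      rw [this]
      exact W.smul_mem _ (W.add_mem h1 h2)
    · by_cases hj : k = j
      · subst hj
        have h2' : (MvPolynomial.C (-Complex.I / 2 : ℂ) : MvPolynomial (Fin d) ℂ) *
            (2 * MvPolynomial.C Complex.I) = 1 := by
          rw [show (2 : MvPolynomial (Fin d) ℂ) = MvPolynomial.C 2 from (map_ofNat _ 2).symm,
            ← map_mul, ← map_mul, ← map_one MvPolynomial.C]
          congr 1
          linear_combination -Complex.I_sq
        have : p * MvPolynomial.X k = (-Complex.I / 2 : ℂ) •
            (p * (MvPolynomial.X i + MvPolynomial.C Complex.I * MvPolynomial.X k) -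
              p * (MvPolynomial.X i - MvPolynomial.C Complex.I * MvPolynomial.X k)) := by
          rw [MvPolynomial.smul_eq_C_mul]
          linear_combination (-p * MvPolynomial.X k) * h2'
        rw [this]
        exact W.smul_mem _ (W.sub_mem h1 h2)
      · exact hmul _ _ (isWeightVector_X hi hj) p hp

/-- The infinitesimal form of rotation invariance, obtained without differentiating under the
integral. On a vector of weight `m` the derivation is multiplication by `i m`; if `m ≠ 0`, rotation
by `π/m` changes the sign of the integral, which is therefore zero. -/
theorem sphIntegral_angularDerivation (i j : Fin d) (p : MvPolynomial (Fin d) ℂ) :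
    sphIntegral d (angularDerivation i j p) = 0 := by
  rcases eq_or_ne i j with rfl | hij
  · rw [angularDerivation_apply, sub_self, map_zero]
  induction mem_span_isWeightVector hij p using Submodule.span_induction with
  | mem p hp =>
    obtain ⟨m, hm⟩ := hp
    rw [hm.2, map_smul]
    rcases eq_or_ne m 0 with rfl | hm0
    · simp
    · obtain ⟨R, hR⟩ := exists_isPlaneRotation hij (Real.pi / m)
      have h := integral_comp_sphRot R (sphEval d p).continuous
      have hm0' : (m : ℂ) ≠ 0 := by exact_mod_cast hm0
      have hexp : Complex.exp (m * (((Real.pi / m : ℝ) : ℂ) * Complex.I)) = -1 := by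
        rw [← Complex.exp_pi_mul_I]
        congr 1
        push_cast
        field_simp
      simp only [hm.1 _ R hR, hexp, neg_mul, one_mul, integral_neg] at h
      have h0 : sphIntegral d p = 0 := self_eq_neg.1 h.symm
      rw [h0, smul_zero]
  | zero => rw [map_zero, map_zero]
  | add u v _ _ hu hv => rw [map_add, map_add, hu, hv, add_zero]
  | smul c u _ hu => rw [Derivation.map_smul, map_smul, hu, smul_zero]

theorem sphIntegral_angularDerivation_mul (i j : Fin d) (p q : MvPolynomial (Fin d) ℂ) :
    sphIntegral d (angularDerivation i j p * q) = -sphIntegral d (p * angularDerivation i j q) := by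
  have h := sphIntegral_angularDerivation i j (p * q)
  rw [Derivation.leibniz, map_add, smul_eq_mul, smul_eq_mul, mul_comm q] at h
  exact eq_neg_of_add_eq_zero_right h

end Weights

open MvPolynomial in
-- The Casimir operator is `2 (|x|² Δ - E² - (d-2) E)` with `E` the Euler operator, which acts as
-- `k` in degree `k`. The factor 2 appears because the sum over ordered pairs counts each plane
-- twice.
theorem sum_angularDerivation_sq {d k : ℕ} {p : MvPolynomial (Fin d) ℂ}
    (hp : p ∈ harmonicPolynomials d k) :
    ∑ i, ∑ j, angularDerivation i j (angularDerivation i j p) =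
      (-2 * (k * (k + d - 2)) : ℂ) • p := by
  have hE : ∑ i, X i * pderiv i p = (k : MvPolynomial (Fin d) ℂ) * p := by
    rw [((mem_homogeneousSubmodule _ _).1 hp.1).sum_X_mul_pderiv, nsmul_eq_mul]
  have hΔ : ∑ j, pderiv j (pderiv j p) = 0 := by
    rw [← laplacian_apply]
    exact hp.2
  have hL : ∀ i j, angularDerivation i j (angularDerivation i j p) =
      (X i * pderiv j (X i * pderiv j p) - X i * pderiv j (X j * pderiv i p)) +
      (X j * pderiv i (X j * pderiv i p) - X j * pderiv i (X i * pderiv j p)) := fun i j => by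
    simp only [angularDerivation_apply, map_sub]
    ring
  have hF : ∀ i j : Fin d, X i * pderiv j (X i * pderiv j p) =
      (if i = j then 1 else 0) * (X j * pderiv j p) + X i * X i * pderiv j (pderiv j p) :=
    fun i j => by
      rw [Derivation.leibniz, pderiv_X, Pi.single_apply, smul_eq_mul, smul_eq_mul]
      split_ifs with h
      · subst h; ring
      · ring
  -- The mixed term is reordered into `(x_j ∂_j)(x_i ∂_i)` plus first-order corrections, so that the
  -- double sum is the square of the Euler operator plus multiples of it.
  have hG : ∀ i j : Fin d, X i * pderiv j (X j * pderiv i p) =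
      X i * pderiv i p + X j * pderiv j (X i * pderiv i p) -
        (if i = j then 1 else 0) * (X j * pderiv j p) := fun i j => by
    rw [Derivation.leibniz, Derivation.leibniz, pderiv_X, pderiv_X, Pi.single_apply,
      Pi.single_apply]
    simp only [smul_eq_mul, if_true]
    split_ifs with h
    · subst h; ring
    · ring
  have hsF : ∑ i : Fin d, ∑ j : Fin d, X i * pderiv j (X i * pderiv j p) =
      (k : MvPolynomial (Fin d) ℂ) * p := by
    simp only [hF, Finset.sum_add_distrib, ← Finset.mul_sum, hΔ, mul_zero,
      add_zero]
    simp only [ite_mul, one_mul, zero_mul, Finset.sum_ite_eq, Finset.mem_univ, if_true, hE]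
  have hsG : ∑ i : Fin d, ∑ j : Fin d, X i * pderiv j (X j * pderiv i p) =
      (d * k + k * k - k : MvPolynomial (Fin d) ℂ) * p := by
    have hk : ∀ j : Fin d, pderiv j ((k : MvPolynomial (Fin d) ℂ) * p) = k * pderiv j p :=
      fun j => by rw [← nsmul_eq_mul, map_nsmul, nsmul_eq_mul]
    have h1 : ∑ i : Fin d, ∑ _j : Fin d, X i * pderiv i p = (d * (k * p) : MvPolynomial (Fin d) ℂ) := by
      simp only [Finset.sum_const, Finset.card_univ, Fintype.card_fin]
      rw [← Finset.smul_sum, hE, nsmul_eq_mul]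
    have h2 : ∑ i : Fin d, ∑ j : Fin d, X j * pderiv j (X i * pderiv i p) =
        (k * (k * p) : MvPolynomial (Fin d) ℂ) := by
      rw [Finset.sum_comm]
      simp only [← Finset.mul_sum, ← map_sum, hE, hk, mul_left_comm _ (k : MvPolynomial (Fin d) ℂ)]
    have h3 : ∑ i : Fin d, ∑ j : Fin d, (if i = j then 1 else 0) * (X j * pderiv j p) =
        (k * p : MvPolynomial (Fin d) ℂ) := by
      simp only [ite_mul, one_mul, zero_mul, Finset.sum_ite_eq, Finset.mem_univ, if_true, hE]
    simp only [hG, Finset.sum_sub_distrib, Finset.sum_add_distrib, h1, h2, h3]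
    ring
  have hsF' : ∑ i : Fin d, ∑ j : Fin d, X j * pderiv i (X j * pderiv i p) =
      (k : MvPolynomial (Fin d) ℂ) * p := by rw [Finset.sum_comm]; exact hsF
  have hsG' : ∑ i : Fin d, ∑ j : Fin d, X j * pderiv i (X i * pderiv j p) =
      (d * k + k * k - k : MvPolynomial (Fin d) ℂ) * p := by rw [Finset.sum_comm]; exact hsG
  simp only [hL, Finset.sum_add_distrib, Finset.sum_sub_distrib, hsF, hsG, hsF', hsG']
  rw [smul_eq_C_mul]
  simp only [map_mul, map_add, map_sub, map_neg, map_natCast, map_ofNat]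
  ring

/-- The Casimir operator is symmetric for the sphere integral by two integrations by parts, and its
eigenvalues on the two factors differ because `k (k + d - 2)` is injective in `k` when `d ≥ 2`. -/
theorem sphIntegral_mul_eq_zero {d k l : ℕ} (hd : 2 ≤ d) (hkl : k ≠ l)
    {p q : MvPolynomial (Fin d) ℂ} (hp : p ∈ harmonicPolynomials d k)
    (hq : q ∈ harmonicPolynomials d l) : sphIntegral d (p * q) = 0 := by
  have h : sphIntegral d ((∑ i, ∑ j, angularDerivation i j (angularDerivation i j p)) * q) =
      sphIntegral d (p * ∑ i, ∑ j, angularDerivation i j (angularDerivation i j q)) := by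
    simp only [Finset.sum_mul, Finset.mul_sum, map_sum]
    refine Finset.sum_congr rfl fun i _ => Finset.sum_congr rfl fun j _ => ?_
    rw [sphIntegral_angularDerivation_mul, sphIntegral_angularDerivation_mul, neg_neg]
  rw [sum_angularDerivation_sq hp, sum_angularDerivation_sq hq, smul_mul_assoc, mul_smul_comm,
    map_smul, map_smul, smul_eq_mul, smul_eq_mul, ← sub_eq_zero, ← sub_mul, mul_eq_zero] at h
  refine h.resolve_left fun h0 => hkl ?_
  obtain ⟨e, rfl⟩ := Nat.exists_eq_add_of_le hd
  have h1 : (k * (k + e) : ℂ) = l * (l + e) := by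
    push_cast at h0
    linear_combination (-1 / 2) * h0
  have h2 : k * (k + e) = l * (l + e) := by exact_mod_cast h1
  rcases lt_trichotomy k l with hlt | heq | hlt
  · nlinarith
  · exact heq
  · nlinarith

/-! ### Spherical harmonics -/

theorem polyToSphere_eq_iff {d : ℕ} {p q : MvPolynomial (Fin d) ℂ} :
    polyToSphere d p = polyToSphere d q ↔ ∀ s, sphEval d p s = sphEval d q s := by
  rw [← sphToLp_sphEval, ← sphToLp_sphEval,
    (ContinuousMap.toLp_injective (p := 2) (𝕜 := ℂ) (sphereMeasure d)).eq_iff, ContinuousMap.ext_iff]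

theorem eval_mul_of_isHomogeneous {σ R : Type*} [Fintype σ] [CommSemiring R] {m : ℕ}
    {p : MvPolynomial σ R} (hp : p.IsHomogeneous m) (c : R) (x : σ → R) :
    MvPolynomial.eval (fun i => c * x i) p = c ^ m * MvPolynomial.eval x p := by
  rw [MvPolynomial.eval_eq', MvPolynomial.eval_eq', Finset.mul_sum]
  refine Finset.sum_congr rfl fun e he => ?_
  have hdeg : ∑ i, e i = m := by
    have := hp.degree_eq_sum_deg_support he
    rw [this]
    exact (Finset.sum_subset (Finset.subset_univ _) fun i _ hi => by simpa using hi).symm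
  simp only [mul_pow, Finset.prod_mul_distrib, Finset.prod_pow_eq_pow_sum, hdeg]
  ring

/-- Homogeneity propagates the vanishing from the sphere to its rays, and a polynomial vanishing on
a product of infinite sets is zero. -/
theorem eq_zero_of_polyToSphere_eq_zero {d m : ℕ} (hd : 1 ≤ d) {p : MvPolynomial (Fin d) ℂ}
    (hp : p.IsHomogeneous m) (h : polyToSphere d p = 0) : p = 0 := by
  have h0 : ∀ s, sphEval d p s = 0 := fun s => by
    have := polyToSphere_eq_iff.1 (h.trans (map_zero (polyToSphere d)).symm) s
    simpa using this
  -- Points with positive real coordinates suffice, and they can all be normalized, being nonzero.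
  refine MvPolynomial.funext_set (fun _ => (fun r : ℝ => (r : ℂ)) '' Set.Ioi 0)
    (fun _ => (Set.Ioi_infinite 0).image Complex.ofReal_injective.injOn) fun x hx => ?_
  have hx' : ∀ i, ∃ r : ℝ, 0 < r ∧ (r : ℂ) = x i := fun i => by
    obtain ⟨r, hr, hr'⟩ := hx i (Set.mem_univ i)
    exact ⟨r, hr, hr'⟩
  choose y hy hyx using hx'
  have hY : WithLp.toLp 2 y ≠ (0 : Euc d) := fun h => by
    have h1 := congrArg (fun v : Euc d => v ⟨0, hd⟩) h
    exact (hy ⟨0, hd⟩).ne' h1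
  set r := ‖(WithLp.toLp 2 y : Euc d)‖ with hr
  have hr0 : r ≠ 0 := norm_ne_zero_iff.2 hY
  let s : Sph d := ⟨r⁻¹ • (WithLp.toLp 2 y : Euc d), by
    rw [mem_sphere_zero_iff_norm, norm_smul, norm_inv, Real.norm_eq_abs, abs_norm]
    exact inv_mul_cancel₀ hr0⟩
  have hxs : x = fun i => (r : ℂ) * (((s : Euc d) i : ℝ) : ℂ) := by
    ext1 i
    rw [← hyx, ← Complex.ofReal_mul]
    congr 1
    change y i = r * (r⁻¹ * y i)
    rw [mul_inv_cancel_left₀ hr0]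
  rw [hxs, eval_mul_of_isHomogeneous hp, ← sphEval_apply, h0, mul_zero, map_zero]

theorem map_conj_mem_harmonicPolynomials {d k : ℕ} {p : MvPolynomial (Fin d) ℂ}
    (hp : p ∈ harmonicPolynomials d k) :
    MvPolynomial.map (starRingEnd ℂ) p ∈ harmonicPolynomials d k := by
  refine ⟨(MvPolynomial.mem_homogeneousSubmodule _ _).2
    (((MvPolynomial.mem_homogeneousSubmodule _ _).1 hp.1).map _), ?_⟩
  have h : laplacian d p = 0 := hp.2
  change laplacian d _ = 0
  rw [laplacian_apply] at h ⊢
  simp only [MvPolynomial.pderiv_map, ← map_sum, h, map_zero]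

theorem inner_sphericalHarmonics {d k l : ℕ} (hd : 2 ≤ d) (hkl : k ≠ l) {φ ψ : L2Sph d}
    (hφ : φ ∈ (sphericalHarmonics d k).carrier) (hψ : ψ ∈ (sphericalHarmonics d l).carrier) :
    (inner ℂ φ ψ : ℂ) = 0 := by
  obtain ⟨p, hp, rfl⟩ := hφ
  obtain ⟨q, hq, rfl⟩ := hψ
  rw [← sphToLp_sphEval, ← sphToLp_sphEval, inner_sphToLp,
    ← sphIntegral_mul_eq_zero hd hkl (map_conj_mem_harmonicPolynomials hp) hq]
  refine integral_congr_ae (Filter.Eventually.of_forall fun s => ?_)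
  beta_reduce
  rw [map_mul, ContinuousMap.mul_apply, ← star_sphEval, ContinuousMap.star_apply]

/-! ### Completeness of the spherical harmonics -/

/-- The span of the spherical harmonics of degree at most `n`. -/
def harmonicsUpTo (d n : ℕ) : Submodule ℂ (L2Sph d) :=
  ⨆ (j) (_ : j ≤ n), (sphericalHarmonics d j).carrier

theorem sphericalHarmonics_le_harmonicsUpTo {d j n : ℕ} (h : j ≤ n) :
    (sphericalHarmonics d j).carrier ≤ harmonicsUpTo d n :=
  le_iSup₂_of_le j h le_rfl

theorem inner_harmonicsUpTo {d n k : ℕ} (hd : 2 ≤ d) (hn : n < k) {φ ψ : L2Sph d}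
    (hφ : φ ∈ harmonicsUpTo d n) (hψ : ψ ∈ (sphericalHarmonics d k).carrier) :
    (inner ℂ φ ψ : ℂ) = 0 := by
  have h : harmonicsUpTo d n ≤ (sphericalHarmonics d k).carrierᗮ :=
    iSup₂_le fun j hj χ hχ => (Submodule.mem_orthogonal' _ _).2 fun ψ hψ =>
      inner_sphericalHarmonics hd (hj.trans_lt hn).ne hχ hψ
  exact (Submodule.mem_orthogonal' _ _).1 (h hφ) ψ hψ

/-- The polynomial `∑ᵢ xᵢ²`. -/
def normSqPoly (d : ℕ) : MvPolynomial (Fin d) ℂ := ∑ i, MvPolynomial.X i ^ 2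

theorem isHomogeneous_normSqPoly (d : ℕ) : (normSqPoly d).IsHomogeneous 2 :=
  MvPolynomial.IsHomogeneous.sum _ _ _ fun i _ => MvPolynomial.isHomogeneous_X_pow i 2

theorem polyToSphere_normSqPoly_mul {d : ℕ} (p : MvPolynomial (Fin d) ℂ) :
    polyToSphere d (normSqPoly d * p) = polyToSphere d p := by
  refine polyToSphere_eq_iff.2 fun s => ?_
  have hs : ‖(s : Euc d)‖ ^ 2 = 1 := by simp
  rw [EuclideanSpace.norm_sq_eq] at hs
  have h : sphEval d (normSqPoly d) s = 1 := by
    rw [sphEval_apply, normSqPoly, map_sum]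
    simp only [map_pow, MvPolynomial.eval_X]
    simp only [Real.norm_eq_abs, sq_abs] at hs
    exact_mod_cast hs
  rw [map_mul, ContinuousMap.mul_apply, h, one_mul]

theorem isHomogeneous_laplacian {d m : ℕ} {p : MvPolynomial (Fin d) ℂ}
    (hp : p.IsHomogeneous (m + 2)) : (laplacian d p).IsHomogeneous m := by
  rw [laplacian_apply]
  exact MvPolynomial.IsHomogeneous.sum _ _ _ fun i _ => hp.pderiv.pderiv

theorem laplacian_eq_zero_of_isHomogeneous {d m : ℕ} (hm : m < 2) {p : MvPolynomial (Fin d) ℂ}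
    (hp : p.IsHomogeneous m) : laplacian d p = 0 := by
  rw [laplacian_apply]
  refine Finset.sum_eq_zero fun i _ => ?_
  have h : (MvPolynomial.pderiv i p).IsHomogeneous 0 := by
    have := hp.pderiv (i := i)
    rwa [show m - 1 = 0 by omega] at this
  rw [← MvPolynomial.totalDegree_zero_iff_isHomogeneous,
    MvPolynomial.totalDegree_eq_zero_iff_eq_C] at h
  rw [h, MvPolynomial.pderiv_C]

/-- The map `q ↦ Δ(|x|² q)` acts on a finite-dimensional space, so injectivity suffices. If `|x|² q`
is harmonic, then `q` restricts to a harmonic of degree `m + 2`, while by `hm` it restricts to a sum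
of harmonics of degree at most `m`; these are orthogonal, so `q = 0`. -/
theorem exists_laplacian_normSqPoly_mul {d m : ℕ} (hd : 2 ≤ d)
    (hm : ∀ q : MvPolynomial (Fin d) ℂ, q.IsHomogeneous m → polyToSphere d q ∈ harmonicsUpTo d m)
    {p : MvPolynomial (Fin d) ℂ} (hp : p.IsHomogeneous m) :
    ∃ q : MvPolynomial (Fin d) ℂ, q.IsHomogeneous m ∧ laplacian d (normSqPoly d * q) = p := by
  have hhom : ∀ q : MvPolynomial (Fin d) ℂ, q.IsHomogeneous m →
      (normSqPoly d * q).IsHomogeneous (m + 2) := fun q hq => by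
    rw [add_comm]; exact (isHomogeneous_normSqPoly d).mul hq
  let V := MvPolynomial.homogeneousSubmodule (Fin d) ℂ m
  have : FiniteDimensional ℂ V :=
    Module.Finite.iff_fg.2 (MvPolynomial.homogeneousSubmodule_fg _ _ _)
  let T : V →ₗ[ℂ] V := (laplacian d ∘ₗ LinearMap.mulLeft ℂ (normSqPoly d)).restrict
    fun q hq => isHomogeneous_laplacian (hhom q hq)
  have hinj : Function.Injective T := by
    rw [← LinearMap.ker_eq_bot, LinearMap.ker_eq_bot']
    intro q hq
    have h0 : laplacian d (normSqPoly d * (q : MvPolynomial (Fin d) ℂ)) = 0 :=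
      congrArg Subtype.val hq
    have hmem : polyToSphere d (q : MvPolynomial (Fin d) ℂ) ∈
        (sphericalHarmonics d (m + 2)).carrier :=
      ⟨_, ⟨hhom _ q.2, h0⟩, polyToSphere_normSqPoly_mul _⟩
    have h1 := inner_harmonicsUpTo hd (by omega) (hm _ q.2) hmem
    exact Subtype.ext (eq_zero_of_polyToSphere_eq_zero (by omega) q.2 (inner_self_eq_zero.1 h1))
  obtain ⟨q, hq⟩ := LinearMap.surjective_of_injective hinj ⟨p, hp⟩
  exact ⟨q, q.2, congrArg Subtype.val hq⟩

/-- Choosing `q` of degree `m - 2` with `Δ(|x|² q) = Δp` makes `p - |x|² q` harmonic, and on the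
sphere `|x|² q` equals `q`, which the induction covers. -/
theorem polyToSphere_mem_harmonicsUpTo {d : ℕ} (hd : 2 ≤ d) (m : ℕ) :
    ∀ p : MvPolynomial (Fin d) ℂ, p.IsHomogeneous m → polyToSphere d p ∈ harmonicsUpTo d m := by
  induction m using Nat.strong_induction_on with
  | _ m ih =>
    intro p hp
    by_cases hm : m < 2
    · exact sphericalHarmonics_le_harmonicsUpTo le_rfl
        ⟨p, ⟨hp, laplacian_eq_zero_of_isHomogeneous hm hp⟩, rfl⟩
    · obtain ⟨e, rfl⟩ := Nat.exists_eq_add_of_le' (not_lt.1 hm)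
      obtain ⟨q, hq, hq'⟩ := exists_laplacian_normSqPoly_mul hd (ih e (by omega))
        (isHomogeneous_laplacian hp)
      have h1 : polyToSphere d (p - normSqPoly d * q) ∈ harmonicsUpTo d (e + 2) := by
        refine sphericalHarmonics_le_harmonicsUpTo le_rfl ⟨_, ⟨hp.sub ?_, ?_⟩, rfl⟩
        · rw [add_comm]; exact (isHomogeneous_normSqPoly d).mul hq
        · exact LinearMap.mem_ker.2 (by rw [map_sub, hq', sub_self])
      have h2 : harmonicsUpTo d e ≤ harmonicsUpTo d (e + 2) :=
        iSup₂_le fun j hj => sphericalHarmonics_le_harmonicsUpTo (by omega)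
      have h3 := Submodule.add_mem _ h1 (h2 (ih e (by omega) q hq))
      rwa [← polyToSphere_normSqPoly_mul q, ← map_add, sub_add_cancel] at h3

theorem sphericalHarmonics_total {d : ℕ} (hd : 2 ≤ d) {F : L2Sph d}
    (hF : ∀ k, ∀ φ ∈ (sphericalHarmonics d k).carrier, (inner ℂ φ F : ℂ) = 0) : F = 0 := by
  refine eq_zero_of_inner_polyToSphere fun p => ?_
  rw [← MvPolynomial.sum_homogeneousComponent p, map_sum, sum_inner]
  refine Finset.sum_eq_zero fun m _ => ?_
  have h : harmonicsUpTo d m ≤ (ℂ ∙ F)ᗮ :=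
    iSup₂_le fun j _ χ hχ => Submodule.mem_orthogonal_singleton_iff_inner_left.2 (hF j χ hχ)
  exact Submodule.mem_orthogonal_singleton_iff_inner_left.1
    (h (polyToSphere_mem_harmonicsUpTo hd m _ (MvPolynomial.homogeneousComponent_isHomogeneous m p)))

/-! ### Nonvanishing and uniqueness of zonal harmonics -/

/-- The `a`-th coordinate vector, as a point of the sphere. -/
def coordPoint {d : ℕ} (a : Fin d) : Sph d := ⟨EuclideanSpace.single a 1, by simp⟩

open MvPolynomial in
-- The power `(x_a + i x_b)^k` is harmonic because the gradient `(1, i)` of the linear form is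
-- isotropic, and it equals one at the point `e_a`.
theorem sphericalHarmonics_ne_bot {d : ℕ} (hd : 2 ≤ d) (k : ℕ) :
    (sphericalHarmonics d k).carrier ≠ ⊥ := by
  let a : Fin d := ⟨0, by omega⟩
  let b : Fin d := ⟨1, by omega⟩
  have hab : a ≠ b := fun h => by simp [a, b] at h
  let u : MvPolynomial (Fin d) ℂ := X a + C Complex.I * X b
  have hC : (C Complex.I : MvPolynomial (Fin d) ℂ) ^ 2 = -1 := by
    rw [← map_pow, Complex.I_sq]; simp
  have hu : u.IsHomogeneous 1 := (isHomogeneous_X ℂ a).add (isHomogeneous_C_mul_X _ b)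
  have hdu : ∀ j, pderiv j u = C (if j = a then 1 else if j = b then Complex.I else 0) := by
    intro j
    simp only [u, map_add, Derivation.leibniz, pderiv_X, pderiv_C, smul_eq_mul, Pi.single_apply]
    rcases eq_or_ne j a with rfl | hja
    · simp [hab.symm]
    · rcases eq_or_ne j b with rfl | hjb
      · simp [hja, hja.symm]
      · simp [hja, hjb, hja.symm, hjb.symm]
  have hsum : ∑ j, pderiv j u * pderiv j u = 0 := by
    rw [Finset.sum_eq_add a b hab]
    · rw [hdu, hdu, if_pos rfl, if_neg hab.symm, if_pos rfl, map_one]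
      linear_combination hC
    · intro j _ hj
      rw [hdu, if_neg hj.1, if_neg hj.2, map_zero, zero_mul]
    · simp
    · simp
  have hlap : laplacian d (u ^ k) = 0 := by
    rw [laplacian_apply]
    have h : ∀ j, pderiv j (pderiv j (u ^ k)) =
        (k * (k - 1 : ℕ) * u ^ (k - 1 - 1)) * (pderiv j u * pderiv j u) := fun j => by
      have h2 : pderiv j (pderiv j u) = 0 := by rw [hdu, pderiv_C]
      rw [Derivation.leibniz_pow, map_nsmul, smul_eq_mul, Derivation.leibniz,
        Derivation.leibniz_pow, h2]
      simp only [smul_eq_mul, nsmul_eq_mul]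
      ring
    simp only [h, ← Finset.mul_sum, hsum, mul_zero]
  have hmem : polyToSphere d (u ^ k) ∈ (sphericalHarmonics d k).carrier :=
    ⟨_, ⟨by simpa using hu.pow k, hlap⟩, rfl⟩
  intro hbot
  rw [hbot, Submodule.mem_bot] at hmem
  have h := polyToSphere_eq_iff.1 (hmem.trans (map_zero (polyToSphere d)).symm) (coordPoint a)
  rw [sphEval_apply] at h
  simp [u, coordPoint, hab.symm] at h

/-- Reduction modulo `u² = 1 - t²`. Multiplication by `u` sends `(g₁, g₂)` to `((1 - t²) g₂, g₁)`,
so the strict degree bound on `g₂` is what keeps the bound on `g₁` in the induction. -/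
theorem exists_eval_plane {d : ℕ} {a b : Fin d} (hab : a ≠ b) (p : MvPolynomial (Fin d) ℂ) :
    ∃ g₁ g₂ : Polynomial ℂ, (∀ m, p.totalDegree < m → g₁.coeff m = 0) ∧
      (∀ m, p.totalDegree ≤ m → g₂.coeff m = 0) ∧ ∀ t u : ℂ, u ^ 2 = 1 - t ^ 2 →
        MvPolynomial.eval (fun j => if j = a then t else if j = b then u else 0) p =
          g₁.eval t + u * g₂.eval t := by
  have key : ∀ (e : Fin d →₀ ℕ) (c : ℂ), ∀ N, (MvPolynomial.monomial e c).totalDegree ≤ N →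
      ∃ g₁ g₂ : Polynomial ℂ, (∀ m, N < m → g₁.coeff m = 0) ∧
      (∀ m, N ≤ m → g₂.coeff m = 0) ∧ ∀ t u : ℂ, u ^ 2 = 1 - t ^ 2 →
        MvPolynomial.eval (fun j => if j = a then t else if j = b then u else 0)
          (MvPolynomial.monomial e c) = g₁.eval t + u * g₂.eval t := by
    refine MvPolynomial.induction_on_monomial (motive := fun q => ∀ N, q.totalDegree ≤ N →
      ∃ g₁ g₂ : Polynomial ℂ, (∀ m, N < m → g₁.coeff m = 0) ∧
      (∀ m, N ≤ m → g₂.coeff m = 0) ∧ ∀ t u : ℂ, u ^ 2 = 1 - t ^ 2 →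
        MvPolynomial.eval (fun j => if j = a then t else if j = b then u else 0) q =
          g₁.eval t + u * g₂.eval t) (fun c N _ => ?_) fun p j hp N hN => ?_
    · exact ⟨Polynomial.C c, 0, fun m hm => Polynomial.coeff_C_of_ne_zero (by omega),
        fun m _ => by simp, fun t u _ => by simp⟩
    · rcases eq_or_ne p 0 with rfl | hp0
      · exact ⟨0, 0, by simp, by simp, by simp⟩
      rw [MvPolynomial.totalDegree_mul_of_isDomain hp0 (MvPolynomial.X_ne_zero j),
        MvPolynomial.totalDegree_X] at hN
      obtain ⟨M, rfl⟩ := Nat.exists_eq_add_of_le' (le_trans (by omega) hN : 1 ≤ N)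
      obtain ⟨g₁, g₂, h1, h2, h3⟩ := hp M (by omega)
      rcases eq_or_ne j a with rfl | hja
      · refine ⟨Polynomial.X * g₁, Polynomial.X * g₂, fun m hm => ?_, fun m hm => ?_,
          fun t u htu => ?_⟩
        · obtain ⟨m, rfl⟩ := Nat.exists_eq_add_of_le' (by omega : 1 ≤ m)
          rw [Polynomial.coeff_X_mul, h1 m (by omega)]
        · obtain ⟨m, rfl⟩ := Nat.exists_eq_add_of_le' (by omega : 1 ≤ m)
          rw [Polynomial.coeff_X_mul, h2 m (by omega)]
        · rw [map_mul, h3 t u htu]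
          simp
          ring
      · rcases eq_or_ne j b with rfl | hjb
        · refine ⟨g₂ - Polynomial.X ^ 2 * g₂, g₁, fun m hm => ?_, fun m hm => ?_,
            fun t u htu => ?_⟩
          · obtain ⟨m, rfl⟩ := Nat.exists_eq_add_of_le' (by omega : 2 ≤ m)
            rw [Polynomial.coeff_sub, Polynomial.coeff_X_pow_mul, h2 m (by omega),
              h2 (m + 2) (by omega), sub_zero]
          · exact h1 m (by omega)
          · rw [map_mul, h3 t u htu]
            simp [hja]
            linear_combination (g₂.eval t) * htu
        · exact ⟨0, 0, by simp, by simp, fun t u _ => by simp [hja, hjb]⟩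
  choose! G₁ G₂ hG₁ hG₂ hG using key
  refine ⟨∑ e ∈ p.support, G₁ e (p.coeff e) p.totalDegree,
    ∑ e ∈ p.support, G₂ e (p.coeff e) p.totalDegree, fun m hm => ?_, fun m hm => ?_,
    fun t u htu => ?_⟩
  all_goals
    have hdeg : ∀ e ∈ p.support,
        (MvPolynomial.monomial e (p.coeff e)).totalDegree ≤ p.totalDegree := fun e he =>
      (MvPolynomial.totalDegree_monomial_le _ _).trans (MvPolynomial.le_totalDegree he)
  · rw [Polynomial.finsetSum_coeff]
    exact Finset.sum_eq_zero fun e he => hG₁ e _ _ (hdeg e he) m hm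
  · rw [Polynomial.finsetSum_coeff]
    exact Finset.sum_eq_zero fun e he => hG₂ e _ _ (hdeg e he) m hm
  · conv_lhs => rw [← MvPolynomial.support_sum_monomial_coeff p]
    rw [map_sum, Polynomial.eval_finsetSum, Polynomial.eval_finsetSum, Finset.mul_sum,
      ← Finset.sum_add_distrib]
    exact Finset.sum_congr rfl fun e he => hG e _ _ (hdeg e he) t u htu

/-- A polynomial function on the sphere, invariant under the rotations about a coordinate axis, is
a polynomial in the corresponding coordinate. -/
theorem exists_polynomial_of_invariant {d : ℕ} (hd : 3 ≤ d) (a : Fin d) {p : MvPolynomial (Fin d) ℂ}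
    (hp : ∀ R, sphRot R (coordPoint a) = coordPoint a → ∀ s, sphEval d p (sphRot R s) = sphEval d p s) :
    ∃ g : Polynomial ℂ, (∀ m, p.totalDegree < m → g.coeff m = 0) ∧
      ∀ s : Sph d, sphEval d p s = g.eval (((s : Euc d) a : ℝ) : ℂ) := by
  obtain ⟨b, hab⟩ : ∃ b : Fin d, a ≠ b := by
    have : Nontrivial (Fin d) := Fin.nontrivial_iff_two_le.2 (by omega)
    obtain ⟨b, hb⟩ := exists_ne a
    exact ⟨b, hb.symm⟩
  obtain ⟨g₁, g₂, h1, -, h3⟩ := exists_eval_plane hab p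
  refine ⟨g₁, h1, fun s => ?_⟩
  set t := (s : Euc d) a with ht
  have ht1 : t ^ 2 ≤ 1 := by
    have h := PiLp.norm_apply_le (s : Euc d) a
    rw [norm_eq_of_mem_sphere s] at h
    exact (sq_le_one_iff_abs_le_one t).2 h
  -- The point `t e_a + u e_b` of the sphere has the same `a`-th coordinate as `s`, hence lies in
  -- the orbit of `s` under the stabilizer of the axis. Both signs of `u` are allowed, and averaging
  -- them removes `g₂`.
  have key : ∀ u : ℝ, u ^ 2 = 1 - t ^ 2 → sphEval d p s = g₁.eval (t : ℂ) + u * g₂.eval (t : ℂ) := by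
    intro u hu
    have hx : ‖(EuclideanSpace.single a t + EuclideanSpace.single b u : Euc d)‖ = 1 := by
      refine (pow_eq_one_iff_of_nonneg (norm_nonneg _) two_ne_zero).1 ?_
      rw [← real_inner_self_eq_norm_sq]
      simp only [inner_add_left, inner_add_right, EuclideanSpace.inner_single_left]
      simp [hab, hab.symm]
      linear_combination hu
    let x : Sph d := ⟨EuclideanSpace.single a t + EuclideanSpace.single b u, by simpa using hx⟩
    obtain ⟨R, hR, hRn⟩ := exists_sphRot_eq_of_inner_eq hd (coordPoint a) s x (by
      simp [x, coordPoint, EuclideanSpace.inner_single_right, hab, ht])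
    rw [← hp R hRn, hR, sphEval_apply, ← h3 t u (by exact_mod_cast hu)]
    congr 2
    ext1 j
    rcases eq_or_ne j a with rfl | hja
    · simp [x, hab]
    · rcases eq_or_ne j b with rfl | hjb
      · simp [x, hja]
      · simp [x, hja, hjb]
  have hsq : √(1 - t ^ 2) ^ 2 = 1 - t ^ 2 := Real.sq_sqrt (by linarith)
  have k1 := key _ hsq
  have k2 := key (-√(1 - t ^ 2)) (by rw [neg_sq, hsq])
  push_cast at k1 k2
  linear_combination (1 / 2) * k1 + (1 / 2) * k2

theorem sphereRep_polyToSphere {d : ℕ} (R : SO d) (p : MvPolynomial (Fin d) ℂ) :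
    sphereRep d R (polyToSphere d p) = polyToSphere d (polyRot R⁻¹ p) := by
  ext1
  filter_upwards [sphereRep_ae_of_ae R (polyToSphere_ae p), polyToSphere_ae (polyRot R⁻¹ p)]
    with s h1 h2
  rw [h1, h2, eval_polyRot]
  rfl

theorem sphEval_sphRot_of_invariant {d : ℕ} {n : Sph d} {p : MvPolynomial (Fin d) ℂ}
    (hp : ∀ R, sphRot R n = n → sphereRep d R (polyToSphere d p) = polyToSphere d p) (R : SO d)
    (hR : sphRot R n = n) (s : Sph d) : sphEval d p (sphRot R s) = sphEval d p s := by
  have hR' : sphRot R⁻¹ n = n := by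
    conv_lhs => rw [← hR]
    rw [← sphRot_mul, inv_mul_cancel, sphRot_one]
  have h := hp R⁻¹ hR'
  rw [sphereRep_polyToSphere, inv_inv] at h
  rw [← polyToSphere_eq_iff.1 h s, sphEval_apply, sphEval_apply, eval_polyRot]
  rfl

/-- A polynomial in the `a`-th coordinate, as a function on the sphere. -/
def axisPoly (d : ℕ) (a : Fin d) : Polynomial ℂ →ₗ[ℂ] L2Sph d :=
  polyToSphere d ∘ₗ (Polynomial.aeval (MvPolynomial.X a)).toLinearMap

theorem axisPoly_eq_polyToSphere {d : ℕ} {a : Fin d} {g : Polynomial ℂ}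
    {p : MvPolynomial (Fin d) ℂ}
    (h : ∀ s : Sph d, sphEval d p s = g.eval (((s : Euc d) a : ℝ) : ℂ)) :
    axisPoly d a g = polyToSphere d p := by
  refine polyToSphere_eq_iff.2 fun s => ?_
  rw [h, AlgHom.toLinearMap_apply, sphEval_apply, ← MvPolynomial.coe_aeval_eq_eval]
  change (MvPolynomial.aeval _) _ = _
  rw [← Polynomial.aeval_algHom_apply, MvPolynomial.aeval_X, Polynomial.aeval_def,
    Polynomial.eval₂_eq_eval_map]
  simp

/-- Powers of the coordinate of degree below `k` restrict to sums of harmonics of degree below `k`.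
-/
theorem inner_axisPoly {d k : ℕ} (hd : 2 ≤ d) (a : Fin d) {g : Polynomial ℂ}
    (hg : ∀ m, k ≤ m → g.coeff m = 0) {ψ : L2Sph d} (hψ : ψ ∈ (sphericalHarmonics d k).carrier) :
    (inner ℂ (axisPoly d a g) ψ : ℂ) = 0 := by
  rw [g.as_sum_support, map_sum, sum_inner]
  refine Finset.sum_eq_zero fun j hj => ?_
  have hjk : j < k := by
    by_contra! h
    exact Polynomial.mem_support_iff.1 hj (hg j h)
  rw [← mul_one (g.coeff j), ← smul_eq_mul, ← Polynomial.smul_monomial, map_smul, inner_smul_left,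
    axisPoly, LinearMap.comp_apply, AlgHom.toLinearMap_apply, Polynomial.aeval_monomial, map_one,
    one_mul, inner_harmonicsUpTo hd hjk (polyToSphere_mem_harmonicsUpTo hd j _
      (MvPolynomial.isHomogeneous_X_pow a j)) hψ, mul_zero]

/-- Invariant harmonics of degree `k` are polynomials of degree at most `k` in one coordinate. One
without a term of degree `k` is orthogonal to itself, hence zero, so an invariant harmonic is
determined by its leading coefficient. -/
theorem sphericalHarmonics_zonal {d : ℕ} (hd : 3 ≤ d) (a : Fin d) (k : ℕ) {φ ψ : L2Sph d}
    (hφ : φ ∈ (sphericalHarmonics d k).carrier) (hψ : ψ ∈ (sphericalHarmonics d k).carrier)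
    (h0 : φ ≠ 0) (hRφ : ∀ R, sphRot R (coordPoint a) = coordPoint a → sphereRep d R φ = φ)
    (hRψ : ∀ R, sphRot R (coordPoint a) = coordPoint a → sphereRep d R ψ = ψ) :
    ∃ c : ℂ, ψ = c • φ := by
  have hd' : 2 ≤ d := by omega
  have key : ∀ χ ∈ (sphericalHarmonics d k).carrier,
      (∀ R, sphRot R (coordPoint a) = coordPoint a → sphereRep d R χ = χ) →
      ∃ g : Polynomial ℂ, (∀ m, k < m → g.coeff m = 0) ∧ axisPoly d a g = χ := by
    rintro _ ⟨p, hp, rfl⟩ hR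
    obtain ⟨g, hg, hg'⟩ := exists_polynomial_of_invariant hd a (sphEval_sphRot_of_invariant hR)
    have hdeg : p.totalDegree ≤ k :=
      ((MvPolynomial.mem_homogeneousSubmodule _ _).1 hp.1).totalDegree_le
    exact ⟨g, fun m hm => hg m (hdeg.trans_lt hm), axisPoly_eq_polyToSphere hg'⟩
  obtain ⟨g₁, hg₁, rfl⟩ := key φ hφ hRφ
  obtain ⟨g₂, hg₂, rfl⟩ := key ψ hψ hRψ
  have hzero : ∀ g : Polynomial ℂ, (∀ m, k ≤ m → g.coeff m = 0) →
      axisPoly d a g ∈ (sphericalHarmonics d k).carrier → axisPoly d a g = 0 := fun g hg hmem =>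
    inner_self_eq_zero.1 (inner_axisPoly hd' a hg hmem)
  have hc : g₁.coeff k ≠ 0 := fun hc => h0 (hzero g₁ (fun m hm => by
    rcases hm.eq_or_lt with rfl | hlt
    · exact hc
    · exact hg₁ m hlt) hφ)
  -- In this combination the coefficients of degree `k` cancel.
  have h := hzero (g₁.coeff k • g₂ - g₂.coeff k • g₁) (fun m hm => by
    rw [Polynomial.coeff_sub, Polynomial.coeff_smul, Polynomial.coeff_smul, smul_eq_mul,
      smul_eq_mul]
    rcases hm.eq_or_lt with rfl | hlt
    · ring
    · rw [hg₁ m hlt, hg₂ m hlt, mul_zero, mul_zero, sub_zero]) (by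
    rw [map_sub, map_smul, map_smul]
    exact Submodule.sub_mem _ (Submodule.smul_mem _ _ hψ) (Submodule.smul_mem _ _ hφ))
  rw [map_sub, map_smul, map_smul, sub_eq_zero] at h
  refine ⟨g₂.coeff k / g₁.coeff k, ?_⟩
  rw [div_eq_inv_mul, mul_smul, ← h, smul_smul, inv_mul_cancel₀ hc, one_smul]

theorem zonalDecomposition_sphericalHarmonics {d : ℕ} (hd : 3 ≤ d) :
    ZonalDecomposition (fun k => sphericalHarmonics d k) (coordPoint (⟨0, by omega⟩ : Fin d)) where
  continuous := by
    rintro k _ ⟨p, -, rfl⟩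
    exact ⟨_, continuous_eval_sphere p, polyToSphere_ae p⟩
  ne_bot := sphericalHarmonics_ne_bot (by omega)
  orthogonal k l hkl φ hφ ψ hψ := inner_sphericalHarmonics (by omega) hkl hφ hψ
  total F hF := sphericalHarmonics_total (by omega) hF
  zonal k φ hφ ψ hψ h0 h1 h2 := sphericalHarmonics_zonal hd _ k hφ hψ h0 h1 h2

end Schroedinger

end

theorem proposition3 :
    (∀ d : ℕ, 3 ≤ d →
      ∃ S : Schroedinger.L2 d ≃ₗᵢ[ℂ] lp (fun i : ℕ => (Schroedinger.sphericalHarmonics d i).L2Radial) 2,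
        (∀ (f : Schroedinger.L2 d) (i : ℕ),
          S f i =ᵐ[MeasureTheory.volume.restrict (Set.Ioi (0 : ℝ))]
            (Schroedinger.sphericalHarmonics d i).component f) ∧
        (∀ (g : Schroedinger.SGroup d)
            (F : lp (fun i : ℕ => (Schroedinger.sphericalHarmonics d i).L2Radial) 2) (i : ℕ),
          S (Schroedinger.schroedingerRep d g (S.symm F)) i =
            (Schroedinger.sphericalHarmonics d i).tensorRep g (F i)) ∧
        (∀ i : ℕ, Schroedinger.IsIrreducibleRep (Schroedinger.sphericalHarmonics d i).tensorRep) ∧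
        (∀ i j : ℕ, i ≠ j →
          ¬ Schroedinger.AreEquivalent (Schroedinger.sphericalHarmonics d i).tensorRep
            (Schroedinger.sphericalHarmonics d j).tensorRep) ∧
        (∀ η : Schroedinger.L2 d,
          Schroedinger.IsAdmissible (Schroedinger.schroedingerRep d) η ↔
            ∀ i : ℕ, ∫⁻ ω in Set.Ioi (0 : ℝ), ‖S η i ω‖ₑ ^ 2 / ENNReal.ofReal ω =
              (Module.finrank ℂ (Schroedinger.sphericalHarmonics d i).carrier : ENNReal))) ∧
    (∃ S : Schroedinger.L2 2 ≃ₗᵢ[ℂ] lp (fun i : ℤ => (Schroedinger.fourierModes i).L2Radial) 2,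
        (∀ (f : Schroedinger.L2 2) (i : ℤ),
          S f i =ᵐ[MeasureTheory.volume.restrict (Set.Ioi (0 : ℝ))]
            (Schroedinger.fourierModes i).component f) ∧
        (∀ (g : Schroedinger.SGroup 2)
            (F : lp (fun i : ℤ => (Schroedinger.fourierModes i).L2Radial) 2) (i : ℤ),
          S (Schroedinger.schroedingerRep 2 g (S.symm F)) i =
            (Schroedinger.fourierModes i).tensorRep g (F i)) ∧
        (∀ i : ℤ, Schroedinger.IsIrreducibleRep (Schroedinger.fourierModes i).tensorRep) ∧
        (∀ i j : ℤ, i ≠ j →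
          ¬ Schroedinger.AreEquivalent (Schroedinger.fourierModes i).tensorRep
            (Schroedinger.fourierModes j).tensorRep) ∧
        (∀ η : Schroedinger.L2 2,
          Schroedinger.IsAdmissible (Schroedinger.schroedingerRep 2) η ↔
            ∀ i : ℤ, ∫⁻ ω in Set.Ioi (0 : ℝ), ‖S η i ω‖ₑ ^ 2 / ENNReal.ofReal ω =
              (Module.finrank ℂ (Schroedinger.fourierModes i).carrier : ENNReal))) := by
  refine ⟨fun d hd => ?_, ?_⟩
  · exact (Schroedinger.zonalDecomposition_sphericalHarmonics hd).exists_decomposition (by omega)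
  · exact Schroedinger.zonalDecomposition_fourierModes.exists_decomposition le_rfl
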